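/- **Conway numbers and classification of the families of alternating prime knots with at most five ribbons.** ("Knot" means knot or link; mirror images are not distinguished.) *Diagrams.* An alternating diagram on the sphere with $V\ge 1$ crossings is regarded as a directed $4$-valent plane graph: at each crossing the two edges of the upper strand leave and the two edges of the lower strand enter. Its matrix $M$ has as entry $M_{jk}$ the number of edges from $j$ to $k$; with $P(x)=\det(xI-M)$, its *Conway number* is $P'(2)/V$. At each crossing the plane is turned so that the NW and SE ends are outgoing and the NE and SW ends are incoming. A diagram is *prime* if it is connected, has no loop, and no two nonempty sets of crossings can be separated by cutting two edges. *Families.* Given a diagram on the sphere with $N$ crossings and, at each crossing, one of the directions vertical (north–south) or horizontal (east–west), replace the $i$-th crossing by a ribbon, i.e. a chain of $a_i\ge 1$ crossings in the chosen direction whose successive crossings are joined by faces with two edges. The diagrams for all $a_1,\dots,a_N\ge1$ form a *family with $N$ ribbons*, provided that the members with all $a_i\ge2$ are prime and that no two ribbons of the same direction, in this configuration or in an equivalent one, are connected one after the other so as to form only one ribbon. Its *representative knot* is the member with all $a_i=1$. Configurations of ribbons are *equivalent* if they are related by renaming the ribbons, turning crossings by a half turn, reflecting the plane, exchanging over- and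 underpasses (the last two exchange vertical and horizontal), and flypes, a flype being the commutation, without turning them, of two tangles connected in the east–west or in the north–south direction. Two ribbons are *parallel* if they have the same direction and *orthogonal* otherwise. *Theorem.* Up to equivalence there are exactly $1,1,2,5,12$ families with $N=1,2,3,4,5$ ribbons. Below they are listed with their Conway numbers, as functions of $a_1,\dots,a_N\ge1$. The Conway number of any configuration equivalent to a listed one is, up to a permutation of the variables, the listed one. Each Conway number is a sum of distinct products of distinct variables, with coefficients $1$ (the constant $1$ being allowed as the empty product). The diagram of the representative knot of every configuration in a family is, up to reflection and exchange of over- and underpasses, the standard diagram named in the list, and the number of terms equals the Conway number of the representative knot. * $N=1$ (the twist of the circle with one crossing; $1$ term): $a_1$. * $N=2$ (Hopf link; $2$ terms), two orthogonal ribbons: $1+a_1a_2$. * $N=3$ (trefoil; $3$ terms), three parallel ribbons: $a_1a_2+a_2a_3+a_3a_1$; ribbons $1,3$ parallel and ribbon $2$ orthogonal to them: $a_1a_2a_3+a_1+a_3$. * $N=4$, Solomon knot ($4$ terms), four parallel ribbons: $a_1a_2a_3+a_2a_3a_4+a_3a_4a_1+a_4a_1a_2$; ribbons $1,2,3$ parallel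 and ribbon $4$ orthogonal to them: $a_1a_2a_3a_4+a_1a_2+a_2a_3+a_3a_1$. * $N=4$, knot $4_1$ ($5$ terms); in each case ribbons $1,2$ form a tangle and ribbons $3,4$ form a tangle. With $1,2$ parallel, $3,4$ parallel, and $1,3$ orthogonal: $a_1a_2a_3a_4+(a_1+a_2)(a_3+a_4)$. With $1,2,4$ parallel and $3$ orthogonal to them: $a_1a_2a_3+(a_1+a_2)(a_3a_4+1)$. With $1,2$ orthogonal and $3,4$ orthogonal: $a_1a_2a_3a_4+a_1a_2+a_3a_4+a_1a_4+1$. * $N=5$, knot $5_1$ ($5$ terms each): $a_1a_2a_3a_4+a_2a_3a_4a_5+a_3a_4a_5a_1+a_4a_5a_1a_2+a_5a_1a_2a_3$; $a_1a_2a_3+a_2a_3a_4+a_3a_4a_1+a_4a_1a_2+a_1a_2a_3a_4a_5$. * $N=5$, knot $5_2$ ($7$ terms each): $(a_1+a_2)(a_3a_4+a_4a_5+a_5a_3)+a_1a_2a_3a_4a_5$; $(a_1a_2+1)(a_3a_4+a_4a_5+a_5a_3)+a_2a_3a_4a_5$; $(a_1+a_3+a_1a_2a_3)(a_4+a_5)+a_1a_3a_4a_5$;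 $(a_1+a_3+a_1a_2a_3)(1+a_4a_5)+a_1a_3a_5$. * $N=5$, Whitehead link $5_1^2$ ($8$ terms each): $1+a_1(a_2+a_3)+(a_3+a_4)a_5+a_1(a_2a_3+a_3a_4+a_4a_2)a_5$; $(a_1+a_2)(a_4+a_5)+a_1a_2a_3(a_4+a_5)+(a_1+a_2)a_3a_4a_5$; $(a_1+a_2)a_3(a_4+a_5)+a_1a_2(a_4+a_5)+(a_1+a_2)a_4a_5$; $a_1+a_5+a_1(a_2+a_4)a_5+(a_1a_2+1)a_3(a_4a_5+1)$; $(a_1+a_2)(a_3a_4a_5+a_3+a_5)+a_1a_2(1+a_4a_5)$; $(a_1a_2a_3+a_1+a_2)(1+a_4a_5)+(a_1+a_2)a_3a_5$. -/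

import Mathlib

namespace AltKnot

/-!
Alternating link diagrams on the sphere, up to exchanging all over- and underpasses.

At a crossing the two edges of the upper strand leave the crossing and the two edges of the lower
strand enter it, so that outgoing and incoming ends alternate around the crossing.  The plane is
turned so that the outgoing ends are NW and SE and the incoming ends are NE and SW.  The diagram
is recorded by the bijection that sends the outgoing end at which an edge starts to the incoming
end at which it arrives.
-/

/-- The outgoing ends of a crossing. -/
inductive OutEnd
  | nw
  | se
  deriving DecidableEq

instance : Fintype OutEnd := ⟨{.nw, .se}, fun o => by cases o <;> simp⟩

/-- The incoming ends of a crossing. -/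
inductive InEnd
  | ne
  | sw
  deriving DecidableEq

instance : Fintype InEnd := ⟨{.ne, .sw}, fun i => by cases i <;> simp⟩

/-- The two directions of a ribbon: north-south and east-west. -/
inductive Dir
  | vertical
  | horizontal
  deriving DecidableEq

/-- The half turn of a crossing, on outgoing ends. -/
def OutEnd.opp : OutEnd → OutEnd
  | .nw => .se
  | .se => .nw

/-- The half turn of a crossing, on incoming ends. -/
def InEnd.opp : InEnd → InEnd
  | .ne => .sw
  | .sw => .ne

/-- The other direction. -/
def Dir.other : Dir → Dir
  | .vertical => .horizontal
  | .horizontal => .vertical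

/-- Turning right at a crossing: this walks along the face to the north or to the south of it. -/
def turnRight : InEnd ≃ OutEnd where
  toFun i := match i with
    | .ne => .nw
    | .sw => .se
  invFun o := match o with
    | .nw => .ne
    | .se => .sw
  left_inv i := by cases i <;> rfl
  right_inv o := by cases o <;> rfl

/-- Turning left at a crossing: this walks along the face to the east or to the west of it. -/
def turnLeft : InEnd ≃ OutEnd where
  toFun i := match i with
    | .ne => .se
    | .sw => .nw
  invFun o := match o with
    | .nw => .sw
    | .se => .ne
  left_inv i := by cases i <;> rfl
  right_inv o := by cases o <;> rfl

/-- The exchange of the two outgoing ends. -/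
def oppEquiv : OutEnd ≃ OutEnd where
  toFun := OutEnd.opp
  invFun := OutEnd.opp
  left_inv o := by cases o <;> rfl
  right_inv o := by cases o <;> rfl

/-- An alternating diagram with set of crossings `V`, given by its directed edges. -/
@[ext] structure Diagram (V : Type) where
  edge : V × OutEnd ≃ V × InEnd

namespace Diagram

variable {V W : Type}

/-- The matrix of a diagram: the entry `(j, k)` is the number of edges from `j` to `k`. -/
def matrix [DecidableEq V] (D : Diagram V) : Matrix V V ℤ :=
  fun j k => ((Finset.univ.filter fun o : OutEnd => (D.edge (j, o)).1 = k).card : ℤ)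

/-- The Conway number: `P'(2)` divided by the number of crossings, where `P` is the
characteristic polynomial of the matrix of the diagram. -/
noncomputable def conwayNumber [Fintype V] [DecidableEq V] (D : Diagram V) : ℚ :=
  ((Polynomial.derivative D.matrix.charpoly).eval 2 : ℤ) / (Fintype.card V : ℚ)

/-- Follow an edge and turn, to the right or to the left, at its end.  The cycles are faces. -/
def facePerm (D : Diagram V) (turn : InEnd ≃ OutEnd) : Equiv.Perm (V × OutEnd) :=
  D.edge.trans (Equiv.prodCongr (Equiv.refl V) turn)

/-- The number of cycles of `facePerm`. -/
noncomputable def numFaces (D : Diagram V) (turn : InEnd ≃ OutEnd) : ℕ :=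
  Nat.card (Quotient (Equiv.Perm.SameCycle.setoid (D.facePerm turn)))

/-- Euler's formula `V - E + F = 2` with `E = 2 V`: a connected diagram lies on the sphere. -/
def IsSpherical [Fintype V] (D : Diagram V) : Prop :=
  D.numFaces turnRight + D.numFaces turnLeft = Fintype.card V + 2

/-- A prime diagram: there is no loop, and no set of crossings can be separated from the remaining
ones by cutting at most two edges.  (As many edges leave a set of crossings as enter it, so
this means that at least two edges leave.)  In particular the diagram is connected. -/
def IsPrime [Fintype V] [DecidableEq V] (D : Diagram V) : Prop :=
  (∀ o : V × OutEnd, (D.edge o).1 ≠ o.1) ∧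
  ∀ S : Finset V, S.Nonempty → S ≠ Finset.univ →
    2 ≤ (Finset.univ.filter fun o : V × OutEnd => o.1 ∈ S ∧ (D.edge o).1 ∉ S).card

/-- The reflection of the plane in the NE-SW diagonal of the crossings.
It exchanges the directions north-south and east-west. -/
def mirror (D : Diagram V) : Diagram V where
  edge := (Equiv.prodCongr (Equiv.refl V) oppEquiv).trans D.edge

/-- Exchange of over- and underpasses at all crossings: the arrows are reversed, and the crossings
are turned by a right angle, so that their ends are
renamed `NE ↦ NW ↦ SW ↦ SE ↦ NE`.
It exchanges the directions north-south and east-west. -/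
def reverse (D : Diagram V) : Diagram V where
  edge := (Equiv.prodCongr (Equiv.refl V) turnRight.symm).trans
    (D.edge.symm.trans (Equiv.prodCongr (Equiv.refl V) turnLeft.symm))

/-- `π` and the half turns of the crossings `v` with `r v = true` carry `D` to `D'`. -/
def IsIsoVia (D : Diagram V) (D' : Diagram W) (π : V ≃ W) (r : V → Bool) : Prop :=
  ∀ (v : V) (o : OutEnd),
    D'.edge (π v, if r v then o.opp else o) =
      (π (D.edge (v, o)).1,
        if r (D.edge (v, o)).1 then (D.edge (v, o)).2.opp else (D.edge (v, o)).2)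

/-- The diagrams agree up to the names of the crossings and half turns of crossings. -/
def Iso (D : Diagram V) (D' : Diagram W) : Prop :=
  ∃ (π : V ≃ W) (r : V → Bool), D.IsIsoVia D' π r

/-- The diagrams agree, where mirror images are not distinguished. -/
def Same (D : Diagram V) (D' : Diagram W) : Prop :=
  D.Iso D' ∨ D.mirror.Iso D' ∨ D.reverse.Iso D' ∨ D.mirror.reverse.Iso D'

/-- `D.SideWalk turn S i o`: the walk that enters at `i`, turns always to the same side, and does
not leave the set of crossings `S`, leads to the outgoing end `o`. -/
inductive SideWalk (D : Diagram V) (turn : InEnd ≃ OutEnd) (S : Finset V) :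
    V × InEnd → V × OutEnd → Prop
  | last (v : V) (i : InEnd) (hv : v ∈ S) : SideWalk D turn S (v, i) (v, turn i)
  | next (v : V) (i : InEnd) (o : V × OutEnd) (hv : v ∈ S)
      (h : SideWalk D turn S (D.edge (v, turn i)) o) : SideWalk D turn S (v, i) o

/-- The crossings in `S` form a tangle with the four ends `nw, ne, sw, se`: exactly these four
edges connect `S` with its complement, and the north, south, east and west side of `S` each join
the two ends that they should join. -/
structure IsTangle (D : Diagram V) (S : Finset V) (nw se : V × OutEnd) (ne sw : V × InEnd) :
    Prop where
  nw_ne_se : nw ≠ se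
  ne_ne_sw : ne ≠ sw
  out_iff : ∀ o : V × OutEnd, (o.1 ∈ S ∧ (D.edge o).1 ∉ S) ↔ (o = nw ∨ o = se)
  in_iff : ∀ i : V × InEnd, (i.1 ∈ S ∧ (D.edge.symm i).1 ∉ S) ↔ (i = ne ∨ i = sw)
  north : D.SideWalk turnRight S ne nw
  south : D.SideWalk turnRight S sw se
  east : D.SideWalk turnLeft S ne se
  west : D.SideWalk turnLeft S sw nw

/-- The crossings in `S` form a tangle. -/
def FormTangle (D : Diagram V) (S : Finset V) : Prop :=
  ∃ nw se ne sw, D.IsTangle S nw se ne sw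

/-- `D'` arises from `D` by commuting two tangles `A` and `B` of `D` that are connected by the
east side of `A` and the west side of `B`: they exchange their places, without being turned. -/
def EastWestFlype [DecidableEq V] (D D' : Diagram V) : Prop :=
  ∃ (A B : Finset V) (nwA seA nwB seB : V × OutEnd) (neA swA neB swB : V × InEnd),
    Disjoint A B ∧ D.IsTangle A nwA seA neA swA ∧ D.IsTangle B nwB seB neB swB ∧
    D.edge nwB = neA ∧ D.edge seA = swB ∧
    ∀ o, D'.edge o = Equiv.swap neA neB (Equiv.swap swA swB
      (D.edge (Equiv.swap nwA nwB (Equiv.swap seA seB o))))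

end Diagram

/-- A configuration of ribbons: one ribbon, with a direction, at each crossing of a diagram. -/
structure Config (V : Type) where
  diagram : Diagram V
  dir : V → Dir

/-- The outgoing end of the crossings of a ribbon that leads to the next crossing of it.  The
crossings are counted from south to north, or from west to east. -/
def Dir.fwd : Dir → OutEnd
  | .vertical => .nw
  | .horizontal => .se

/-- The outgoing end of the crossings of a ribbon that leads to the previous crossing of it. -/
def Dir.bwd : Dir → OutEnd
  | .vertical => .se
  | .horizontal => .nw

theorem Dir.bwd_ne_fwd (d : Dir) : d.bwd ≠ d.fwd := by cases d <;> decide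

theorem Dir.eq_bwd_of_ne {d : Dir} {o : OutEnd} (h : o ≠ d.fwd) : o = d.bwd := by
  cases d <;> cases o <;> first | rfl | exact absurd rfl h

namespace Config

variable {V : Type}

/-- The first crossing of the ribbon `v`. -/
def first (a : V → ℕ+) (v : V) : Σ v : V, Fin (a v) := ⟨v, ⟨0, (a v).pos⟩⟩

/-- The last crossing of the ribbon `v`. -/
def last (a : V → ℕ+) (v : V) : Σ v : V, Fin (a v) :=
  ⟨v, ⟨(a v : ℕ) - 1, Nat.sub_lt (a v).pos Nat.one_pos⟩⟩

/-- The incoming end of a whole ribbon: SW is at its first crossing, NE at its last crossing. -/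
def ribbonIn (a : V → ℕ+) : V × InEnd → (Σ v : V, Fin (a v)) × InEnd
  | (v, .sw) => (first a v, .sw)
  | (v, .ne) => (last a v, .ne)

/-- The outgoing end of a whole ribbon. -/
def ribbonOut (c : Config V) (a : V → ℕ+) (x : V × OutEnd) : (Σ v : V, Fin (a v)) × OutEnd :=
  if x.2 = (c.dir x.1).fwd then (last a x.1, x.2) else (first a x.1, x.2)

/-- The edges of the diagram in which the ribbon at `v` has `a v` crossings. -/
def expandTo (c : Config V) (a : V → ℕ+) :
    (Σ v : V, Fin (a v)) × OutEnd → (Σ v : V, Fin (a v)) × InEnd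
  | (⟨v, k⟩, o) =>
    if o = (c.dir v).fwd then
      if h : (k : ℕ) + 1 < a v then (⟨v, ⟨k + 1, h⟩⟩, .sw)
      else ribbonIn a (c.diagram.edge (v, o))
    else
      if 0 < (k : ℕ) then (⟨v, ⟨k - 1, lt_of_le_of_lt (Nat.sub_le _ _) k.2⟩⟩, .ne)
      else ribbonIn a (c.diagram.edge (v, o))

/-- The inverse of `expandTo`. -/
def expandFrom (c : Config V) (a : V → ℕ+) :
    (Σ v : V, Fin (a v)) × InEnd → (Σ v : V, Fin (a v)) × OutEnd
  | (⟨v, k⟩, .sw) =>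
      if 0 < (k : ℕ) then
        (⟨v, ⟨k - 1, lt_of_le_of_lt (Nat.sub_le _ _) k.2⟩⟩, (c.dir v).fwd)
      else c.ribbonOut a (c.diagram.edge.symm (v, .sw))
  | (⟨v, k⟩, .ne) =>
      if h : (k : ℕ) + 1 < a v then (⟨v, ⟨k + 1, h⟩⟩, (c.dir v).bwd)
      else c.ribbonOut a (c.diagram.edge.symm (v, .ne))

theorem expandTo_fwd (c : Config V) (a : V → ℕ+) (v : V) (k : Fin (a v)) (h : (k : ℕ) + 1 < a v) :
    c.expandTo a (⟨v, k⟩, (c.dir v).fwd) = (⟨v, ⟨k + 1, h⟩⟩, .sw) :=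
  (if_pos rfl).trans (dif_pos h)

theorem expandTo_bwd (c : Config V) (a : V → ℕ+) (v : V) (k : Fin (a v)) (h : 0 < (k : ℕ)) :
    c.expandTo a (⟨v, k⟩, (c.dir v).bwd) =
      (⟨v, ⟨k - 1, lt_of_le_of_lt (Nat.sub_le _ _) k.2⟩⟩, .ne) :=
  (if_neg (c.dir v).bwd_ne_fwd).trans (if_pos h)

theorem expandFrom_sw (c : Config V) (a : V → ℕ+) (v : V) (k : Fin (a v)) (h : 0 < (k : ℕ)) :
    c.expandFrom a (⟨v, k⟩, .sw) =
      (⟨v, ⟨k - 1, lt_of_le_of_lt (Nat.sub_le _ _) k.2⟩⟩, (c.dir v).fwd) :=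
  if_pos h

theorem expandFrom_ne (c : Config V) (a : V → ℕ+) (v : V) (k : Fin (a v))
    (h : (k : ℕ) + 1 < a v) :
    c.expandFrom a (⟨v, k⟩, .ne) = (⟨v, ⟨k + 1, h⟩⟩, (c.dir v).bwd) :=
  dif_pos h

theorem ribbonOut_fwd (c : Config V) (a : V → ℕ+) (v : V) :
    c.ribbonOut a (v, (c.dir v).fwd) = (last a v, (c.dir v).fwd) :=
  if_pos rfl

theorem ribbonOut_bwd (c : Config V) (a : V → ℕ+) (v : V) :
    c.ribbonOut a (v, (c.dir v).bwd) = (first a v, (c.dir v).bwd) :=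
  if_neg (c.dir v).bwd_ne_fwd

theorem expandFrom_ribbonIn (c : Config V) (a : V → ℕ+) (x : V × InEnd) :
    c.expandFrom a (ribbonIn a x) = c.ribbonOut a (c.diagram.edge.symm x) := by
  obtain ⟨v, i⟩ := x
  have := (a v).pos
  cases i
  · exact dif_neg (show ¬ ((a v : ℕ) - 1 + 1 < a v) by omega)
  · exact if_neg (c := 0 < (((first a v).2 : Fin _) : ℕ))
      (t := (⟨v, ⟨0 - 1, by omega⟩⟩, (c.dir v).fwd)) (lt_irrefl 0)

theorem expandTo_ribbonOut (c : Config V) (a : V → ℕ+) (x : V × OutEnd) :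
    c.expandTo a (c.ribbonOut a x) = ribbonIn a (c.diagram.edge x) := by
  obtain ⟨v, o⟩ := x
  have := (a v).pos
  by_cases h : o = (c.dir v).fwd
  · subst h
    rw [ribbonOut_fwd]
    exact (if_pos rfl).trans (dif_neg (show ¬ ((a v : ℕ) - 1 + 1 < a v) by omega))
  · obtain rfl := Dir.eq_bwd_of_ne h
    rw [ribbonOut_bwd]
    exact (if_neg h).trans (if_neg (lt_irrefl 0))

theorem eq_last (a : V → ℕ+) (v : V) (k : Fin (a v)) (h : ¬ (k : ℕ) + 1 < a v) :
    last a v = ⟨v, k⟩ := by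
  have e : (k : ℕ) = (a v : ℕ) - 1 := by have := k.2; omega
  exact congrArg (Sigma.mk v) (Fin.ext e.symm)

theorem eq_first (a : V → ℕ+) (v : V) (k : Fin (a v)) (h : ¬ 0 < (k : ℕ)) :
    first a v = ⟨v, k⟩ := by
  have e : (k : ℕ) = 0 := by omega
  exact congrArg (Sigma.mk v) (Fin.ext e.symm)

theorem expandFrom_expandTo (c : Config V) (a : V → ℕ+) (x : (Σ v : V, Fin (a v)) × OutEnd) :
    c.expandFrom a (c.expandTo a x) = x := by
  obtain ⟨⟨v, k⟩, o⟩ := x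
  by_cases ho : o = (c.dir v).fwd
  · subst ho
    by_cases h : (k : ℕ) + 1 < a v
    · rw [expandTo_fwd c a v k h, expandFrom_sw c a v _ (Nat.succ_pos _)]
      rfl
    · rw [← eq_last a v k h, ← ribbonOut_fwd, expandTo_ribbonOut, expandFrom_ribbonIn,
        Equiv.symm_apply_apply]
  · obtain rfl := Dir.eq_bwd_of_ne ho
    by_cases h : 0 < (k : ℕ)
    · have e : (k : ℕ) - 1 + 1 = k := by omega
      rw [expandTo_bwd c a v k h, expandFrom_ne c a v _ (by simp only [e]; exact k.2)]
      simp only [e]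
    · rw [← eq_first a v k h, ← ribbonOut_bwd, expandTo_ribbonOut, expandFrom_ribbonIn,
        Equiv.symm_apply_apply]

theorem expandTo_expandFrom (c : Config V) (a : V → ℕ+) (x : (Σ v : V, Fin (a v)) × InEnd) :
    c.expandTo a (c.expandFrom a x) = x := by
  obtain ⟨⟨v, k⟩, i⟩ := x
  cases i
  · by_cases h : (k : ℕ) + 1 < a v
    · rw [expandFrom_ne c a v k h, expandTo_bwd c a v _ (Nat.succ_pos _)]
      rfl
    · have e : ((⟨v, k⟩, .ne) : (Σ v : V, Fin (a v)) × InEnd) = ribbonIn a (v, .ne) :=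
        congrArg (fun y => (y, InEnd.ne)) (eq_last a v k h).symm
      rw [e, expandFrom_ribbonIn, expandTo_ribbonOut, Equiv.apply_symm_apply]
  · by_cases h : 0 < (k : ℕ)
    · have e : (k : ℕ) - 1 + 1 = k := by omega
      rw [expandFrom_sw c a v k h, expandTo_fwd c a v _ (by simp only [e]; exact k.2)]
      simp only [e]
    · have e : ((⟨v, k⟩, .sw) : (Σ v : V, Fin (a v)) × InEnd) = ribbonIn a (v, .sw) :=
        congrArg (fun y => (y, InEnd.sw)) (eq_first a v k h).symm
      rw [e, expandFrom_ribbonIn, expandTo_ribbonOut, Equiv.apply_symm_apply]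

/-- The member of the family of `c` in which the ribbon at `v` has `a v` crossings, successive
crossings of a ribbon being joined by faces of two edges. -/
def expand (c : Config V) (a : V → ℕ+) : Diagram (Σ v : V, Fin (a v)) where
  edge :=
    { toFun := c.expandTo a
      invFun := c.expandFrom a
      left_inv := c.expandFrom_expandTo a
      right_inv := c.expandTo_expandFrom a }

/-- The representative knot of a family: all crossing numbers are 1. -/
def representative (c : Config V) : Diagram (Σ _ : V, Fin ((1 : ℕ+) : ℕ)) :=
  c.expand fun _ => 1

/-- The reflected configuration. -/
def mirror (c : Config V) : Config V where
  diagram := c.diagram.mirror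
  dir v := (c.dir v).other

/-- The configuration with over- and underpasses exchanged. -/
def reverse (c : Config V) : Config V where
  diagram := c.diagram.reverse
  dir v := (c.dir v).other

/-- The configurations agree up to the names of the ribbons and half turns of ribbons. -/
def Iso (c c' : Config V) : Prop :=
  ∃ (π : V ≃ V) (r : V → Bool), c.diagram.IsIsoVia c'.diagram π r ∧ ∀ v, c'.dir (π v) = c.dir v

/-- `c'` arises from `c` by commuting two tangles connected in the east-west direction. -/
def EastWestFlype [DecidableEq V] (c c' : Config V) : Prop :=
  c.diagram.EastWestFlype c'.diagram ∧ c'.dir = c.dir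

/-- The elementary identifications of configurations. -/
inductive Step [DecidableEq V] : Config V → Config V → Prop
  | iso (c c' : Config V) (h : c.Iso c') : Step c c'
  | mirror (c : Config V) : Step c c.mirror
  | reverse (c : Config V) : Step c c.reverse
  | eastWestFlype (c c' : Config V) (h : c.EastWestFlype c') : Step c c'
  | northSouthFlype (c c' : Config V) (h : c.mirror.EastWestFlype c'.mirror) : Step c c'

/-- The configurations give the same family. -/
def Equivalent [DecidableEq V] : Config V → Config V → Prop := Relation.EqvGen Step

/-- Two different ribbons of the same direction are connected one after the other, so that they
form only one ribbon. -/
def HasMergingRibbons (c : Config V) : Prop :=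
  ∃ v w : V, v ≠ w ∧ c.dir v = c.dir w ∧
    c.diagram.edge (v, (c.dir v).fwd) = (w, .sw) ∧ c.diagram.edge (w, (c.dir v).bwd) = (v, .ne)

/-- The configuration describes a family of alternating prime knots (or links) whose number of
ribbons is the number of elements of `V`: the members with at least two crossings in each ribbon
are prime, and no two ribbons can be made into one by flypes. -/
def IsFamily [Fintype V] [DecidableEq V] (c : Config V) : Prop :=
  c.diagram.IsSpherical ∧
  (∀ a : V → ℕ+, (∀ v, 2 ≤ a v) → (c.expand a).IsPrime) ∧
  ∀ c', Equivalent c c' → ¬ c'.HasMergingRibbons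

/-- The Conway number as a function of the crossing numbers of the ribbons. -/
noncomputable def conway [Fintype V] [DecidableEq V] (c : Config V) (a : V → ℕ+) : ℚ :=
  (c.expand a).conwayNumber

end Config

/-- The ring of `n` crossings, each one to the north of the previous one, with faces of two edges
in between: the figure eight twist of the circle for `n = 1`, the Hopf link, the trefoil, the
Solomon knot and the knot `5_1` for `n = 2, 3, 4, 5`. -/
def ring (n : ℕ) [NeZero n] : Diagram (Fin n) where
  edge :=
    { toFun := fun x => match x with
        | (v, .nw) => (v + 1, .sw)
        | (v, .se) => (v - 1, .ne)
      invFun := fun x => match x with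
        | (v, .sw) => (v - 1, .nw)
        | (v, .ne) => (v + 1, .se)
      left_inv := by rintro ⟨v, _ | _⟩ <;> simp
      right_inv := by rintro ⟨v, _ | _⟩ <;> simp }

/-- A diagram together with its set of crossings. -/
abbrev SomeDiagram : Type 1 := Σ V : Type, Diagram V

/-- The standard diagram of the torus link with `n` crossings. -/
def torusLink (n : ℕ) [NeZero n] : SomeDiagram := ⟨_, ring n⟩

/-- The rational link with Conway's notation `p q`: two orthogonal ribbons, of `p` and `q`
crossings. -/
def rationalTwo (p q : ℕ+) : SomeDiagram :=
  ⟨_, (Config.mk (ring 2) ![.vertical, .horizontal]).expand ![p, q]⟩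

/-- The rational link with Conway's notation `p q r`. -/
def rationalThree (p q r : ℕ+) : SomeDiagram :=
  ⟨_, (Config.mk (ring 3) ![.horizontal, .vertical, .horizontal]).expand ![p, q, r]⟩

/-- The figure eight knot `4_1`, with Conway's notation `2 2`. -/
def knotFourOne : SomeDiagram := rationalTwo 2 2

/-- The knot `5_2`, with Conway's notation `3 2`. -/
def knotFiveTwo : SomeDiagram := rationalTwo 3 2

/-- The Whitehead link `5_1^2`, with Conway's notation `2 1 2`. -/
def whiteheadLink : SomeDiagram := rationalThree 2 1 2

/-- `F` is a sum of `t` different products of different variables, with coefficients 1. -/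
def HasTerms {N : ℕ} (F : (Fin N → ℕ) → ℕ) (t : ℕ) : Prop :=
  ∃ T : Finset (Finset (Fin N)), T.card = t ∧ ∀ a, F a = ∑ S ∈ T, ∏ i ∈ S, a i

/-- `fam` lists all families with `N` ribbons, each one once: the family `k` has the Conway number
`F k`, with `t k` terms, and belongs to the knot `K k` of `N` crossings, whose Conway number
is `t k`. -/
structure Classifies {N m : ℕ} (fam : Fin m → Config (Fin N)) (F : Fin m → (Fin N → ℕ) → ℕ)
    (t : Fin m → ℕ) (K : Fin m → SomeDiagram) : Prop where
  isFamily : ∀ k, (fam k).IsFamily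
  distinct : ∀ k l, (fam k).Equivalent (fam l) → k = l
  complete : ∀ c : Config (Fin N), c.IsFamily → ∃ k, c.Equivalent (fam k)
  conway_eq : ∀ k (a : Fin N → ℕ+), (fam k).conway a = F k fun i => (a i : ℕ)
  conway_equivalent : ∀ (c : Config (Fin N)) (k : Fin m), c.Equivalent (fam k) →
    ∃ π : Equiv.Perm (Fin N), ∀ a : Fin N → ℕ+, c.conway a = F k fun i => (a (π i) : ℕ)
  hasTerms : ∀ k, HasTerms (F k) (t k)
  representative_same : ∀ (c : Config (Fin N)) (k : Fin m), c.Equivalent (fam k) →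
    c.representative.Same (K k).2
  representative_conway : ∀ k, (fam k).representative.conwayNumber = t k

end AltKnot

set_option linter.unusedSectionVars false

namespace AltKnot

/-! Two mechanisms carry the theorem: a state sum for the Conway number, and a finite classification
that the kernel checks.

State sum. The matrix `2I - M` is the Laplacian of a graph with two outgoing and two incoming edges
at every crossing, so its rows and columns sum to zero and all its cofactors agree. Since `P'(2)` is
the sum of the diagonal cofactors, the Conway number is one cofactor, that is, the determinant of
the Laplacian with a matrix unit added (`conwayNumber_eq_det`). Along a ribbon the Laplacian is a
second difference, so a ribbon of any length is described by one value and one increment. Splitting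
off two unipotent factors and using `det (1 - PQ) = det (1 - QP)` leaves a determinant of size `2N`
(`conway_eq_det_system`). The pair `(a v, 1)` enters only one of its columns, and linearly.
Multilinear expansion selects `a v` or `1` at each ribbon. Up to unimodular changes of basis, the
remaining matrices are `1` minus a permutation matrix plus a matrix unit; their determinant is 1 if
the permutation is a single cycle and 0 otherwise (`det_permDiff`). The cycles are the circles of a
smoothed diagram. Hence in `conway_eq_sum` all coefficients are 0 or 1, and finitely many circle
counts determine the polynomial.

Classification. The members with all `a v ≥ 2` are prime exactly if the underlying diagram has no
two-edge cut and no ribbon closes up on one side into a curl (`isPrime_expand` and its converses). A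
backtracking search shows that 2, 1, 2, 3, 6 tables contain all cut free spherical diagrams with 1,
..., 5 crossings, up to renaming and half turns. A table with one of the `2 ^ N` choices of
directions is a node of a finite graph. For completeness, each node without a curl is led by flypes
and reflections to a listed family or to a pair of merging ribbons (`known_of_reach`). Conversely,
the nodes carry labels that are constant under reflection, reversal and every flype, and no labelled
node has merging ribbons, so what is listed are families (`belongs_iff`). Different families are
told apart by their Conway numbers at constant arguments. Invariance of the Conway number under
flypes is not derived in general: for each flype of the atlas the one-circle smoothings before and
after are compared. -/

theorem Dir.other_other (d : Dir) : d.other.other = d := by cases d <;> rfl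

/-- The half turn, if `b` is true, on outgoing ends. -/
def OutEnd.turn (b : Bool) (o : OutEnd) : OutEnd := if b then o.opp else o

/-- The half turn, if `b` is true, on incoming ends. -/
def InEnd.turn (b : Bool) (i : InEnd) : InEnd := if b then i.opp else i

theorem OutEnd.turn_turn (b b' : Bool) (o : OutEnd) : (o.turn b).turn b' = o.turn (b ^^ b') := by
  cases b <;> cases b' <;> cases o <;> rfl

theorem InEnd.turn_turn (b b' : Bool) (i : InEnd) : (i.turn b).turn b' = i.turn (b ^^ b') := by
  cases b <;> cases b' <;> cases i <;> rfl

@[simp] theorem OutEnd.turn_false (o : OutEnd) : o.turn false = o := rfl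
@[simp] theorem InEnd.turn_false (i : InEnd) : i.turn false = i := rfl

theorem turnRight_turn (b : Bool) (i : InEnd) : turnRight (i.turn b) = (turnRight i).turn b := by
  cases b <;> cases i <;> rfl

theorem turnLeft_turn (b : Bool) (i : InEnd) : turnLeft (i.turn b) = (turnLeft i).turn b := by
  cases b <;> cases i <;> rfl

theorem turnRight_symm_turn (b : Bool) (o : OutEnd) :
    turnRight.symm (o.turn b) = (turnRight.symm o).turn b := by
  cases b <;> cases o <;> rfl

theorem turnLeft_symm_turn (b : Bool) (o : OutEnd) :
    turnLeft.symm (o.turn b) = (turnLeft.symm o).turn b := by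
  cases b <;> cases o <;> rfl

/-! ### Isomorphisms of diagrams, reflection and reversal -/

namespace Diagram

variable {V W U : Type}

/-- The map on outgoing ends given by a renaming and half turns of crossings. -/
def outMap (π : V ≃ W) (r : V → Bool) : V × OutEnd ≃ W × OutEnd where
  toFun x := (π x.1, x.2.turn (r x.1))
  invFun y := (π.symm y.1, y.2.turn (r (π.symm y.1)))
  left_inv x := by simp [OutEnd.turn_turn]
  right_inv x := by simp [OutEnd.turn_turn]

/-- The map on incoming ends given by a renaming and half turns of crossings. -/
def inMap (π : V ≃ W) (r : V → Bool) : V × InEnd ≃ W × InEnd where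
  toFun x := (π x.1, x.2.turn (r x.1))
  invFun y := (π.symm y.1, y.2.turn (r (π.symm y.1)))
  left_inv x := by simp [InEnd.turn_turn]
  right_inv x := by simp [InEnd.turn_turn]

@[simp] theorem outMap_apply (π : V ≃ W) (r : V → Bool) (x : V × OutEnd) :
    outMap π r x = (π x.1, x.2.turn (r x.1)) := rfl

@[simp] theorem inMap_apply (π : V ≃ W) (r : V → Bool) (x : V × InEnd) :
    inMap π r x = (π x.1, x.2.turn (r x.1)) := rfl

theorem isIsoVia_iff {D : Diagram V} {D' : Diagram W} {π : V ≃ W} {r : V → Bool} :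
    D.IsIsoVia D' π r ↔ ∀ x, D'.edge (outMap π r x) = inMap π r (D.edge x) :=
  ⟨fun h x => h x.1 x.2, fun h v o => h (v, o)⟩

theorem IsIsoVia.edge_symm {D : Diagram V} {D' : Diagram W} {π : V ≃ W} {r : V → Bool}
    (h : D.IsIsoVia D' π r) (y : V × InEnd) :
    D'.edge.symm (inMap π r y) = outMap π r (D.edge.symm y) := by
  rw [Equiv.symm_apply_eq, isIsoVia_iff.1 h, Equiv.apply_symm_apply]

/-- The diagram with renamed and turned crossings. -/
def relabel (D : Diagram V) (π : V ≃ W) (r : V → Bool) : Diagram W where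
  edge := (outMap π r).symm.trans (D.edge.trans (inMap π r))

theorem isIsoVia_relabel (D : Diagram V) (π : V ≃ W) (r : V → Bool) :
    D.IsIsoVia (D.relabel π r) π r :=
  isIsoVia_iff.2 fun x => by
    simp only [relabel, Equiv.trans_apply, Equiv.symm_apply_apply]

theorem IsIsoVia.symm {D : Diagram V} {D' : Diagram W} {π : V ≃ W} {r : V → Bool}
    (h : D.IsIsoVia D' π r) : D'.IsIsoVia D π.symm (r ∘ π.symm) := by
  rw [isIsoVia_iff] at h ⊢
  intro y
  obtain ⟨x, rfl⟩ := (outMap π r).surjective y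
  rw [h]
  simp [OutEnd.turn_turn, InEnd.turn_turn]

theorem IsIsoVia.trans {D : Diagram V} {D' : Diagram W} {D'' : Diagram U} {π : V ≃ W}
    {r : V → Bool} {π' : W ≃ U} {r' : W → Bool}
    (h : D.IsIsoVia D' π r) (h' : D'.IsIsoVia D'' π' r') :
    D.IsIsoVia D'' (π.trans π') fun v => r v ^^ r' (π v) := by
  rw [isIsoVia_iff] at h h' ⊢
  intro x
  have := h' (outMap π r x)
  rw [h] at this
  simpa [OutEnd.turn_turn, InEnd.turn_turn] using this

theorem IsIsoVia.mirror {D : Diagram V} {D' : Diagram W} {π : V ≃ W} {r : V → Bool}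
    (h : D.IsIsoVia D' π r) : D.mirror.IsIsoVia D'.mirror π r := by
  rw [isIsoVia_iff] at h ⊢
  intro x
  have := h (x.1, x.2.opp)
  simp only [Diagram.mirror, Equiv.trans_apply]
  rw [show (Equiv.prodCongr (Equiv.refl V) oppEquiv) x = (x.1, x.2.opp) from rfl, ← this]
  obtain ⟨v, o⟩ := x
  cases h : r v <;> cases o <;> simp [h, OutEnd.turn, oppEquiv]

theorem IsIsoVia.reverse {D : Diagram V} {D' : Diagram W} {π : V ≃ W} {r : V → Bool}
    (h : D.IsIsoVia D' π r) : D.reverse.IsIsoVia D'.reverse π r := by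
  rw [isIsoVia_iff]
  intro x
  have := h.edge_symm (x.1, turnRight.symm x.2)
  simp only [Diagram.reverse, Equiv.trans_apply, outMap_apply, inMap_apply, Equiv.prodCongr_apply,
    Prod.map, Equiv.refl_apply, turnRight_symm_turn] at this ⊢
  rw [this, turnLeft_symm_turn]

theorem Iso.symm {D : Diagram V} {D' : Diagram W} : D.Iso D' → D'.Iso D :=
  fun ⟨_, _, h⟩ => ⟨_, _, h.symm⟩

theorem Iso.trans {D : Diagram V} {D' : Diagram W} {D'' : Diagram U} :
    D.Iso D' → D'.Iso D'' → D.Iso D'' :=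
  fun ⟨_, _, h⟩ ⟨_, _, h'⟩ => ⟨_, _, h.trans h'⟩

theorem Iso.mirror {D : Diagram V} {D' : Diagram W} : D.Iso D' → D.mirror.Iso D'.mirror :=
  fun ⟨_, _, h⟩ => ⟨_, _, h.mirror⟩

theorem Iso.reverse {D : Diagram V} {D' : Diagram W} : D.Iso D' → D.reverse.Iso D'.reverse :=
  fun ⟨_, _, h⟩ => ⟨_, _, h.reverse⟩

theorem Same.of_iso_left {D : Diagram V} {D' : Diagram W} {E : Diagram U} (h : D.Iso D') :
    D'.Same E → D.Same E
  | .inl h' => .inl (h.trans h')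
  | .inr (.inl h') => .inr (.inl (h.mirror.trans h'))
  | .inr (.inr (.inl h')) => .inr (.inr (.inl (h.reverse.trans h')))
  | .inr (.inr (.inr h')) => .inr (.inr (.inr (h.mirror.reverse.trans h')))

theorem mirror_mirror (D : Diagram V) : D.mirror.mirror = D := by
  ext x <;> obtain ⟨v, _ | _⟩ := x <;> rfl

/-- Each reversal turns the crossings by a right angle in the same sense, so two of them leave a
half turn of every crossing, not the identity. -/
theorem reverse_reverse (D : Diagram V) :
    D.reverse.reverse.IsIsoVia D (Equiv.refl V) fun _ => true := by
  intro v o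
  obtain ⟨y, hy⟩ : ∃ y, D.reverse.reverse.edge (v, o) = y := ⟨_, rfl⟩
  have h₁ : D.reverse.edge (y.1, turnLeft y.2) = (v, turnRight.symm o) := by
    rw [← Equiv.eq_symm_apply, ← hy]
    simp [Diagram.reverse]
    rfl
  have h₂ : D.edge.symm (y.1, turnRight.symm (turnLeft y.2)) =
      (v, turnLeft (turnRight.symm o)) := by
    have := congrArg (Equiv.prodCongr (Equiv.refl V) turnLeft) h₁
    simpa [Diagram.reverse, Prod.map] using this
  rw [Equiv.symm_apply_eq] at h₂
  have h₃ : turnLeft (turnRight.symm o) = o.opp := by cases o <;> rfl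
  have h₄ (i : InEnd) : turnRight.symm (turnLeft i) = i.opp := by cases i <;> rfl
  rw [h₃, h₄] at h₂
  rw [hy]
  exact h₂.symm

end Diagram

namespace Config

variable {V : Type}

theorem mirror_mirror (c : Config V) : c.mirror.mirror = c := by
  cases c
  simp [mirror, Diagram.mirror_mirror, Dir.other_other]

theorem Iso.symm {c c' : Config V} : c.Iso c' → c'.Iso c :=
  fun ⟨π, _, h, hd⟩ => ⟨_, _, h.symm, fun v => by rw [← hd, Equiv.apply_symm_apply]⟩

theorem Iso.trans {c c' c'' : Config V} : c.Iso c' → c'.Iso c'' → c.Iso c'' :=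
  fun ⟨_, _, h, hd⟩ ⟨_, _, h', hd'⟩ => ⟨_, _, h.trans h', fun v => by
    rw [← hd, ← hd']; rfl⟩

theorem Iso.mirror {c c' : Config V} : c.Iso c' → c.mirror.Iso c'.mirror :=
  fun ⟨_, _, h, hd⟩ => ⟨_, _, h.mirror, fun v => congrArg Dir.other (hd v)⟩

theorem Iso.reverse {c c' : Config V} : c.Iso c' → c.reverse.Iso c'.reverse :=
  fun ⟨_, _, h, hd⟩ => ⟨_, _, h.reverse, fun v => congrArg Dir.other (hd v)⟩

theorem reverse_reverse (c : Config V) : c.reverse.reverse.Iso c :=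
  ⟨_, _, Diagram.reverse_reverse _, fun _ => (Dir.other_other _).symm⟩

end Config
-- Tangles and flypes under isomorphisms; symmetry of flypes
namespace Diagram

variable {V W : Type}

theorem SideWalk.fst_mem {D : Diagram V} {turn : InEnd ≃ OutEnd} {S : Finset V} {i : V × InEnd}
    {o : V × OutEnd} (h : D.SideWalk turn S i o) : i.1 ∈ S := by
  cases h <;> assumption

/-- A half turn commutes with turning right and with turning left, so a walk along one side of a set
of crossings stays on that side. -/
theorem SideWalk.map {D : Diagram V} {E : Diagram W} {π : V ≃ W} {r : V → Bool}
    (hE : D.IsIsoVia E π r) {turn : InEnd ≃ OutEnd}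
    (ht : ∀ b i, turn (i.turn b) = (turn i).turn b) {S : Finset V} {i : V × InEnd}
    {o : V × OutEnd} (h : D.SideWalk turn S i o) :
    E.SideWalk turn (S.map π.toEmbedding) (inMap π r i) (outMap π r o) := by
  induction h with
  | last v i hv =>
    have := SideWalk.last (D := E) (turn := turn) (π v) (i.turn (r v))
      (Finset.mem_map_of_mem π.toEmbedding hv)
    rwa [ht] at this
  | next v i o hv _ ih =>
    refine SideWalk.next (π v) (i.turn (r v)) _ (Finset.mem_map_of_mem π.toEmbedding hv) ?_
    have := isIsoVia_iff.1 hE (v, turn i)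
    rw [ht]
    rw [outMap_apply] at this
    rw [this]
    exact ih

theorem IsTangle.map {D : Diagram V} {E : Diagram W} {π : V ≃ W} {r : V → Bool}
    (hE : D.IsIsoVia E π r) {S : Finset V} {nw se : V × OutEnd} {ne sw : V × InEnd}
    (h : D.IsTangle S nw se ne sw) :
    E.IsTangle (S.map π.toEmbedding) (outMap π r nw) (outMap π r se) (inMap π r ne)
      (inMap π r sw) where
  nw_ne_se := (outMap π r).injective.ne h.nw_ne_se
  ne_ne_sw := (inMap π r).injective.ne h.ne_ne_sw
  out_iff o := by
    obtain ⟨o, rfl⟩ := (outMap π r).surjective o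
    rw [isIsoVia_iff.1 hE, (outMap π r).injective.eq_iff, (outMap π r).injective.eq_iff,
      ← h.out_iff]
    simp
  in_iff i := by
    obtain ⟨i, rfl⟩ := (inMap π r).surjective i
    rw [hE.edge_symm, (inMap π r).injective.eq_iff, (inMap π r).injective.eq_iff, ← h.in_iff]
    simp
  north := h.north.map hE turnRight_turn
  south := h.south.map hE turnRight_turn
  east := h.east.map hE turnLeft_turn
  west := h.west.map hE turnLeft_turn

theorem EastWestFlype.map [DecidableEq V] [DecidableEq W] {D D' : Diagram V} {E : Diagram W}
    {π : V ≃ W} {r : V → Bool} (hE : D.IsIsoVia E π r) (h : D.EastWestFlype D') :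
    E.EastWestFlype (D'.relabel π r) := by
  obtain ⟨A, B, nwA, seA, nwB, seB, neA, swA, neB, swB, hAB, hA, hB, h₁, h₂, h₃⟩ := h
  refine ⟨_, _, _, _, _, _, _, _, _, _, ?_, hA.map hE, hB.map hE, ?_, ?_, fun o => ?_⟩
  · exact (Finset.disjoint_map _).2 hAB
  · rw [isIsoVia_iff.1 hE, h₁]
  · rw [isIsoVia_iff.1 hE, h₂]
  · obtain ⟨o, rfl⟩ := (outMap π r).surjective o
    rw [isIsoVia_iff.1 (isIsoVia_relabel D' π r), h₃]
    simp only [(outMap π r).injective.swap_apply, (inMap π r).injective.swap_apply,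
      isIsoVia_iff.1 hE]

/-- Being a tangle depends only on the edges inside `S`: the four side walks use no others. Rewiring
outside is harmless as long as the two outgoing ends still leave `S`; by bijectivity the incoming
ends then take care of themselves. -/
theorem IsTangle.congr {D D' : Diagram V} {S : Finset V} {nw se : V × OutEnd}
    {ne sw : V × InEnd} (h : D.IsTangle S nw se ne sw)
    (hD : ∀ o : V × OutEnd, o.1 ∈ S → o ≠ nw → o ≠ se → D'.edge o = D.edge o)
    (hnw : (D'.edge nw).1 ∉ S) (hse : (D'.edge se).1 ∉ S) : D'.IsTangle S nw se ne sw := by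
  have inner {o : V × OutEnd} (ho : o.1 ∈ S) (he : (D.edge o).1 ∈ S) : D'.edge o = D.edge o := by
    refine hD o ho ?_ ?_ <;> rintro rfl
    · exact ((h.out_iff _).2 (Or.inl rfl)).2 he
    · exact ((h.out_iff _).2 (Or.inr rfl)).2 he
  have walk {turn : InEnd ≃ OutEnd} {i : V × InEnd} {o : V × OutEnd}
      (w : D.SideWalk turn S i o) : D'.SideWalk turn S i o := by
    induction w with
    | last v i hv => exact .last v i hv
    | next v i o hv w ih =>
      refine .next v i o hv ?_
      rwa [inner hv w.fst_mem]
  refine ⟨h.nw_ne_se, h.ne_ne_sw, fun o => ?_, fun i => ?_, walk h.north, walk h.south,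
    walk h.east, walk h.west⟩
  · by_cases ho : o = nw ∨ o = se
    · simp only [ho, iff_true]
      refine ⟨((h.out_iff o).2 ho).1, ?_⟩
      rcases ho with rfl | rfl <;> assumption
    · simp only [ho, iff_false]
      rintro ⟨h₁, h₂⟩
      rw [hD o h₁ (fun e => ho (.inl e)) (fun e => ho (.inr e))] at h₂
      exact ho ((h.out_iff o).1 ⟨h₁, h₂⟩)
  · rw [← h.in_iff]
    refine and_congr_right fun hi => not_congr ?_
    constructor
    · intro h₁
      have h₂ : D'.edge (D'.edge.symm i) = i := D'.edge.apply_symm_apply i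
      have h₃ := hD _ h₁ (fun e => hnw (by rw [← e, h₂]; exact hi))
        (fun e => hse (by rw [← e, h₂]; exact hi))
      rw [h₂] at h₃
      rw [h₃, Equiv.symm_apply_apply]
      exact h₁
    · intro h₁
      have h₂ : D.edge (D.edge.symm i) = i := D.edge.apply_symm_apply i
      have h₃ := inner h₁ (by rw [h₂]; exact hi)
      rw [h₂, ← Equiv.eq_symm_apply] at h₃
      rwa [← h₃]

theorem swap_swap_comm {α : Type*} [DecidableEq α] {a b c d : α} (hac : a ≠ c) (had : a ≠ d)
    (hbc : b ≠ c) (hbd : b ≠ d) (x : α) :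
    Equiv.swap a b (Equiv.swap c d x) = Equiv.swap c d (Equiv.swap a b x) := by
  simp only [Equiv.swap_apply_def]
  split_ifs <;> simp_all

/-- After the flype `B` lies west of `A`, and both are still tangles with the same ends; commuting
them again, with exchanged roles, undoes the product of transpositions. -/
theorem EastWestFlype.symm [DecidableEq V] {D D' : Diagram V} (h : D.EastWestFlype D') :
    D'.EastWestFlype D := by
  obtain ⟨A, B, nwA, seA, nwB, seB, neA, swA, neB, swB, hAB, hA, hB, h₁, h₂, h₃⟩ := h
  have nwA_mem := (hA.out_iff _).2 (Or.inl rfl)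
  have seA_mem := (hA.out_iff _).2 (Or.inr rfl)
  have nwB_mem := (hB.out_iff _).2 (Or.inl rfl)
  have seB_mem := (hB.out_iff _).2 (Or.inr rfl)
  have neA_mem := (hA.in_iff _).2 (Or.inl rfl)
  have swA_mem := (hA.in_iff _).2 (Or.inr rfl)
  have neB_mem := (hB.in_iff _).2 (Or.inl rfl)
  have swB_mem := (hB.in_iff _).2 (Or.inr rfl)
  have disj {α : Type} {x y : V × α} (hx : x.1 ∈ A) (hy : y.1 ∈ B) : x ≠ y := by
    rintro rfl
    exact Finset.disjoint_left.1 hAB hx hy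
  have notB {v : V} (hv : v ∈ A) : v ∉ B := Finset.disjoint_left.1 hAB hv
  have notA {v : V} (hv : v ∈ B) : v ∉ A := Finset.disjoint_right.1 hAB hv
  have fixOut {o : V × OutEnd} (h₁ : o ≠ nwA) (h₂ : o ≠ nwB) (h₃ : o ≠ seA) (h₄ : o ≠ seB) :
      Equiv.swap nwA nwB (Equiv.swap seA seB o) = o := by
    rw [Equiv.swap_apply_of_ne_of_ne h₃ h₄, Equiv.swap_apply_of_ne_of_ne h₁ h₂]
  have fixIn {i : V × InEnd} (h₁ : i ≠ neA) (h₂ : i ≠ neB) (h₃ : i ≠ swA) (h₄ : i ≠ swB) :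
      Equiv.swap neA neB (Equiv.swap swA swB i) = i := by
    rw [Equiv.swap_apply_of_ne_of_ne h₃ h₄, Equiv.swap_apply_of_ne_of_ne h₁ h₂]
  have e₁ : D'.edge nwA = neB := by
    rw [h₃, Equiv.swap_apply_of_ne_of_ne hA.nw_ne_se (disj nwA_mem.1 seB_mem.1),
      Equiv.swap_apply_left, h₁,
      Equiv.swap_apply_of_ne_of_ne hA.ne_ne_sw (disj neA_mem.1 swB_mem.1), Equiv.swap_apply_left]
  have e₂ : D'.edge seB = swA := by
    rw [h₃, Equiv.swap_apply_right,
      Equiv.swap_apply_of_ne_of_ne hA.nw_ne_se.symm (disj seA_mem.1 nwB_mem.1), h₂,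
      Equiv.swap_apply_right,
      Equiv.swap_apply_of_ne_of_ne hA.ne_ne_sw.symm (disj swA_mem.1 neB_mem.1)]
  -- The ends `seA` and `nwB` now lead outwards. The case distinction is whether the outer ends of
  -- `A` and `B` were joined directly, since then the transpositions move the target as well.
  have e₃ : (D'.edge seA).1 ∉ A := by
    rw [h₃, Equiv.swap_apply_left, Equiv.swap_apply_of_ne_of_ne
      (disj nwA_mem.1 seB_mem.1).symm hB.nw_ne_se.symm]
    by_cases hs : D.edge seB = swA
    · rw [hs, Equiv.swap_apply_left, Equiv.swap_apply_of_ne_of_ne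
        (disj neA_mem.1 swB_mem.1).symm hB.ne_ne_sw.symm]
      exact notA swB_mem.1
    · have hn : D.edge seB ≠ neA := fun e => hB.nw_ne_se (D.edge.injective (h₁.trans e.symm))
      rw [fixIn hn (fun e => seB_mem.2 (e ▸ neB_mem.1)) hs (fun e => seB_mem.2 (e ▸ swB_mem.1))]
      intro hm
      rcases (hA.in_iff _).1 ⟨hm, by rw [Equiv.symm_apply_apply]; exact notA seB_mem.1⟩ with e | e
      · exact hn e
      · exact hs e
  have e₄ : (D'.edge nwB).1 ∉ B := by
    rw [h₃, Equiv.swap_apply_of_ne_of_ne (disj seA_mem.1 nwB_mem.1).symm hB.nw_ne_se,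
      Equiv.swap_apply_right]
    by_cases hs : D.edge nwA = neB
    · rw [hs, Equiv.swap_apply_of_ne_of_ne (disj swA_mem.1 neB_mem.1).symm hB.ne_ne_sw,
        Equiv.swap_apply_right]
      exact notB neA_mem.1
    · have hn : D.edge nwA ≠ swB := fun e => hA.nw_ne_se (D.edge.injective (e.trans h₂.symm))
      rw [fixIn (fun e => nwA_mem.2 (by rw [e]; exact neA_mem.1)) hs
        (fun e => nwA_mem.2 (by rw [e]; exact swA_mem.1)) hn]
      intro hm
      rcases (hB.in_iff _).1 ⟨hm, by rw [Equiv.symm_apply_apply]; exact notB nwA_mem.1⟩ with e | e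
      · exact hs e
      · exact hn e
  refine ⟨B, A, nwB, seB, nwA, seA, neB, swB, neA, swA, hAB.symm, ?_, ?_, e₁, e₂, fun o => ?_⟩
  · refine hB.congr (fun o ho hn hs => ?_) e₄ (by rw [e₂]; exact notB swA_mem.1)
    have hm : (D.edge o).1 ∈ B := by
      by_contra hm
      rcases (hB.out_iff o).1 ⟨ho, hm⟩ with e | e
      · exact hn e
      · exact hs e
    have ho' : (D.edge.symm (D.edge o)).1 ∈ B := by rwa [Equiv.symm_apply_apply]
    rw [h₃, fixOut (disj nwA_mem.1 ho).symm hn (disj seA_mem.1 ho).symm hs,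
      fixIn (disj neA_mem.1 hm).symm (fun e => neB_mem.2 (e ▸ ho')) (disj swA_mem.1 hm).symm
        (fun e => swB_mem.2 (e ▸ ho'))]
  · refine hA.congr (fun o ho hn hs => ?_) (by rw [e₁]; exact notA neB_mem.1) e₃
    have hm : (D.edge o).1 ∈ A := by
      by_contra hm
      rcases (hA.out_iff o).1 ⟨ho, hm⟩ with e | e
      · exact hn e
      · exact hs e
    have ho' : (D.edge.symm (D.edge o)).1 ∈ A := by rwa [Equiv.symm_apply_apply]
    rw [h₃, fixOut hn (disj ho nwB_mem.1) hs (disj ho seB_mem.1),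
      fixIn (fun e => neA_mem.2 (e ▸ ho')) (disj hm neB_mem.1) (fun e => swA_mem.2 (e ▸ ho'))
        (disj hm swB_mem.1)]
  · rw [h₃]
    have c₁ := swap_swap_comm hA.ne_ne_sw (disj neA_mem.1 swB_mem.1)
      (disj swA_mem.1 neB_mem.1).symm hB.ne_ne_sw
    have c₂ := swap_swap_comm hA.nw_ne_se (disj nwA_mem.1 seB_mem.1)
      (disj seA_mem.1 nwB_mem.1).symm hB.nw_ne_se
    rw [Equiv.swap_comm neB, Equiv.swap_comm swB, Equiv.swap_comm nwB, Equiv.swap_comm seB,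
      c₁, Equiv.swap_apply_self, Equiv.swap_apply_self, c₂, Equiv.swap_apply_self,
      Equiv.swap_apply_self]

end Diagram

/-! ### Properties invariant under equivalence -/

namespace Config

variable {V : Type} [DecidableEq V]

theorem EastWestFlype.symm {c c' : Config V} (h : c.EastWestFlype c') : c'.EastWestFlype c :=
  ⟨h.1.symm, h.2.symm⟩

/-- A flype can be carried along an isomorphism. -/
theorem EastWestFlype.exists_of_iso {c c' e : Config V} (h : c.EastWestFlype c') (hi : c.Iso e) :
    ∃ e', e.EastWestFlype e' ∧ c'.Iso e' := by
  obtain ⟨π, r, hπ, hd⟩ := hi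
  refine ⟨⟨c'.diagram.relabel π r, e.dir⟩, ⟨h.1.map hπ, rfl⟩, π, r,
    Diagram.isIsoVia_relabel _ _ _, fun v => ?_⟩
  rw [h.2]
  exact hd v

/-- A property of configurations that is respected by the elementary identifications in one
direction is respected by equivalence. -/
theorem Equivalent.of_closed {P : Config V → Prop} (hiso : ∀ c c', c.Iso c' → P c → P c')
    (hmirror : ∀ c, P c → P c.mirror) (hreverse : ∀ c, P c → P c.reverse)
    (hflype : ∀ c c', c.EastWestFlype c' → P c → P c') {c c' : Config V} (h : c.Equivalent c') :
    P c ↔ P c' := by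
  have hm (c : Config V) : P c.mirror → P c := fun h => by
    simpa only [mirror_mirror] using hmirror _ h
  induction h with
  | rel c c' h =>
    cases h with
    | iso _ h => exact ⟨hiso _ _ h, hiso _ _ h.symm⟩
    | mirror => exact ⟨hmirror c, hm c⟩
    | reverse => exact ⟨hreverse c, fun h => hiso _ _ (reverse_reverse c) (hreverse _ h)⟩
    | eastWestFlype _ h => exact ⟨hflype _ _ h, hflype _ _ h.symm⟩
    -- A north-south flype is an east-west flype conjugated by the reflection, so it needs no
    -- hypothesis of its own.
    | northSouthFlype _ h =>
      exact ⟨fun p => hm _ (hflype _ _ h (hmirror _ p)),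
        fun p => hm _ (hflype _ _ h.symm (hmirror _ p))⟩
  | refl => rfl
  | symm _ _ _ ih => exact ih.symm
  | trans _ _ _ _ _ ih₁ ih₂ => exact ih₁.trans ih₂

end Config

/-! ### Cofactors, rank one perturbations and permutation matrices -/

section LinearAlgebra

variable {ι κ : Type}

/-- The coordinate `j`. -/
def coord (j : ι) : (ι → ℤ) →ₗ[ℤ] ℤ := LinearMap.proj j

@[simp] theorem coord_apply (j : ι) (x : ι → ℤ) : coord j x = x j := rfl

/-- The endomorphism `x ↦ (x i - x (σ i))`. -/
def permDiff (σ : Equiv.Perm ι) : (ι → ℤ) →ₗ[ℤ] (ι → ℤ) := 1 - LinearMap.funLeft ℤ ℤ σ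

theorem permDiff_apply (σ : Equiv.Perm ι) (x : ι → ℤ) (i : ι) :
    permDiff σ x i = x i - x (σ i) := rfl

/-- The endomorphism `f` with `φ` added to its coordinate `i`. -/
def addAt [DecidableEq ι] (f : (ι → ℤ) →ₗ[ℤ] (ι → ℤ)) (i : ι) (φ : (ι → ℤ) →ₗ[ℤ] ℤ) :
    (ι → ℤ) →ₗ[ℤ] (ι → ℤ) :=
  f + (LinearMap.single ℤ (fun _ => ℤ) i).comp φ

theorem addAt_apply [DecidableEq ι] (f : (ι → ℤ) →ₗ[ℤ] (ι → ℤ)) (i : ι) (φ : (ι → ℤ) →ₗ[ℤ] ℤ)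
    (x : ι → ℤ) (j : ι) : addAt f i φ x j = f x j + if j = i then φ x else 0 := by
  simp [addAt, Pi.single_apply]

variable [Fintype ι] [DecidableEq ι] [Fintype κ] [DecidableEq κ]

theorem derivative_det {R : Type*} [CommRing R] (A : Matrix ι ι (Polynomial R)) :
    Polynomial.derivative A.det =
      ∑ i, (A.updateCol i fun j => Polynomial.derivative (A j i)).det := by
  simp only [Matrix.det_apply, Polynomial.derivative_sum, Polynomial.derivative_smul,
    Polynomial.derivative_prod_finset]
  rw [Finset.sum_comm]
  refine Finset.sum_congr rfl fun σ _ => ?_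
  rw [← Finset.smul_sum]
  congr 1
  refine Finset.sum_congr rfl fun i _ => ?_
  rw [← Finset.mul_prod_erase Finset.univ _ (Finset.mem_univ i), Matrix.updateCol_self, mul_comm]
  congr 1
  refine Finset.prod_congr rfl fun j hj => ?_
  rw [Matrix.updateCol_ne (Finset.ne_of_mem_erase hj)]

/-- The column `i` of `XI - M` has the derivative `e i`; differentiating column by column gives the
sum of the diagonal cofactors of `xI - M`. -/
theorem derivative_charpoly_eval {R : Type*} [CommRing R] (M : Matrix ι ι R) (x : R) :
    (Polynomial.derivative M.charpoly).eval x =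
      ∑ i, ((Matrix.scalar ι x - M).updateCol i (Pi.single i 1)).det := by
  rw [Matrix.charpoly, derivative_det, Polynomial.eval_finsetSum]
  refine Finset.sum_congr rfl fun i _ => ?_
  rw [← Polynomial.coe_evalRingHom, RingHom.map_det]
  congr 1
  ext j k
  by_cases hk : k = i
  · subst hk
    by_cases hj : j = k
    · subst hj; simp [Matrix.charmatrix_apply]
    · simp [Matrix.charmatrix_apply, hj]
  · by_cases hj : j = k
    · subst hj; simp [Matrix.charmatrix_apply, hk]
    · simp [Matrix.charmatrix_apply, hk, hj]

theorem det_one_sub_comp_comm (P : (κ → ℤ) →ₗ[ℤ] (ι → ℤ)) (Q : (ι → ℤ) →ₗ[ℤ] (κ → ℤ)) :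
    LinearMap.det (1 - P.comp Q) = LinearMap.det (1 - Q.comp P) := by
  have := Matrix.det_one_sub_mul_comm (LinearMap.toMatrix' P) (LinearMap.toMatrix' Q)
  rwa [← LinearMap.toMatrix'_comp, ← LinearMap.toMatrix'_comp, ← LinearMap.toMatrix'_one,
    ← LinearMap.toMatrix'_one, ← map_sub, ← map_sub, LinearMap.det_toMatrix',
    LinearMap.det_toMatrix'] at this

/-- The characteristic polynomial differs from a power of `X` by a nilpotent polynomial, which is
zero because `ℤ` is reduced; evaluation at 1 gives the claim. -/
theorem det_one_sub_of_isNilpotent {f : (ι → ℤ) →ₗ[ℤ] (ι → ℤ)} (h : IsNilpotent f) :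
    LinearMap.det (1 - f) = 1 := by
  have hM : IsNilpotent (LinearMap.toMatrix' f) := by
    obtain ⟨n, hn⟩ := h
    refine ⟨n, ?_⟩
    have := (map_pow LinearMap.toMatrixAlgEquiv' f n).symm
    rwa [hn, map_zero] at this
  have h₁ := (Matrix.isNilpotent_charpoly_sub_pow_of_isNilpotent hM).eq_zero
  have h₂ := congrArg (Polynomial.eval 1) (sub_eq_zero.1 h₁)
  rw [Matrix.eval_charpoly, Polynomial.eval_pow, Polynomial.eval_X, one_pow, map_one,
    ← LinearMap.toMatrix'_one, ← map_sub, LinearMap.det_toMatrix'] at h₂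
  exact h₂

/-- In an endomorphism with zero column sums the place of a rank one perturbation can be moved. -/
theorem det_addAt_row {f : (ι → ℤ) →ₗ[ℤ] (ι → ℤ)} (hf : ∀ x, ∑ j, f x j = 0) (i i' : ι)
    (φ : (ι → ℤ) →ₗ[ℤ] ℤ) : LinearMap.det (addAt f i φ) = LinearMap.det (addAt f i' φ) := by
  let σ : (ι → ℤ) →ₗ[ℤ] ℤ := ∑ j, coord j
  have hσ (x : ι → ℤ) : σ x = ∑ j, x j := by simp [σ]
  -- The row operation that moves the sum of all coordinates from place `i` to place `i'`. It
  -- ignores the range of `f` and is unipotent, as `σ` vanishes on `e i - e i'`.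
  let T : (ι → ℤ) →ₗ[ℤ] (ι → ℤ) :=
    1 - (LinearMap.toSpanSingleton ℤ (ι → ℤ) (Pi.single i 1 - Pi.single i' 1)).comp σ
  have hT : LinearMap.det T = 1 := by
    refine det_one_sub_of_isNilpotent ⟨2, ?_⟩
    ext x
    simp [pow_two, hσ]
  have : addAt f i' φ = T * addAt f i φ := by
    refine LinearMap.ext fun x => funext fun j => ?_
    have h : σ (addAt f i φ x) = φ x := by
      simp only [hσ, addAt_apply, Finset.sum_add_distrib, hf]
      simp
    simp only [T, Module.End.mul_apply, LinearMap.sub_apply, LinearMap.comp_apply, h, addAt_apply,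
      Pi.sub_apply, Module.End.one_apply, LinearMap.toSpanSingleton_apply, Pi.smul_apply,
      Pi.single_apply, smul_eq_mul, mul_sub, mul_ite, mul_one, mul_zero]
    ring
  rw [this, map_mul, hT, one_mul]

/-- In an endomorphism with zero row sums the functional of a rank one perturbation can be
changed. -/
theorem det_addAt_proj {f : (ι → ℤ) →ₗ[ℤ] (ι → ℤ)} (hf : f (fun _ => 1) = 0) (i j j' : ι) :
    LinearMap.det (addAt f i (coord j)) = LinearMap.det (addAt f i (coord j')) := by
  let δ : (ι → ℤ) →ₗ[ℤ] ℤ := coord j - coord j'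
  -- The dual operation: it changes `x` by a constant vector, which `f` kills, so that its
  -- coordinate `j` becomes `x j'`.
  let T : (ι → ℤ) →ₗ[ℤ] (ι → ℤ) :=
    1 - (LinearMap.toSpanSingleton ℤ (ι → ℤ) (fun _ => 1)).comp δ
  have hT : LinearMap.det T = 1 := by
    refine det_one_sub_of_isNilpotent ⟨2, ?_⟩
    ext x
    simp [pow_two, δ]
  have : addAt f i (coord j') = addAt f i (coord j) * T := by
    refine LinearMap.ext fun x => funext fun k => ?_
    have h : f ((x j - x j') • fun _ => 1) = 0 := by rw [map_smul, hf, smul_zero]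
    have h' : T x = x - (x j - x j') • fun _ => 1 := rfl
    rw [Module.End.mul_apply, h', addAt_apply, addAt_apply, map_sub, h, sub_zero]
    simp
  rw [this, map_mul, hT, mul_one]

/-- The sum of the diagonal cofactors of an endomorphism with zero row and column sums. -/
theorem sum_det_updateCol {f : (ι → ℤ) →ₗ[ℤ] (ι → ℤ)} (hr : f (fun _ => 1) = 0)
    (hc : ∀ x, ∑ j, f x j = 0) (i j : ι) :
    ∑ k, ((LinearMap.toMatrix' f).updateCol k (Pi.single k 1)).det =
      Fintype.card ι * LinearMap.det (addAt f i (coord j)) := by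
  have h0 : (LinearMap.toMatrix' f).det = 0 := by
    rw [← Matrix.exists_mulVec_eq_zero_iff]
    refine ⟨fun _ => 1, fun h => one_ne_zero (congrFun h i), ?_⟩
    rw [← Matrix.toLin'_apply, Matrix.toLin'_toMatrix', hr]
  have key (k : ι) : ((LinearMap.toMatrix' f).updateCol k (Pi.single k 1)).det =
      LinearMap.det (addAt f i (coord j)) := by
    -- Both indices are moved to `k`. Adding 1 at the place `(k, k)` adds the cofactor to `det f`,
    -- which is 0 because constants lie in the kernel.
    rw [det_addAt_row hc i k, det_addAt_proj hr k j k, ← LinearMap.det_toMatrix',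
      ← zero_add (Matrix.det _), ← h0]
    nth_rewrite 1 [← Matrix.updateCol_eq_self (LinearMap.toMatrix' f) k]
    rw [← Matrix.det_updateCol_add]
    congr 1
    ext a b
    by_cases hb : b = k
    · subst hb
      simp [LinearMap.toMatrix'_apply, addAt_apply, Pi.single_apply]
    · simp [LinearMap.toMatrix'_apply, addAt_apply, hb]
  simp [key]

open Classical in
-- For a single cycle a suitable choice of functional removes one arrow from the cycle, and what
-- remains is a nilpotent shift. With several cycles, a cycle that does not contain `i` supplies a
-- left kernel vector.
theorem det_permDiff (σ : Equiv.Perm ι) (i j : ι) :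
    LinearMap.det (addAt (permDiff σ) i (coord j)) =
      if ∀ x y, σ.SameCycle x y then 1 else 0 := by
  split_ifs with h
  · have hr : permDiff σ (fun _ => 1) = 0 := by
      ext; simp [permDiff_apply]
    -- With this functional the entry `- x (σ i)` in row `i` is cancelled, which cuts the cycle at
    -- `i`.
    rw [det_addAt_proj hr i j (σ i)]
    let N : (ι → ℤ) →ₗ[ℤ] (ι → ℤ) := 1 - addAt (permDiff σ) i (coord (σ i))
    have hN (x : ι → ℤ) (k : ι) : N x k = if k = i then 0 else x (σ k) := by
      simp only [N, LinearMap.sub_apply, Module.End.one_apply, Pi.sub_apply, addAt_apply,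
        permDiff_apply, coord_apply]
      split_ifs with hk
      · subst hk; ring
      · ring
    have hpow (m : ℕ) : ∀ (x : ι → ℤ) (k : ι), (∃ l < m, (σ ^ l) k = i) → (N ^ m) x k = 0 := by
      induction m with
      | zero => rintro x k ⟨l, hl, _⟩; omega
      | succ m ih =>
        rintro x k ⟨l, hl, hk⟩
        rw [pow_succ', Module.End.mul_apply, hN]
        split_ifs with hki
        · rfl
        · cases l with
          | zero => exact absurd hk hki
          | succ l => exact ih x (σ k) ⟨l, by omega, by rw [← hk, pow_succ]; rfl⟩
    have hnil : IsNilpotent N := by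
      refine ⟨orderOf σ, LinearMap.ext fun x => funext fun k => hpow _ x k ?_⟩
      obtain ⟨l, hl, hl'⟩ := (h k i).exists_pow_eq'
      exact ⟨l, hl, hl'⟩
    have := det_one_sub_of_isNilpotent hnil
    rwa [sub_sub_cancel] at this
  · push Not at h
    obtain ⟨x, hx⟩ : ∃ x, ¬ σ.SameCycle i x := by
      by_contra hc
      push Not at hc
      obtain ⟨x, y, hxy⟩ := h
      exact hxy ((hc x).symm.trans (hc y))
    rw [← LinearMap.det_toMatrix', ← Matrix.exists_vecMul_eq_zero_iff]
    -- The indicator of the complement of the cycle of `i`: it is `σ`-invariant and does not see the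
    -- perturbed row `i`.
    refine ⟨fun k => if σ.SameCycle i k then 0 else 1, fun h => ?_, ?_⟩
    · simpa [hx] using congrFun h x
    · ext k
      have hc (l : ι) : σ.SameCycle i (σ l) ↔ σ.SameCycle i l := Equiv.Perm.sameCycle_apply_right
      have hs := Equiv.sum_comp σ fun l =>
        (if σ.SameCycle i l then 0 else 1) * (Pi.single k 1 : ι → ℤ) l
      simp only [hc] at hs
      simp only [Matrix.vecMul, dotProduct, LinearMap.toMatrix'_apply, addAt_apply, permDiff_apply,
        mul_add, mul_sub, Finset.sum_add_distrib, Finset.sum_sub_distrib, hs, mul_ite, mul_zero]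
      simp [Equiv.Perm.SameCycle.refl]

end LinearAlgebra

/-! ### The Laplacian of a diagram and its cofactors -/

theorem OutEnd.sum_eq {M : Type*} [AddCommMonoid M] (f : OutEnd → M) (d : Dir) :
    ∑ o, f o = f d.fwd + f d.bwd := by
  cases d
  · exact (Finset.sum_pair (by decide) : ∑ o ∈ {OutEnd.nw, OutEnd.se}, f o = _)
  · exact (Finset.sum_pair (by decide) : ∑ o ∈ {OutEnd.nw, OutEnd.se}, f o = _).trans
      (add_comm _ _)

theorem InEnd.sum_eq {M : Type*} [AddCommMonoid M] (f : InEnd → M) :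
    ∑ i, f i = f .ne + f .sw :=
  Finset.sum_pair (by decide)

theorem Dir.eq_fwd_or_eq_bwd (d : Dir) (o : OutEnd) : o = d.fwd ∨ o = d.bwd := by
  cases d <;> cases o <;> decide

namespace Diagram

variable {V : Type}

/-- The Laplacian of a diagram. -/
def laplacian (D : Diagram V) : (V → ℤ) →ₗ[ℤ] (V → ℤ) :=
  LinearMap.pi fun j => 2 • coord j - ∑ o, coord (D.edge (j, o)).1

theorem laplacian_apply (D : Diagram V) (x : V → ℤ) (j : V) :
    D.laplacian x j = 2 * x j - ∑ o, x (D.edge (j, o)).1 := by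
  simp [laplacian]

variable [Fintype V] [DecidableEq V]

theorem matrix_mulVec (D : Diagram V) (x : V → ℤ) (j : V) :
    D.matrix.mulVec x j = ∑ o, x (D.edge (j, o)).1 := by
  simp only [Matrix.mulVec, dotProduct, Diagram.matrix, Finset.card_filter, Nat.cast_sum,
    Finset.sum_mul]
  rw [Finset.sum_comm]
  refine Finset.sum_congr rfl fun o _ => ?_
  simp

theorem toMatrix'_laplacian (D : Diagram V) :
    LinearMap.toMatrix' D.laplacian = Matrix.scalar V 2 - D.matrix := by
  rw [← LinearMap.toMatrix'.symm.injective.eq_iff, LinearEquiv.symm_apply_apply]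
  refine LinearMap.ext fun x => funext fun j => ?_
  rw [LinearMap.toMatrix'_symm, Matrix.toLin'_apply, Matrix.sub_mulVec, Pi.sub_apply,
    matrix_mulVec, laplacian_apply]
  simp

theorem laplacian_one (D : Diagram V) : D.laplacian (fun _ => 1) = 0 := by
  funext j
  rw [laplacian_apply, OutEnd.sum_eq _ .vertical]
  norm_num

theorem sum_laplacian (D : Diagram V) (x : V → ℤ) : ∑ j, D.laplacian x j = 0 := by
  simp only [laplacian_apply, Finset.sum_sub_distrib]
  have h₁ : ∑ j, ∑ o, x (D.edge (j, o)).1 = ∑ y : V × InEnd, x y.1 := by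
    rw [← Fintype.sum_prod_type']
    exact Equiv.sum_comp D.edge fun y => x y.1
  rw [h₁, Fintype.sum_prod_type, sub_eq_zero]
  refine Finset.sum_congr rfl fun j _ => ?_
  rw [InEnd.sum_eq, two_mul]

/-- All cofactors of the Laplacian agree, so dividing their diagonal sum by the number of crossings
returns one of them. The freedom in `i` and `j` is used to put the perturbation at ends of ribbons.
-/
theorem conwayNumber_eq_det (D : Diagram V) (i j : V) :
    D.conwayNumber = LinearMap.det (addAt D.laplacian i (coord j)) := by
  rw [conwayNumber, derivative_charpoly_eval, ← toMatrix'_laplacian,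
    sum_det_updateCol D.laplacian_one D.sum_laplacian i j]
  have : (Fintype.card V : ℚ) ≠ 0 := by
    have : Nonempty V := ⟨i⟩
    exact_mod_cast Fintype.card_ne_zero
  push_cast
  rw [mul_div_cancel_left₀ _ this]

/-- The smoothing of all crossings that joins the incoming end of a crossing `v` to the outgoing
end on its left if `f v` is true, and on its right otherwise. -/
def smooth (f : V → Bool) : V × InEnd ≃ V × OutEnd where
  toFun x := (x.1, if f x.1 then turnLeft x.2 else turnRight x.2)
  invFun x := (x.1, if f x.1 then turnLeft.symm x.2 else turnRight.symm x.2)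
  left_inv x := by cases h : f x.1 <;> simp [h]
  right_inv x := by cases h : f x.1 <;> simp [h]

theorem smooth_apply (f : V → Bool) (x : V × InEnd) :
    smooth f x = (x.1, if f x.1 then turnLeft x.2 else turnRight x.2) := rfl

/-- The circles of the smoothed diagram are the cycles of this permutation. -/
def circles (D : Diagram V) (f : V → Bool) : Equiv.Perm (V × OutEnd) := D.edge.trans (smooth f)

/-- Smoothing the crossings as indicated by `f` gives a single circle. -/
def IsSingle (D : Diagram V) (f : V → Bool) : Prop := ∀ x y, (D.circles f).SameCycle x y

end Diagram

/-! ### Reduction of the Laplacian to two unknowns per ribbon -/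

namespace Config

variable {V : Type}

theorem expand_edge (c : Config V) (a : V → ℕ+) (x : (Σ v : V, Fin (a v)) × OutEnd) :
    (c.expand a).edge x = c.expandTo a x := rfl

/-- The smoothing of a ribbon `v` that contributes a factor `a v` if `r v` is true, and a factor `1`
otherwise. -/
def turns (c : Config V) (r : V → Bool) (v : V) : Bool := r v == decide (c.dir v = .horizontal)

/-- The values at the incoming ends of the ribbons. -/
def inValue (c : Config V) (p : V → ℤ × ℤ) (i : V × InEnd) : (V × OutEnd → ℤ) →ₗ[ℤ] ℤ :=
  coord (i.1, (c.dir i.1).fwd) -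
    (match i.2 with | .sw => (p i.1).1 | .ne => (p i.1).2) • coord (i.1, (c.dir i.1).bwd)

theorem inValue_apply (c : Config V) (p : V → ℤ × ℤ) (i : V × InEnd) (y : V × OutEnd → ℤ) :
    c.inValue p i y = y (i.1, (c.dir i.1).fwd) -
      (match i.2 with | .sw => (p i.1).1 | .ne => (p i.1).2) * y (i.1, (c.dir i.1).bwd) := rfl

variable [DecidableEq V]

/-- The equations for the values and the increments along the ribbons. -/
def system (c : Config V) (v₀ : V) (i₀ : V × InEnd) (p : V → ℤ × ℤ) :
    (V × OutEnd → ℤ) →ₗ[ℤ] (V × OutEnd → ℤ) :=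
  LinearMap.pi fun x =>
    if x.2 = (c.dir x.1).fwd then
      coord x - c.inValue p (c.diagram.edge x) + if x.1 = v₀ then c.inValue p i₀ else 0
    else
      ((p x.1).1 + (p x.1).2) • coord x - coord (x.1, (c.dir x.1).fwd) +
        c.inValue p (c.diagram.edge x)

theorem system_fwd (c : Config V) (v₀ : V) (i₀ : V × InEnd) (p : V → ℤ × ℤ) (y : V × OutEnd → ℤ)
    (v : V) :
    c.system v₀ i₀ p y (v, (c.dir v).fwd) =
      y (v, (c.dir v).fwd) - c.inValue p (c.diagram.edge (v, (c.dir v).fwd)) y +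
        if v = v₀ then c.inValue p i₀ y else 0 := by
  simp only [system, LinearMap.pi_apply, if_pos]
  split_ifs <;> rfl

theorem system_bwd (c : Config V) (v₀ : V) (i₀ : V × InEnd) (p : V → ℤ × ℤ) (y : V × OutEnd → ℤ)
    (v : V) :
    c.system v₀ i₀ p y (v, (c.dir v).bwd) =
      ((p v).1 + (p v).2) * y (v, (c.dir v).bwd) - y (v, (c.dir v).fwd) +
        c.inValue p (c.diagram.edge (v, (c.dir v).bwd)) y := by
  simp only [system, LinearMap.pi_apply, if_neg (c.dir v).bwd_ne_fwd]
  rfl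

/-- The common value on the ribbon `v`, as an affine function of the position. -/
def affine (c : Config V) (a : V → ℕ+) :
    (V × OutEnd → ℤ) →ₗ[ℤ] ((Σ v : V, Fin (a v)) → ℤ) :=
  LinearMap.pi fun k => coord (k.1, (c.dir k.1).fwd) -
    ((a k.1 : ℤ) - (k.2 : ℕ)) • coord (k.1, (c.dir k.1).bwd)

theorem affine_apply (c : Config V) (a : V → ℕ+) (y : V × OutEnd → ℤ) (v : V) (k : Fin (a v)) :
    c.affine a y ⟨v, k⟩ =
      y (v, (c.dir v).fwd) - ((a v : ℤ) - (k : ℕ)) * y (v, (c.dir v).bwd) := rfl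

/-- The values at the far ends and the increments along the ribbons. -/
def boundary (c : Config V) (v₀ : V) (i₀ : V × InEnd) (a : V → ℕ+) :
    ((Σ v : V, Fin (a v)) → ℤ) →ₗ[ℤ] (V × OutEnd → ℤ) :=
  LinearMap.pi fun x =>
    if x.2 = (c.dir x.1).fwd then
      coord (ribbonIn a (c.diagram.edge x)).1 - if x.1 = v₀ then coord (ribbonIn a i₀).1 else 0
    else coord (first a x.1) - coord (ribbonIn a (c.diagram.edge x)).1

theorem boundary_fwd (c : Config V) (v₀ : V) (i₀ : V × InEnd) (a : V → ℕ+)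
    (x : (Σ v : V, Fin (a v)) → ℤ) (v : V) :
    c.boundary v₀ i₀ a x (v, (c.dir v).fwd) =
      x (ribbonIn a (c.diagram.edge (v, (c.dir v).fwd))).1 -
        if v = v₀ then x (ribbonIn a i₀).1 else 0 := by
  simp only [boundary, LinearMap.pi_apply, if_pos]
  split_ifs <;> rfl

theorem boundary_bwd (c : Config V) (v₀ : V) (i₀ : V × InEnd) (a : V → ℕ+)
    (x : (Σ v : V, Fin (a v)) → ℤ) (v : V) :
    c.boundary v₀ i₀ a x (v, (c.dir v).bwd) =
      x (first a v) - x (ribbonIn a (c.diagram.edge (v, (c.dir v).bwd))).1 := by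
  simp only [boundary, LinearMap.pi_apply, if_neg (c.dir v).bwd_ne_fwd]
  rfl

theorem affine_ribbonIn (c : Config V) (a : V → ℕ+) (y : V × OutEnd → ℤ) (i : V × InEnd) :
    c.affine a y (ribbonIn a i).1 = c.inValue (fun v => (a v, 1)) i y := by
  obtain ⟨v, _ | _⟩ := i
  · have : (((a v : ℕ) - 1 : ℕ) : ℤ) = a v - 1 := by
      have := (a v).pos
      omega
    simp only [ribbonIn, last, affine_apply, inValue_apply, this]
    ring
  · simp only [ribbonIn, first, affine_apply, inValue_apply]
    simp

/-- On affine functions the boundary data of a ribbon depend on its length only through the value at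
its first crossing, namely the far value minus `a v` increments. At the last crossing one increment
is subtracted, whence the pair `(a v, 1)`. -/
theorem one_sub_boundary_comp_affine (c : Config V) (v₀ : V) (i₀ : V × InEnd) (a : V → ℕ+) :
    1 - (c.boundary v₀ i₀ a).comp (c.affine a) = c.system v₀ i₀ fun v => (a v, 1) := by
  refine LinearMap.ext fun y => funext fun ⟨v, o⟩ => ?_
  rw [LinearMap.sub_apply, Pi.sub_apply, Module.End.one_apply, LinearMap.comp_apply]
  obtain rfl | rfl := (c.dir v).eq_fwd_or_eq_bwd o
  · rw [boundary_fwd, system_fwd, affine_ribbonIn, affine_ribbonIn]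
    ring
  · rw [boundary_bwd, system_bwd, affine_ribbonIn, first, affine_apply]
    push_cast
    ring

/-- The shift to the next crossing of a ribbon. -/
def shiftUp (a : V → ℕ+) : ((Σ v : V, Fin (a v)) → ℤ) →ₗ[ℤ] ((Σ v : V, Fin (a v)) → ℤ) :=
  LinearMap.pi fun k => if h : (k.2 : ℕ) + 1 < a k.1 then coord ⟨k.1, ⟨k.2 + 1, h⟩⟩ else 0

theorem shiftUp_apply (a : V → ℕ+) (x : (Σ v : V, Fin (a v)) → ℤ) (v : V) (k : Fin (a v)) :
    shiftUp a x ⟨v, k⟩ = if h : (k : ℕ) + 1 < a v then x ⟨v, ⟨k + 1, h⟩⟩ else 0 := by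
  simp only [shiftUp, LinearMap.pi_apply]
  split_ifs <;> rfl

/-- The shift to the previous crossing of a ribbon. -/
def shiftDown (a : V → ℕ+) : ((Σ v : V, Fin (a v)) → ℤ) →ₗ[ℤ] ((Σ v : V, Fin (a v)) → ℤ) :=
  LinearMap.pi fun k =>
    if 0 < (k.2 : ℕ) then coord ⟨k.1, ⟨k.2 - 1, lt_of_le_of_lt (Nat.sub_le _ _) k.2.2⟩⟩ else 0

theorem shiftDown_apply (a : V → ℕ+) (x : (Σ v : V, Fin (a v)) → ℤ) (v : V) (k : Fin (a v)) :
    shiftDown a x ⟨v, k⟩ =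
      if 0 < (k : ℕ) then x ⟨v, ⟨k - 1, lt_of_le_of_lt (Nat.sub_le _ _) k.2⟩⟩ else 0 := by
  simp only [shiftDown, LinearMap.pi_apply]
  split_ifs <;> rfl

theorem isNilpotent_shiftUp [Fintype V] (a : V → ℕ+) : IsNilpotent (shiftUp a) := by
  have key (m : ℕ) : ∀ (x : (Σ v : V, Fin (a v)) → ℤ) (v : V) (k : Fin (a v)),
      (a v : ℕ) ≤ k + m → (shiftUp a ^ m) x ⟨v, k⟩ = 0 := by
    induction m with
    | zero => intro x v k h; exact absurd k.2 (by omega)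
    | succ m ih =>
      intro x v k h
      rw [pow_succ', Module.End.mul_apply, shiftUp_apply]
      split_ifs with h'
      · exact ih x v _ (by simp only; omega)
      · rfl
  refine ⟨∑ v, (a v : ℕ), LinearMap.ext fun x => funext fun ⟨v, k⟩ => key _ x v k ?_⟩
  exact (Finset.single_le_sum (f := fun v => (a v : ℕ)) (fun _ _ => Nat.zero_le _)
    (Finset.mem_univ v)).trans
    (Nat.le_add_left _ _)

theorem isNilpotent_shiftDown [Fintype V] (a : V → ℕ+) : IsNilpotent (shiftDown a) := by
  have key (m : ℕ) : ∀ (x : (Σ v : V, Fin (a v)) → ℤ) (v : V) (k : Fin (a v)),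
      (k : ℕ) < m → (shiftDown a ^ m) x ⟨v, k⟩ = 0 := by
    induction m with
    | zero => intro x v k h; omega
    | succ m ih =>
      intro x v k h
      rw [pow_succ', Module.End.mul_apply, shiftDown_apply]
      split_ifs with h'
      · exact ih x v _ (by simp only; omega)
      · rfl
  refine ⟨∑ v, (a v : ℕ), LinearMap.ext fun x => funext fun ⟨v, k⟩ => key _ x v k ?_⟩
  exact k.2.trans_le (Finset.single_le_sum (f := fun v => (a v : ℕ)) (fun _ _ => Nat.zero_le _)
    (Finset.mem_univ v))

/-- The last factor subtracts from `x` the affine function on each ribbon with the prescribed far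
value and increment. The two difference operators then annihilate the affine part inside the ribbon
and give the second difference of `x`; at the ends the boundary data supply the missing neighbours.
The perturbation at `last a v₀` is hidden in the far value of `v₀`. -/
theorem addAt_laplacian_expand [Fintype V] (c : Config V) (v₀ : V) (i₀ : V × InEnd) (a : V → ℕ+) :
    addAt (c.expand a).laplacian (last a v₀) (coord (ribbonIn a i₀).1) =
      (1 - shiftDown a) * ((1 - shiftUp a) * (1 - (c.affine a).comp (c.boundary v₀ i₀ a))) := by
  refine LinearMap.ext fun x => funext fun ⟨v, k⟩ => ?_
  obtain ⟨t, ht⟩ : ∃ t, c.boundary v₀ i₀ a x (v, (c.dir v).fwd) = t := ⟨_, rfl⟩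
  obtain ⟨s, hs⟩ : ∃ s, c.boundary v₀ i₀ a x (v, (c.dir v).bwd) = s := ⟨_, rfl⟩
  have h₁ (k : Fin (a v)) : (1 - (c.affine a).comp (c.boundary v₀ i₀ a)) x ⟨v, k⟩ =
      x ⟨v, k⟩ - (t - ((a v : ℤ) - (k : ℕ)) * s) := by
    rw [LinearMap.sub_apply, Pi.sub_apply, Module.End.one_apply, LinearMap.comp_apply, affine_apply,
      ht, hs]
  have h₂ (k : Fin (a v)) :
      ((1 - shiftUp a) * (1 - (c.affine a).comp (c.boundary v₀ i₀ a))) x ⟨v, k⟩ =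
        x ⟨v, k⟩ + s - if h : (k : ℕ) + 1 < a v then x ⟨v, ⟨k + 1, h⟩⟩ else t := by
    rw [Module.End.mul_apply, LinearMap.sub_apply, Pi.sub_apply, Module.End.one_apply,
      shiftUp_apply, h₁]
    split_ifs with h
    · rw [h₁]
      push_cast
      ring
    · have : (a v : ℤ) = (k : ℕ) + 1 := by
        have := k.2
        omega
      rw [this]
      ring
  rw [Module.End.mul_apply, LinearMap.sub_apply, Pi.sub_apply, Module.End.one_apply,
    shiftDown_apply, h₂, addAt_apply, Diagram.laplacian_apply, OutEnd.sum_eq _ (c.dir v)]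
  rw [boundary_fwd] at ht
  rw [boundary_bwd] at hs
  have e₁ : x ((c.expand a).edge (⟨v, k⟩, (c.dir v).fwd)).1 =
      if h : (k : ℕ) + 1 < a v then x ⟨v, ⟨k + 1, h⟩⟩
      else x (ribbonIn a (c.diagram.edge (v, (c.dir v).fwd))).1 := by
    split_ifs with h
    · exact congrArg (fun z : (Σ v : V, Fin (a v)) × InEnd => x z.1) (c.expandTo_fwd a v k h)
    · refine congrArg (fun z : (Σ v : V, Fin (a v)) × InEnd => x z.1) ?_
      rw [expand_edge, ← expandTo_ribbonOut, ribbonOut_fwd, eq_last a v k h]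
  have e₂ : x ((c.expand a).edge (⟨v, k⟩, (c.dir v).bwd)).1 =
      if 0 < (k : ℕ) then x ⟨v, ⟨k - 1, lt_of_le_of_lt (Nat.sub_le _ _) k.2⟩⟩
      else x (ribbonIn a (c.diagram.edge (v, (c.dir v).bwd))).1 := by
    split_ifs with h
    · exact congrArg (fun z : (Σ v : V, Fin (a v)) × InEnd => x z.1) (c.expandTo_bwd a v k h)
    · refine congrArg (fun z : (Σ v : V, Fin (a v)) × InEnd => x z.1) ?_
      rw [expand_edge, ← expandTo_ribbonOut, ribbonOut_bwd, eq_first a v k h]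
  have e₃ : (⟨v, k⟩ : Σ v : V, Fin (a v)) = last a v₀ ↔ ¬ (k : ℕ) + 1 < a v ∧ v = v₀ := by
    constructor
    · intro e
      obtain rfl : v = v₀ := congrArg Sigma.fst e
      refine ⟨fun h => ?_, rfl⟩
      have := congrArg Fin.val (eq_of_heq (Sigma.mk.inj e).2)
      simp only at this
      omega
    · rintro ⟨h, rfl⟩
      exact (eq_last a v k h).symm
  have e₄ : (if (⟨v, k⟩ : Σ v : V, Fin (a v)) = last a v₀ then coord (ribbonIn a i₀).1 x else 0) =
      if ¬ (k : ℕ) + 1 < a v ∧ v = v₀ then x (ribbonIn a i₀).1 else 0 := by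
    simp only [e₃, coord_apply]
  have e₅ (h' : 0 < (k : ℕ)) : ((1 - shiftUp a) * (1 - (c.affine a).comp (c.boundary v₀ i₀ a))) x
      ⟨v, ⟨k - 1, lt_of_le_of_lt (Nat.sub_le _ _) k.2⟩⟩ =
        x ⟨v, ⟨k - 1, lt_of_le_of_lt (Nat.sub_le _ _) k.2⟩⟩ + s - x ⟨v, k⟩ := by
    have e : (k : ℕ) - 1 + 1 = k := by omega
    rw [h₂]
    simp only [e, k.2, dif_pos]
  rw [e₁, e₂, e₄, ← ht]
  by_cases h' : 0 < (k : ℕ)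
  · rw [if_pos h', if_pos h', e₅ h']
    by_cases h : (k : ℕ) + 1 < a v
    · simp only [h, dif_pos, not_true_eq_false, false_and, if_false]
      ring
    · simp only [h, dif_neg, not_false_eq_true, true_and]
      ring
  · rw [if_neg h', if_neg h', ← hs, eq_first a v k h']
    by_cases h : (k : ℕ) + 1 < a v
    · simp only [h, dif_pos, not_true_eq_false, false_and, if_false]
      ring
    · simp only [h, dif_neg, not_false_eq_true, true_and]
      ring

/-- The two shift factors are unipotent, and exchanging `affine` and `boundary` in the third
replaces a determinant indexed by crossings by one indexed by two unknowns per ribbon. -/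
theorem conway_eq_det_system [Fintype V] (c : Config V) (v₀ : V) (i₀ : V × InEnd) (a : V → ℕ+) :
    c.conway a = LinearMap.det (c.system v₀ i₀ fun v => (a v, 1)) := by
  rw [conway, Diagram.conwayNumber_eq_det _ (last a v₀) (ribbonIn a i₀).1, addAt_laplacian_expand,
    map_mul, map_mul, det_one_sub_of_isNilpotent (isNilpotent_shiftDown a),
    det_one_sub_of_isNilpotent (isNilpotent_shiftUp a), one_mul, one_mul, det_one_sub_comp_comm,
    one_sub_boundary_comp_affine]

end Config
-- Multilinear expansion into single-circle smoothings
namespace Config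

variable {V : Type} [DecidableEq V]

theorem inValue_congr (c : Config V) {p q : V → ℤ × ℤ} {y : V × OutEnd → ℤ}
    (h : ∀ v, p v = q v ∨ y (v, (c.dir v).bwd) = 0) (i : V × InEnd) :
    c.inValue p i y = c.inValue q i y := by
  rw [inValue_apply, inValue_apply]
  rcases h i.1 with h | h <;> simp [h]

theorem system_congr (c : Config V) (v₀ : V) (i₀ : V × InEnd) {p q : V → ℤ × ℤ}
    {y : V × OutEnd → ℤ} (h : ∀ v, p v = q v ∨ y (v, (c.dir v).bwd) = 0) :
    c.system v₀ i₀ p y = c.system v₀ i₀ q y := by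
  funext ⟨v, o⟩
  obtain rfl | rfl := (c.dir v).eq_fwd_or_eq_bwd o
  · simp only [system_fwd, c.inValue_congr h]
  · rw [system_bwd, system_bwd, c.inValue_congr h]
    rcases h v with h | h <;> simp [h]

theorem inValue_single (c : Config V) (p : V → ℤ × ℤ) (i : V × InEnd) (w : V) :
    c.inValue p i (Pi.single (w, (c.dir w).bwd) 1) =
      if i.1 = w then -(match i.2 with | .sw => (p w).1 | .ne => (p w).2) else 0 := by
  rw [inValue_apply]
  obtain ⟨v, _ | _⟩ := i <;> by_cases h : v = w
  · subst h; simp [(c.dir v).bwd_ne_fwd.symm]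
  · simp [h]
  · subst h; simp [(c.dir v).bwd_ne_fwd.symm]
  · simp [h]

/-- The increment of the ribbon `w` is the only unknown multiplied by `p w`, and its coefficients in
all equations are homogeneous linear in `p w`. -/
theorem system_single (c : Config V) (v₀ : V) (i₀ : V × InEnd) (w : V) (x y : ℤ) (p q s : V → ℤ × ℤ)
    (h : s w = x • p w + y • q w) :
    c.system v₀ i₀ s (Pi.single (w, (c.dir w).bwd) 1) =
      x • c.system v₀ i₀ p (Pi.single (w, (c.dir w).bwd) 1) +
        y • c.system v₀ i₀ q (Pi.single (w, (c.dir w).bwd) 1) := by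
  have hi (i : V × InEnd) : c.inValue s i (Pi.single (w, (c.dir w).bwd) 1) =
      x * c.inValue p i (Pi.single (w, (c.dir w).bwd) 1) +
        y * c.inValue q i (Pi.single (w, (c.dir w).bwd) 1) := by
    simp only [inValue_single, h]
    obtain ⟨v, _ | _⟩ := i <;> by_cases hv : v = w <;> simp [hv] <;> ring
  have hf (v : V) : (Pi.single (w, (c.dir w).bwd) 1 : V × OutEnd → ℤ) (v, (c.dir v).fwd) = 0 := by
    refine Pi.single_eq_of_ne (fun e => ?_) _
    obtain rfl : v = w := congrArg Prod.fst e
    exact (c.dir v).bwd_ne_fwd.symm (congrArg Prod.snd e)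
  funext ⟨v, o⟩
  obtain rfl | rfl := (c.dir v).eq_fwd_or_eq_bwd o
  · simp only [Pi.add_apply, Pi.smul_apply, system_fwd, hi, hf, smul_eq_mul]
    split_ifs <;> ring
  · simp only [Pi.add_apply, Pi.smul_apply, system_bwd, hi, hf, smul_eq_mul]
    by_cases hv : v = w
    · subst hv
      simp only [h, Prod.fst_add, Prod.snd_add, Prod.smul_fst, Prod.smul_snd, smul_eq_mul]
      ring
    · have : (Pi.single (w, (c.dir w).bwd) 1 : V × OutEnd → ℤ) (v, (c.dir v).bwd) = 0 :=
        Pi.single_eq_of_ne (fun e => hv (congrArg Prod.fst e)) _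
      rw [this]
      ring

variable [Fintype V]

theorem toMatrix'_system_update (c : Config V) (v₀ : V) (i₀ : V × InEnd) (p q : V → ℤ × ℤ) (w : V)
    (h : ∀ v, v ≠ w → q v = p v) :
    LinearMap.toMatrix' (c.system v₀ i₀ q) =
      (LinearMap.toMatrix' (c.system v₀ i₀ p)).updateCol (w, (c.dir w).bwd)
        (c.system v₀ i₀ q (Pi.single (w, (c.dir w).bwd) 1)) := by
  ext x y
  by_cases hy : y = (w, (c.dir w).bwd)
  · subst hy
    simp [LinearMap.toMatrix'_apply]
  · rw [Matrix.updateCol_ne hy, LinearMap.toMatrix'_apply, LinearMap.toMatrix'_apply]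
    refine congrFun (c.system_congr v₀ i₀ fun v => ?_) x
    by_cases hv : v = w
    · subst hv
      exact Or.inr (Pi.single_eq_of_ne (Ne.symm hy) _)
    · exact Or.inl (h v hv)

/-- Linearity of the determinant in one column. The form with two scalars yields additivity and
homogeneity of `detSystem` at once. -/
theorem det_system_update (c : Config V) (v₀ : V) (i₀ : V × InEnd) (p q s : V → ℤ × ℤ) (w : V)
    (x y : ℤ) (hp : ∀ v, v ≠ w → p v = s v) (hq : ∀ v, v ≠ w → q v = s v)
    (h : s w = x • p w + y • q w) :
    LinearMap.det (c.system v₀ i₀ s) =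
      x * LinearMap.det (c.system v₀ i₀ p) + y * LinearMap.det (c.system v₀ i₀ q) := by
  simp only [← LinearMap.det_toMatrix']
  rw [c.toMatrix'_system_update v₀ i₀ s p w hp, c.toMatrix'_system_update v₀ i₀ s q w hq,
    ← Matrix.det_updateCol_smul, ← Matrix.det_updateCol_smul, ← Matrix.det_updateCol_add,
    ← c.system_single v₀ i₀ w x y p q s h, ← c.toMatrix'_system_update v₀ i₀ s s w fun _ _ => rfl]

/-- The determinant of the system is a multilinear function of the parameters. -/
noncomputable def detSystem (c : Config V) (v₀ : V) (i₀ : V × InEnd) :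
    MultilinearMap ℤ (fun _ : V => ℤ × ℤ) ℤ :=
  MultilinearMap.mk' (fun p => LinearMap.det (c.system v₀ i₀ p))
    (fun p w x y => by
      have := c.det_system_update v₀ i₀ (Function.update p w x) (Function.update p w y)
        (Function.update p w (x + y)) w 1 1 (by intro v hv; simp [hv]) (by intro v hv; simp [hv])
        (by simp)
      simpa using this)
    (fun p w r x => by
      have := c.det_system_update v₀ i₀ (Function.update p w x) (Function.update p w x)
        (Function.update p w (r • x)) w r 0 (by intro v hv; simp [hv]) (by intro v hv; simp [hv])
        (by simp)
      simpa using this)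

/-- The parameters that select one smoothing of each ribbon. -/
def unitParam (r : V → Bool) (v : V) : ℤ × ℤ := if r v then (1, 0) else (0, 1)

/-- Each pair is written as `(a v, 1) = a v • (1, 0) + 1 • (0, 1)`, and the multilinear determinant
is expanded. -/
theorem det_system_eq_sum (c : Config V) (v₀ : V) (i₀ : V × InEnd) (a : V → ℕ+) :
    LinearMap.det (c.system v₀ i₀ fun v => (a v, 1)) =
      ∑ r : V → Bool, (∏ v, if r v then (a v : ℤ) else 1) *
        LinearMap.det (c.system v₀ i₀ (unitParam r)) := by
  have h : (fun v => ((a v : ℤ), (1 : ℤ))) = fun v => ∑ b : Bool,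
      (if b then (a v : ℤ) else 1) • (if b then ((1 : ℤ), (0 : ℤ)) else (0, 1)) := by
    funext v
    simp
  have := (c.detSystem v₀ i₀).map_sum fun v (b : Bool) =>
      (if b then (a v : ℤ) else 1) • (if b then ((1 : ℤ), (0 : ℤ)) else (0, 1))
  rw [← h] at this
  refine this.trans (Finset.sum_congr rfl fun r _ => ?_)
  rw [MultilinearMap.map_smul_univ]
  rfl

/-- The passage from increments to values at the south or west end. -/
def toValues (c : Config V) : (V × OutEnd → ℤ) →ₗ[ℤ] (V × OutEnd → ℤ) :=
  LinearMap.pi fun x =>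
    if x.2 = (c.dir x.1).fwd then coord x else coord (x.1, (c.dir x.1).fwd) - coord x

/-- The change of sign at the south or west ends. -/
def negBwd (c : Config V) : (V × OutEnd → ℤ) →ₗ[ℤ] (V × OutEnd → ℤ) :=
  LinearMap.pi fun x => if x.2 = (c.dir x.1).fwd then coord x else - coord x

theorem toValues_fwd (c : Config V) (y : V × OutEnd → ℤ) (v : V) :
    c.toValues y (v, (c.dir v).fwd) = y (v, (c.dir v).fwd) := by
  simp [toValues]

theorem toValues_bwd (c : Config V) (y : V × OutEnd → ℤ) (v : V) :
    c.toValues y (v, (c.dir v).bwd) = y (v, (c.dir v).fwd) - y (v, (c.dir v).bwd) := by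
  simp [toValues, (c.dir v).bwd_ne_fwd]

theorem negBwd_fwd (c : Config V) (y : V × OutEnd → ℤ) (v : V) :
    c.negBwd y (v, (c.dir v).fwd) = y (v, (c.dir v).fwd) := by
  simp [negBwd]

theorem negBwd_bwd (c : Config V) (y : V × OutEnd → ℤ) (v : V) :
    c.negBwd y (v, (c.dir v).bwd) = -y (v, (c.dir v).bwd) := by
  simp [negBwd, (c.dir v).bwd_ne_fwd]

/-- The product of the two maps is unitriangular: it only adds the forward unknown to the backward
one. -/
theorem det_toValues_mul_det_negBwd (c : Config V) :
    LinearMap.det c.toValues * LinearMap.det c.negBwd = 1 := by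
  have h : IsNilpotent (1 - c.toValues * c.negBwd) := by
    refine ⟨2, LinearMap.ext fun y => funext fun ⟨v, o⟩ => ?_⟩
    obtain rfl | rfl := (c.dir v).eq_fwd_or_eq_bwd o <;>
    simp [pow_two, toValues_fwd, toValues_bwd, negBwd_fwd, negBwd_bwd]
  have := det_one_sub_of_isNilpotent h
  rwa [sub_sub_cancel, map_mul] at this

/-- At parameters `(1, 0)` and `(0, 1)` the value at each incoming end is the value at one of the
two outgoing ends of the same ribbon; this pairing of ends is a smoothing. `turns` accounts for the
direction of the ribbon. -/
theorem inValue_unitParam (c : Config V) (r : V → Bool) (i : V × InEnd) (y : V × OutEnd → ℤ) :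
    c.inValue (unitParam r) i y = c.toValues y (Diagram.smooth (c.turns r) i) := by
  obtain ⟨v, i⟩ := i
  have hf := c.toValues_fwd y v
  have hb := c.toValues_bwd y v
  rw [inValue_apply, Diagram.smooth_apply]
  cases hr : r v <;> cases hd : c.dir v <;> cases i <;>
  simp_all [unitParam, turns, turnLeft, turnRight, Dir.fwd, Dir.bwd]

/-- Once values replace increments, each equation says that the value at an outgoing end equals the
value at the next one on its circle, up to a sign for backward ends and the perturbation at `v₀`. -/
theorem system_unitParam (c : Config V) (v₀ : V) (i₀ : V × InEnd) (r : V → Bool) :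
    c.system v₀ i₀ (unitParam r) = c.negBwd * (addAt (permDiff (c.diagram.circles (c.turns r)))
      (v₀, (c.dir v₀).fwd) (coord (Diagram.smooth (c.turns r) i₀)) * c.toValues) := by
  refine LinearMap.ext fun y => funext fun ⟨v, o⟩ => ?_
  have h : (unitParam r v).1 + (unitParam r v).2 = 1 := by
    unfold unitParam
    split_ifs <;> rfl
  have hbf (w : V) : (c.dir v).bwd = (c.dir w).fwd → v ≠ w := by
    rintro e rfl
    exact (c.dir v).bwd_ne_fwd e
  obtain rfl | rfl := (c.dir v).eq_fwd_or_eq_bwd o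
  · rw [Module.End.mul_apply, Module.End.mul_apply, negBwd_fwd, addAt_apply, permDiff_apply,
      system_fwd, toValues_fwd, inValue_unitParam, inValue_unitParam]
    congr 1
    by_cases hv : v = v₀
    · subst hv; simp
    · simp [hv]
  · rw [Module.End.mul_apply, Module.End.mul_apply, negBwd_bwd, addAt_apply, permDiff_apply,
      system_bwd, toValues_bwd, inValue_unitParam, h, if_neg]
    · change _ = -(_ - c.toValues y (Diagram.smooth _ _) + _)
      ring
    · intro e
      obtain ⟨rfl, e⟩ := Prod.mk.inj e
      exact (c.dir v).bwd_ne_fwd e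

open Classical in
/-- The Conway number counts the smoothings that give a single circle. -/
theorem conway_eq_sum [Nonempty V] (c : Config V) (a : V → ℕ+) :
    c.conway a = ∑ r : V → Bool,
      if c.diagram.IsSingle (c.turns r) then ∏ v, (if r v then (a v : ℚ) else 1) else 0 := by
  obtain ⟨v₀⟩ := ‹Nonempty V›
  rw [c.conway_eq_det_system v₀ (v₀, .ne), det_system_eq_sum]
  push_cast
  refine Finset.sum_congr rfl fun r _ => ?_
  have h : LinearMap.det (c.system v₀ (v₀, .ne) (unitParam r)) =
      if c.diagram.IsSingle (c.turns r) then 1 else 0 := by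
    rw [system_unitParam, map_mul, map_mul, det_permDiff, mul_left_comm, mul_comm (LinearMap.det _),
      det_toValues_mul_det_negBwd, mul_one]
    exact if_congr Iff.rfl rfl rfl
  rw [h]
  split_ifs <;> simp

end Config

/-! ### Primeness of the members of a family -/

theorem exists_step {p : ℕ → Prop} {i j : ℕ} (hij : i ≤ j) (hi : p i) (hj : ¬ p j) :
    ∃ k, i ≤ k ∧ k < j ∧ p k ∧ ¬ p (k + 1) := by
  induction j, hij using Nat.le_induction with
  | base => exact absurd hi hj
  | succ j hij ih =>
    by_cases h : p j
    · exact ⟨j, hij, Nat.lt_succ_self j, h, hj⟩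
    · obtain ⟨k, h₁, h₂, h₃⟩ := ih h
      exact ⟨k, h₁, h₂.trans (Nat.lt_succ_self j), h₃⟩

namespace Diagram

variable {V W : Type} [Fintype V] [DecidableEq V] [Fintype W] [DecidableEq W]

/-- The outgoing ends of the edges that leave a set of crossings. -/
def leaving (D : Diagram V) (S : Finset V) : Finset (V × OutEnd) :=
  Finset.univ.filter fun o => o.1 ∈ S ∧ (D.edge o).1 ∉ S

theorem mem_leaving {D : Diagram V} {S : Finset V} {o : V × OutEnd} :
    o ∈ D.leaving S ↔ o.1 ∈ S ∧ (D.edge o).1 ∉ S := by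
  simp [leaving]

/-- No set of crossings can be separated from the others by cutting two edges. -/
def IsCutFree (D : Diagram V) : Prop :=
  ∀ S : Finset V, S.Nonempty → S ≠ Finset.univ → 2 ≤ (D.leaving S).card

theorem IsCutFree.of_isIsoVia {D : Diagram V} {D' : Diagram W} {π : V ≃ W} {r : V → Bool}
    (h : D.IsIsoVia D' π r) (hD : D.IsCutFree) : D'.IsCutFree := by
  intro S hS hS'
  obtain ⟨S, rfl⟩ : ∃ T : Finset V, S = T.map π.toEmbedding :=
    ⟨S.map π.symm.toEmbedding, by ext; simp⟩
  have hl : D'.leaving (S.map π.toEmbedding) =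
      (D.leaving S).map (outMap π r).toEmbedding := by
    ext o
    obtain ⟨o, rfl⟩ := (outMap π r).surjective o
    rw [mem_leaving, isIsoVia_iff.1 h]
    simp only [outMap_apply, inMap_apply, Finset.mem_map_equiv, Equiv.symm_apply_apply]
    rw [← outMap_apply, Equiv.symm_apply_apply, mem_leaving]
  rw [hl, Finset.card_map]
  refine hD S (Finset.map_nonempty.1 hS) ?_
  rintro rfl
  exact hS' (by ext; simp)

end Diagram

namespace Config

variable {V : Type}

/-- No end of a ribbon is connected to the other end on the same side. -/
def NoCurl (c : Config V) : Prop :=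
  ∀ v, c.diagram.edge (v, (c.dir v).bwd) ≠ (v, .sw) ∧ c.diagram.edge (v, (c.dir v).fwd) ≠ (v, .ne)

theorem ribbonOut_injective (c : Config V) (a : V → ℕ+) : Function.Injective (c.ribbonOut a) := by
  intro x y h
  have := congrArg (c.expand a).edge h
  rw [expand_edge, expand_edge, expandTo_ribbonOut, expandTo_ribbonOut] at this
  have := congrArg (c.expandFrom a) this
  rw [expandFrom_ribbonIn, expandFrom_ribbonIn, Equiv.symm_apply_apply,
    Equiv.symm_apply_apply] at this
  have h' (z : V × OutEnd) : ((c.ribbonOut a z).1.1, (c.ribbonOut a z).2) = z := by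
    unfold ribbonOut
    split_ifs <;> rfl
  rw [← h' x, h, h']

theorem ribbonOut_fst_fst (c : Config V) (a : V → ℕ+) (x : V × OutEnd) :
    (c.ribbonOut a x).1.1 = x.1 := by
  unfold ribbonOut
  split_ifs <;> rfl

theorem ribbonIn_fst_fst (a : V → ℕ+) (x : V × InEnd) : (ribbonIn a x).1.1 = x.1 := by
  obtain ⟨v, _ | _⟩ := x <;> rfl

/-- An edge of an expanded diagram lies inside a ribbon or connects ends of ribbons. -/
theorem expand_edge_cases (c : Config V) (a : V → ℕ+) (v : V) (k : Fin (a v)) (o : OutEnd) :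
    (∃ l : Fin (a v), l ≠ k ∧ ((c.expand a).edge (⟨v, k⟩, o)).1 = ⟨v, l⟩) ∨
      (⟨v, k⟩, o) = c.ribbonOut a (v, o) := by
  obtain rfl | rfl := (c.dir v).eq_fwd_or_eq_bwd o
  · by_cases h : (k : ℕ) + 1 < a v
    · refine .inl ⟨⟨k + 1, h⟩, fun e => ?_, ?_⟩
      · have := congrArg Fin.val e
        simp at this
      · rw [expand_edge, expandTo_fwd c a v k h]
    · exact .inr (by rw [ribbonOut_fwd, eq_last a v k h])
  · by_cases h : 0 < (k : ℕ)
    · refine .inl ⟨_, fun e => ?_, by rw [expand_edge, expandTo_bwd c a v k h]⟩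
      have := congrArg Fin.val e
      simp only at this
      omega
    · exact .inr (by rw [ribbonOut_bwd, eq_first a v k h])

variable [Fintype V] [DecidableEq V]

/-- A set of ribbons is a set of crossings of the expanded diagram, and the edges that leave it are
edges between ends of ribbons. -/
theorem isCutFree_of_isPrime_expand (c : Config V) (a : V → ℕ+) (h : (c.expand a).IsPrime) :
    c.diagram.IsCutFree := by
  intro S ⟨v, hv⟩ hS'
  have hmem (k : Σ v : V, Fin (a v)) :
      k ∈ (Finset.univ.filter fun k : Σ v : V, Fin (a v) => k.1 ∈ S) ↔ k.1 ∈ S := by simp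
  have := h.2 (Finset.univ.filter fun k => k.1 ∈ S) ⟨first a v, (hmem _).2 hv⟩ (fun e => hS' <|
    Finset.eq_univ_of_forall fun w => (hmem (first a w)).1 (by rw [e]; exact Finset.mem_univ _))
  refine this.trans ((Finset.card_le_card (t := (c.diagram.leaving S).image (c.ribbonOut a))
    fun x hx => ?_).trans Finset.card_image_le)
  obtain ⟨⟨w, k⟩, o⟩ := x
  simp only [Finset.mem_filter, Finset.mem_univ, true_and] at hx
  rcases c.expand_edge_cases a w k o with ⟨l, _, h⟩ | h
  · rw [h] at hx
    exact absurd hx.1 hx.2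
  · rw [h, expand_edge, expandTo_ribbonOut, ribbonIn_fst_fst] at hx
    rw [h]
    exact Finset.mem_image_of_mem _ (Diagram.mem_leaving.2 hx)

theorem noCurl_of_isPrime_expand (c : Config V) (a : V → ℕ+) (h : (c.expand a).IsPrime) :
    c.NoCurl := by
  refine fun v => ⟨fun e => h.1 (c.ribbonOut a (v, (c.dir v).bwd)) ?_,
    fun e => h.1 (c.ribbonOut a (v, (c.dir v).fwd)) ?_⟩
  · rw [expand_edge, expandTo_ribbonOut, e, ribbonOut_bwd]
    rfl
  · rw [expand_edge, expandTo_ribbonOut, e, ribbonOut_fwd]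
    rfl

/-- A ribbon that passes from inside to outside `S` has an inner edge where this happens; its
orientation tells forward from backward breaks. -/
theorem exists_fwd_leaving (c : Config V) (a : V → ℕ+) (S : Finset (Σ v : V, Fin (a v))) (v : V)
    (k l : Fin (a v)) (hkl : k ≤ l) (hk : ⟨v, k⟩ ∈ S) (hl : ⟨v, l⟩ ∉ S) :
    ∃ m : Fin (a v), (⟨v, m⟩, (c.dir v).fwd) ∈ (c.expand a).leaving S := by
  obtain ⟨m, _, hm, ⟨h₁, h₂⟩, h₃⟩ := exists_step (p := fun n => ∃ h : n < a v, ⟨v, ⟨n, h⟩⟩ ∈ S)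
    hkl ⟨k.2, hk⟩ (fun ⟨_, h⟩ => hl h)
  have h : m + 1 < a v := lt_of_le_of_lt hm l.2
  refine ⟨⟨m, h₁⟩, Diagram.mem_leaving.2 ⟨h₂, fun h' => h₃ ⟨h, ?_⟩⟩⟩
  rwa [expand_edge, expandTo_fwd c a v ⟨m, h₁⟩ h] at h'

theorem exists_bwd_leaving (c : Config V) (a : V → ℕ+) (S : Finset (Σ v : V, Fin (a v))) (v : V)
    (k l : Fin (a v)) (hkl : k ≤ l) (hk : ⟨v, k⟩ ∉ S) (hl : ⟨v, l⟩ ∈ S) :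
    ∃ m : Fin (a v), (⟨v, m⟩, (c.dir v).bwd) ∈ (c.expand a).leaving S := by
  obtain ⟨m, _, hm, ⟨h₁, h₂⟩, h₃⟩ := exists_step (p := fun n => ∃ h : n < a v, ⟨v, ⟨n, h⟩⟩ ∉ S)
    hkl ⟨k.2, hk⟩ (fun ⟨_, h⟩ => h hl)
  have h : m + 1 < a v := lt_of_le_of_lt hm l.2
  refine ⟨⟨m + 1, h⟩, Diagram.mem_leaving.2 ⟨by_contra fun h' => h₃ ⟨h, h'⟩, ?_⟩⟩
  rwa [expand_edge, expandTo_bwd c a v ⟨m + 1, h⟩ (Nat.succ_pos m)]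

/-- Suppose that at most one edge leaves `S`. A ribbon that meets both `S` and its complement away
from its ends would be left both forwards and backwards, so only one ribbon can be broken, and only
once. If none is broken, `S` comes from a set of ribbons and the diagram has a cut; if one is
broken, it closes up into a curl. -/
theorem isPrime_expand (c : Config V) (hc : c.diagram.IsCutFree) (hn : c.NoCurl) (a : V → ℕ+)
    (ha : ∀ v, 2 ≤ a v) : (c.expand a).IsPrime := by
  have hfl (v : V) : first a v ≠ last a v := by
    intro e
    have h₁ := congrArg Fin.val (eq_of_heq (Sigma.mk.inj e).2)
    have h₂ : 2 ≤ (a v : ℕ) := ha v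
    simp only at h₁
    omega
  constructor
  · rintro ⟨⟨v, k⟩, o⟩ e
    rcases c.expand_edge_cases a v k o with ⟨l, hl, h⟩ | h
    · rw [h] at e
      exact hl (eq_of_heq (Sigma.mk.inj e).2)
    · rw [h, expand_edge, expandTo_ribbonOut] at e
      have hv := congrArg Sigma.fst e
      rw [ribbonIn_fst_fst, ribbonOut_fst_fst] at hv
      obtain ⟨⟨w, i⟩, hw⟩ : ∃ x, c.diagram.edge (v, o) = x := ⟨_, rfl⟩
      rw [hw] at e hv
      obtain rfl : w = v := hv
      obtain rfl | rfl := (c.dir w).eq_fwd_or_eq_bwd o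
      · rw [ribbonOut_fwd] at e
        cases i
        · exact (hn w).2 hw
        · exact hfl w e
      · rw [ribbonOut_bwd] at e
        cases i
        · exact hfl w e.symm
        · exact (hn w).1 hw
  · intro S hS hS'
    change 2 ≤ ((c.expand a).leaving S).card
    by_contra hcard
    have huniq {x y} (hx : x ∈ (c.expand a).leaving S) (hy : y ∈ (c.expand a).leaving S) : x = y :=
      Finset.card_le_one.1 (by omega) x hx y hy
    have hends {v : V} {k l : Fin (a v)}
        (h₁ : (⟨v, k⟩, (c.dir v).fwd) ∈ (c.expand a).leaving S)
        (h₂ : (⟨v, l⟩, (c.dir v).bwd) ∈ (c.expand a).leaving S) : False :=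
      (c.dir v).bwd_ne_fwd (congrArg Prod.snd (huniq h₂ h₁))
    have hle (v : V) (k : Fin (a v)) : k ≤ (last a v).2 := Nat.le_sub_one_of_lt k.2
    have hge (v : V) (k : Fin (a v)) : (first a v).2 ≤ k := Nat.zero_le _
    have hfull {v : V} (hf : first a v ∈ S) (hl : last a v ∈ S) (k : Fin (a v)) : ⟨v, k⟩ ∈ S := by
      by_contra hk
      obtain ⟨m, hm⟩ := c.exists_fwd_leaving a S v _ k (hge v k) hf hk
      obtain ⟨m', hm'⟩ := c.exists_bwd_leaving a S v k _ (hle v k) hk hl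
      exact hends hm hm'
    have hempty {v : V} (hf : first a v ∉ S) (hl : last a v ∉ S) (k : Fin (a v)) :
        ⟨v, k⟩ ∉ S := by
      intro hk
      obtain ⟨m, hm⟩ := c.exists_bwd_leaving a S v _ k (hge v k) hf hk
      obtain ⟨m', hm'⟩ := c.exists_fwd_leaving a S v k _ (hle v k) hk hl
      exact hends hm' hm
    let T : Finset V := Finset.univ.filter fun v => first a v ∈ S ∧ last a v ∈ S
    have hT (v : V) : v ∈ T ↔ first a v ∈ S ∧ last a v ∈ S := by simp [T]
    have hout {v : V} (hv : v ∈ T) (o : OutEnd) : (c.ribbonOut a (v, o)).1 ∈ S := by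
      obtain rfl | rfl := (c.dir v).eq_fwd_or_eq_bwd o
      · rw [ribbonOut_fwd]; exact ((hT v).1 hv).2
      · rw [ribbonOut_bwd]; exact ((hT v).1 hv).1
    -- A ribbon with only one end in `S` already uses up the single edge that leaves `S`.
    by_cases hpart : ∃ v, ¬ (first a v ∈ S ↔ last a v ∈ S)
    · obtain ⟨v, hv⟩ := hpart
      have hbreak {w : V} (hw : ¬ (first a w ∈ S ↔ last a w ∈ S)) :
          ∃ (m : Fin (a w)), (⟨w, m⟩, if first a w ∈ S then (c.dir w).fwd else (c.dir w).bwd) ∈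
            (c.expand a).leaving S := by
        split_ifs with hf
        · exact c.exists_fwd_leaving a S w _ _ (hle w _) hf (by tauto)
        · exact c.exists_bwd_leaving a S w _ _ (hle w _) hf (by tauto)
      obtain ⟨m, hm⟩ := hbreak hv
      have hother {w : V} (hw : w ≠ v) : first a w ∈ S ↔ last a w ∈ S := by
        by_contra hw'
        obtain ⟨m', hm'⟩ := hbreak hw'
        exact hw (congrArg (fun x => x.1.1) (huniq hm' hm))
      have hvT : v ∉ T := fun h => hv (by rw [hT] at h; tauto)
      -- an edge into the set `S` that does not lead to `T` leads to one particular end of `v`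
      have hin {i : V × InEnd} (hi : i.1 ∉ T) (hi' : (ribbonIn a i).1 ∈ S) :
          i = (v, if first a v ∈ S then .sw else .ne) := by
        obtain ⟨w, i⟩ := i
        obtain rfl : w = v := by
          by_contra hw
          have := hother hw
          rw [hT] at hi
          cases i
          · exact hi ⟨this.2 hi', hi'⟩
          · exact hi ⟨hi', this.1 hi'⟩
        cases i
        · rw [if_neg]
          exact fun h => hv ⟨fun _ => hi', fun _ => h⟩
        · rw [if_pos]
          exact hi'
      -- Every edge leaving `T` must stay in `S`, hence arrive at the end of `v` in `S`. Only one
      -- edge arrives there, against cut freeness.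
      have hT0 : T = ∅ := by
        by_contra hne
        have h₁ := hc T (Finset.nonempty_iff_ne_empty.2 hne) fun e => hvT (e ▸ Finset.mem_univ v)
        have h₂ : (c.diagram.leaving T).card ≤ 1 := by
          have key {x : V × OutEnd} (hx : x ∈ c.diagram.leaving T) :
              c.diagram.edge x = (v, if first a v ∈ S then .sw else .ne) := by
            rw [Diagram.mem_leaving] at hx
            refine hin hx.2 ?_
            by_contra h
            rw [← c.expandTo_ribbonOut] at h
            have := huniq (Diagram.mem_leaving.2 ⟨hout hx.1 x.2, h⟩) hm
            have := congrArg (fun x => x.1.1) this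
            simp only [ribbonOut_fst_fst] at this
            exact hvT (this ▸ hx.1)
          exact Finset.card_le_one.2 fun x hx y hy =>
            c.diagram.edge.injective ((key hx).trans (key hy).symm)
        omega
      -- With `T` empty, the outer edge at the end of `v` in `S` stays in `S` and can only arrive at
      -- that same end: a curl.
      by_cases hf : first a v ∈ S
      · have h₁ : (c.expand a).edge (first a v, (c.dir v).bwd) =
            ribbonIn a (c.diagram.edge (v, (c.dir v).bwd)) := by
          rw [expand_edge, ← ribbonOut_bwd, expandTo_ribbonOut]
        refine (hn v).1 ((hin (by simp [hT0]) ?_).trans (by rw [if_pos hf]))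
        by_contra h
        rw [← h₁] at h
        have := huniq hm (Diagram.mem_leaving.2 ⟨hf, h⟩)
        rw [if_pos hf] at this
        exact (c.dir v).bwd_ne_fwd (congrArg Prod.snd this).symm
      · have hl : last a v ∈ S := by tauto
        have h₁ : (c.expand a).edge (last a v, (c.dir v).fwd) =
            ribbonIn a (c.diagram.edge (v, (c.dir v).fwd)) := by
          rw [expand_edge, ← ribbonOut_fwd, expandTo_ribbonOut]
        refine (hn v).2 ((hin (by simp [hT0]) ?_).trans (by rw [if_neg hf]))
        by_contra h
        rw [← h₁] at h
        have := huniq hm (Diagram.mem_leaving.2 ⟨hl, h⟩)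
        rw [if_neg hf] at this
        exact (c.dir v).bwd_ne_fwd (congrArg Prod.snd this)
    · push Not at hpart
      have hST (k : Σ v : V, Fin (a v)) : k ∈ S ↔ k.1 ∈ T := by
        obtain ⟨v, k⟩ := k
        rw [hT]
        constructor
        · intro hk
          by_contra h
          exact hempty (by have := hpart v; tauto) (by have := hpart v; tauto) k hk
        · exact fun h => hfull h.1 h.2 k
      have hT' : T.Nonempty := by
        obtain ⟨k, hk⟩ := hS
        exact ⟨k.1, (hST k).1 hk⟩
      have h₁ := hc T hT' fun e => hS' (Finset.eq_univ_of_forall fun k =>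
        (hST k).2 (e ▸ Finset.mem_univ _))
      have h₂ : ((c.diagram.leaving T).image (c.ribbonOut a)).card ≤
          ((c.expand a).leaving S).card := by
        refine Finset.card_le_card fun x hx => ?_
        obtain ⟨y, hy, rfl⟩ := Finset.mem_image.1 hx
        rw [Diagram.mem_leaving] at hy ⊢
        rwa [hST, hST, expand_edge, expandTo_ribbonOut, ribbonOut_fst_fst, ribbonIn_fst_fst]
      rw [Finset.card_image_of_injective _ (c.ribbonOut_injective a)] at h₂
      omega

end Config

/-! ### Cycles of permutations in computable form -/

theorem sameCycle_conj {α β : Type} (e : α ≃ β) {σ : Equiv.Perm α} {τ : Equiv.Perm β}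
    (h : ∀ x, τ (e x) = e (σ x)) (x y : α) : τ.SameCycle (e x) (e y) ↔ σ.SameCycle x y := by
  have : τ = e.symm.trans (σ.trans e) := by
    ext z
    obtain ⟨z, rfl⟩ := e.surjective z
    simp [h]
  subst this
  have hz (k : ℤ) (z : α) : ((e.symm.trans (σ.trans e) : Equiv.Perm β) ^ k) (e z) =
      e ((σ ^ k) z) := by
    have := map_zpow e.permCongrHom σ k
    rw [show (e.symm.trans (σ.trans e) : Equiv.Perm β) = e.permCongrHom σ from rfl, ← this]
    simp [Equiv.permCongrHom]
  simp only [Equiv.Perm.SameCycle, hz, e.injective.eq_iff]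

section Cycles

variable {α : Type} [Fintype α] [DecidableEq α]

/-- The power supplied by `exists_pow_eq'` need not be smaller than the cardinality; the least
exponent is, by the pigeonhole principle. This bound keeps the later computations short. -/
theorem exists_iterate_eq {σ : Equiv.Perm α} {x y : α} (h : σ.SameCycle x y) :
    ∃ i < Fintype.card α, σ^[i] x = y := by
  by_contra hc
  push Not at hc
  obtain ⟨i, hi, hi'⟩ := h.exists_pow_eq'
  rw [← Equiv.Perm.iterate_eq_pow] at hi'
  -- the first index at which `y` occurs is too large for the pigeonhole principle
  have hex : ∃ i, σ^[i] x = y := ⟨i, hi'⟩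
  classical
  obtain ⟨n, hn, hmin⟩ : ∃ n, σ^[n] x = y ∧ ∀ m < n, σ^[m] x ≠ y :=
    ⟨Nat.find hex, Nat.find_spec hex, fun m hm => Nat.find_min hex hm⟩
  have hcard : Fintype.card α ≤ n := by
    by_contra h
    exact hc n (by omega) hn
  obtain ⟨a, ha, b, hb, hab, he⟩ := Finset.exists_ne_map_eq_of_card_lt_of_maps_to
    (s := Finset.range (n + 1)) (t := (Finset.univ : Finset α)) (f := fun i => σ^[i] x)
    (by simp; omega) (fun _ _ => Finset.mem_univ _)
  wlog hlt : a < b generalizing a b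
  · exact this b hb a ha hab.symm he.symm (by omega)
  simp only [Finset.mem_range] at hb
  refine hmin (n - b + a) (by omega) ?_
  rw [Function.iterate_add_apply]
  have he : σ^[a] x = σ^[b] x := he
  rw [he, ← Function.iterate_add_apply, Nat.sub_add_cancel (by omega), hn]

/-- The number of cycles of a permutation is the number of elements that come first in their cycle,
where elements are compared by means of an injective map to the natural numbers. -/
theorem card_quotient_sameCycle (σ : Equiv.Perm α) (code : α → ℕ)
    (hcode : Function.Injective code) :
    Nat.card (Quotient (Equiv.Perm.SameCycle.setoid σ)) =
      (Finset.univ.filter fun x => ∀ i < Fintype.card α, code x ≤ code (σ^[i] x)).card := by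
  have hmin (x : α) : (∀ i < Fintype.card α, code x ≤ code (σ^[i] x)) ↔
      ∀ y, σ.SameCycle x y → code x ≤ code y := by
    constructor
    · intro h y hy
      obtain ⟨i, hi, rfl⟩ := exists_iterate_eq hy
      exact h i hi
    · intro h i _
      exact h _ ⟨i, by rw [zpow_natCast, Equiv.Perm.iterate_eq_pow]⟩
  simp only [hmin]
  rw [← Fintype.card_coe, ← Nat.card_eq_fintype_card]
  symm
  refine Nat.card_congr (Equiv.ofBijective
    (fun x => (Quotient.mk (Equiv.Perm.SameCycle.setoid σ) x.1)) ⟨?_, ?_⟩)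
  · rintro ⟨x, hx⟩ ⟨y, hy⟩ h
    have h : σ.SameCycle x y := Quotient.exact h
    simp only [Finset.mem_filter, Finset.mem_univ, true_and] at hx hy
    exact Subtype.ext (hcode (le_antisymm (hx y h) (hy x h.symm)))
  · intro q
    obtain ⟨x, rfl⟩ := q.exists_rep
    classical
    obtain ⟨y, hy, hmin⟩ := Finset.exists_min_image
      (Finset.univ.filter fun y => σ.SameCycle x y) code ⟨x, by simp [Equiv.Perm.SameCycle.refl]⟩
    simp only [Finset.mem_filter, Finset.mem_univ, true_and] at hy hmin
    exact ⟨⟨y, by simpa using fun z hz => hmin z (hy.trans hz)⟩, Quotient.sound hy.symm⟩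

/-- The first `n` elements that are reached from `x`. -/
def orbitList (f : α → α) : ℕ → α → List α
  | 0, _ => []
  | n + 1, x => x :: orbitList f n (f x)

theorem mem_orbitList {f : α → α} {n : ℕ} {x y : α} :
    y ∈ orbitList f n x ↔ ∃ i < n, f^[i] x = y := by
  induction n generalizing x with
  | zero => simp [orbitList]
  | succ n ih =>
    rw [orbitList, List.mem_cons, ih]
    constructor
    · rintro (rfl | ⟨i, hi, rfl⟩)
      · exact ⟨0, by omega, rfl⟩
      · exact ⟨i + 1, by omega, rfl⟩
    · rintro ⟨_ | i, hi, rfl⟩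
      · exact .inl rfl
      · exact .inr ⟨i, by omega, rfl⟩

/-- Transitivity is tested on one orbit, which makes `IsSingle` decidable by a list computation. -/
theorem forall_sameCycle_iff (σ : Equiv.Perm α) (x : α) :
    (∀ y z, σ.SameCycle y z) ↔ ∀ y, y ∈ orbitList σ (Fintype.card α) x := by
  constructor
  · intro h y
    exact mem_orbitList.2 (exists_iterate_eq (h x y))
  · intro h
    have h' (y : α) : σ.SameCycle x y := by
      obtain ⟨i, _, hi⟩ := mem_orbitList.1 (h y)
      exact ⟨i, by rw [zpow_natCast, ← Equiv.Perm.iterate_eq_pow, hi]⟩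
    exact fun y z => (h' y).symm.trans (h' z)

end Cycles

/-! ### Isomorphism invariance of faces and circles; walks of bounded length -/

namespace Diagram

variable {V W : Type}

theorem IsIsoVia.numFaces {D : Diagram V} {D' : Diagram W} {π : V ≃ W} {r : V → Bool}
    (h : D.IsIsoVia D' π r) {turn : InEnd ≃ OutEnd}
    (ht : ∀ b i, turn (i.turn b) = (turn i).turn b) : D'.numFaces turn = D.numFaces turn := by
  refine (Nat.card_congr (Quotient.congr (outMap π r) fun x y => ?_)).symm
  refine (sameCycle_conj (outMap π r) (fun z => ?_) x y).symm
  have := isIsoVia_iff.1 h z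
  simp only [facePerm, Equiv.trans_apply]
  rw [this]
  simp [ht]

theorem IsIsoVia.isSpherical [Fintype V] [Fintype W] {D : Diagram V} {D' : Diagram W} {π : V ≃ W}
    {r : V → Bool} (h : D.IsIsoVia D' π r) (hD : D.IsSpherical) : D'.IsSpherical := by
  unfold IsSpherical at *
  rw [h.numFaces turnRight_turn, h.numFaces turnLeft_turn, hD, Fintype.card_congr π]

theorem IsIsoVia.isSingle {D : Diagram V} {D' : Diagram W} {π : V ≃ W} {r : V → Bool}
    (h : D.IsIsoVia D' π r) (f : W → Bool) : D.IsSingle (f ∘ π) ↔ D'.IsSingle f := by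
  have key := sameCycle_conj (outMap π r) (σ := D.circles (f ∘ π)) (τ := D'.circles f) fun z => by
    have := isIsoVia_iff.1 h z
    simp only [circles, Equiv.trans_apply]
    rw [this]
    simp only [smooth_apply, inMap_apply, outMap_apply, Function.comp_apply]
    split_ifs <;> simp [turnLeft_turn, turnRight_turn]
  constructor
  · intro hs x y
    obtain ⟨x, rfl⟩ := (outMap π r).surjective x
    obtain ⟨y, rfl⟩ := (outMap π r).surjective y
    exact (key x y).2 (hs x y)
  · exact fun hs x y => (key x y).1 (hs _ _)

instance [Fintype V] [DecidableEq V] [Inhabited V] (D : Diagram V) (f : V → Bool) :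
    Decidable (D.IsSingle f) :=
  decidable_of_iff' _ (forall_sameCycle_iff (D.circles f) (default, .nw))

/-- The walk from an incoming end to the place where it leaves the set of crossings, if it does so
within `n` steps. -/
def walkEnd (D : Diagram V) (turn : InEnd ≃ OutEnd) (p : V → Bool) :
    ℕ → V × InEnd → Option (V × OutEnd)
  | 0, _ => none
  | n + 1, i =>
    if p (D.edge (i.1, turn i.2)).1 then walkEnd D turn p n (D.edge (i.1, turn i.2))
    else some (i.1, turn i.2)

theorem SideWalk.of_walkEnd {D : Diagram V} {turn : InEnd ≃ OutEnd} {S : Finset V} {p : V → Bool}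
    (hp : ∀ v, p v = true ↔ v ∈ S) {n : ℕ} {i : V × InEnd} {o : V × OutEnd} (hi : i.1 ∈ S)
    (h : D.walkEnd turn p n i = some o) : D.SideWalk turn S i o := by
  induction n generalizing i with
  | zero => exact absurd h (by simp [walkEnd])
  | succ n ih =>
    rw [walkEnd] at h
    split_ifs at h with h'
    · exact .next i.1 i.2 o hi (ih ((hp _).1 h') h)
    · obtain rfl := Option.some.inj h
      exact .last i.1 i.2 hi

/-- The walk is deterministic and cannot stop before it leaves `S`. Running out of steps is allowed,
so no bound on the length of walks has to be proved. -/
theorem SideWalk.walkEnd_eq {D : Diagram V} {turn : InEnd ≃ OutEnd} {S : Finset V} {p : V → Bool}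
    (hp : ∀ v, p v = true ↔ v ∈ S) {i : V × InEnd} {o : V × OutEnd} (h : D.SideWalk turn S i o)
    (ho : (D.edge o).1 ∉ S) (n : ℕ) :
    D.walkEnd turn p n i = none ∨ D.walkEnd turn p n i = some o := by
  induction h generalizing n with
  | last v i hv =>
    cases n with
    | zero => exact .inl rfl
    | succ n => exact .inr (by rw [walkEnd, if_neg (fun h => ho ((hp _).1 h))])
  | next v i o hv h ih =>
    cases n with
    | zero => exact .inl rfl
    | succ n =>
      rw [walkEnd, if_pos ((hp _).2 h.fst_mem)]
      exact ih ho n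

/-- The walk leads to `o`, unless it is too long. -/
def LeadsTo (D : Diagram V) (turn : InEnd ≃ OutEnd) (p : V → Bool) (n : ℕ) (i : V × InEnd)
    (o : V × OutEnd) : Prop :=
  ∀ o' ∈ D.walkEnd turn p n i, o' = o

instance [DecidableEq V] (D : Diagram V) (turn : InEnd ≃ OutEnd) (p : V → Bool) (n : ℕ)
    (i : V × InEnd) (o : V × OutEnd) : Decidable (D.LeadsTo turn p n i o) :=
  match h : D.walkEnd turn p n i with
  | none => .isTrue (by simp [LeadsTo, h])
  | some o' => if h' : o' = o then .isTrue (by simp [LeadsTo, h, h']) else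
      .isFalse (by simp [LeadsTo, h, h'])

theorem SideWalk.leadsTo {D : Diagram V} {turn : InEnd ≃ OutEnd} {S : Finset V} {p : V → Bool}
    (hp : ∀ v, p v = true ↔ v ∈ S) {i : V × InEnd} {o : V × OutEnd} (h : D.SideWalk turn S i o)
    (ho : (D.edge o).1 ∉ S) (n : ℕ) : D.LeadsTo turn p n i o := by
  intro o' ho'
  rcases h.walkEnd_eq hp ho n with e | e
  · simp [e] at ho'
  · simpa [e, eq_comm] using ho'

end Diagram

/-! ### Diagrams given by tables -/

section Codes

variable {N : ℕ}

/-- The number of an outgoing end. -/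
def outCode (x : Fin N × OutEnd) : ℕ := 2 * x.1 + match x.2 with | .nw => 0 | .se => 1

/-- The number of an incoming end. -/
def inCode (x : Fin N × InEnd) : ℕ := 2 * x.1 + match x.2 with | .ne => 0 | .sw => 1

variable [NeZero N]

/-- The outgoing end with a given number. -/
def decOut (N : ℕ) [NeZero N] (k : ℕ) : Fin N × OutEnd :=
  (Fin.ofNat N (k / 2), if k % 2 = 0 then .nw else .se)

/-- The incoming end with a given number. -/
def decIn (N : ℕ) [NeZero N] (k : ℕ) : Fin N × InEnd :=
  (Fin.ofNat N (k / 2), if k % 2 = 0 then .ne else .sw)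

theorem outCode_lt (x : Fin N × OutEnd) : outCode x < 2 * N := by
  obtain ⟨v, _ | _⟩ := x <;> simp only [outCode] <;> omega

theorem outCode_div (x : Fin N × OutEnd) : outCode x / 2 = x.1 := by
  obtain ⟨v, _ | _⟩ := x <;> simp only [outCode] <;> omega

theorem inCode_div (x : Fin N × InEnd) : inCode x / 2 = x.1 := by
  obtain ⟨v, _ | _⟩ := x <;> simp only [inCode] <;> omega

theorem decOut_outCode (x : Fin N × OutEnd) : decOut N (outCode x) = x := by
  rw [decOut, outCode_div]
  refine Prod.ext (Fin.ext (by simp)) ?_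
  obtain ⟨v, _ | _⟩ := x <;> simp [outCode]

theorem decIn_inCode (x : Fin N × InEnd) : decIn N (inCode x) = x := by
  rw [decIn, inCode_div]
  refine Prod.ext (Fin.ext (by simp)) ?_
  obtain ⟨v, _ | _⟩ := x <;> simp [inCode]

theorem outCode_injective : Function.Injective (outCode : Fin N × OutEnd → ℕ) :=
  Function.LeftInverse.injective decOut_outCode

theorem decIn_fst {k : ℕ} (h : k < 2 * N) : ((decIn N k).1 : ℕ) = k / 2 := by
  simp only [decIn, Fin.val_ofNat]
  exact Nat.mod_eq_of_lt (by omega)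

theorem decOut_fst {k : ℕ} (h : k < 2 * N) : ((decOut N k).1 : ℕ) = k / 2 := by
  simp only [decOut, Fin.val_ofNat]
  exact Nat.mod_eq_of_lt (by omega)

theorem inCode_decIn {k : ℕ} (h : k < 2 * N) : inCode (decIn N k) = k := by
  rw [inCode, decIn_fst h]
  by_cases h' : k % 2 = 0 <;> simp [decIn, h'] <;> omega

theorem outCode_decOut {k : ℕ} (h : k < 2 * N) : outCode (decOut N k) = k := by
  rw [outCode, decOut_fst h]
  by_cases h' : k % 2 = 0 <;> simp [decOut, h'] <;> omega

/-- The codes of ends are chosen so that turning right preserves them; turning left flips the last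
digit. -/
theorem outCode_turnRight (x : Fin N × InEnd) : outCode (x.1, turnRight x.2) = inCode x := by
  obtain ⟨v, _ | _⟩ := x <;> rfl

/-- The number of the other end of the same kind at the same crossing. -/
def oppCode (k : ℕ) : ℕ := k + 1 - 2 * (k % 2)

theorem outCode_turnLeft (x : Fin N × InEnd) :
    outCode (x.1, turnLeft x.2) = oppCode (inCode x) := by
  obtain ⟨v, _ | _⟩ := x <;> simp only [outCode, inCode, turnLeft, oppCode, Equiv.coe_fn_mk] <;>
    omega

theorem card_filter_outCode (p : ℕ → Bool) :
    (Finset.univ.filter fun x : Fin N × OutEnd => p (outCode x)).card =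
      ((List.range (2 * N)).filter p).length := by
  have h : ((List.range (2 * N)).filter p).length =
      ((Finset.range (2 * N)).filter fun k => p k).card := by
    rw [Finset.card_def]
    simp [Finset.range, Multiset.range, Finset.filter]
  rw [h, ← Finset.card_image_of_injective _ outCode_injective]
  congr 1
  ext k
  simp only [Finset.mem_image, Finset.mem_filter, Finset.mem_univ, true_and, Finset.mem_range]
  constructor
  · rintro ⟨x, hx, rfl⟩
    exact ⟨outCode_lt x, hx⟩
  · rintro ⟨hk, hp⟩
    exact ⟨decOut N k, by rwa [outCode_decOut hk], outCode_decOut hk⟩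

/-- The edges given by a table. -/
def tableTo (N : ℕ) [NeZero N] (l : List ℕ) (x : Fin N × OutEnd) : Fin N × InEnd :=
  decIn N (l.getD (outCode x) 0)

/-- The inverse of `tableTo`. -/
def tableFrom (N : ℕ) [NeZero N] (l : List ℕ) (x : Fin N × InEnd) : Fin N × OutEnd :=
  decOut N (l.idxOf (inCode x))

/-- The list is the table of a diagram. -/
def IsTable (N : ℕ) [NeZero N] (l : List ℕ) : Prop :=
  (∀ x, tableFrom N l (tableTo N l x) = x) ∧ ∀ x, tableTo N l (tableFrom N l x) = x

instance (l : List ℕ) : Decidable (IsTable N l) := inferInstanceAs (Decidable (_ ∧ _))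

/-- The diagram given by a table. -/
def Diagram.ofTable (l : List ℕ) (h : IsTable N l) : Diagram (Fin N) where
  edge :=
    { toFun := tableTo N l
      invFun := tableFrom N l
      left_inv := h.1
      right_inv := h.2 }

end Codes

/-! ### Renamings given by lists -/

section Signed

variable {N : ℕ} [NeZero N]

/-- The renaming of crossings given by a list: the entry `2 w` or `2 w + 1` at `v` means that `v` is
renamed `w`, in the latter case with a half turn. -/
def signedFun (N : ℕ) [NeZero N] (s : List ℕ) (v : Fin N) : Fin N := Fin.ofNat N (s.getD v 0 / 2)

/-- The half turns given by a list. -/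
def signedTurn (N : ℕ) (s : List ℕ) (v : Fin N) : Bool := s.getD v 0 % 2 == 1

/-- The renaming and the half turns given by `s` carry the edges `e` to the edges `e'`. -/
def IsoBy (s : List ℕ) (e e' : Fin N × OutEnd → Fin N × InEnd) : Prop :=
  ∀ x, e' (signedFun N s x.1, x.2.turn (signedTurn N s x.1)) =
    (signedFun N s (e x).1, (e x).2.turn (signedTurn N s (e x).1))

instance (s : List ℕ) (e e' : Fin N × OutEnd → Fin N × InEnd) : Decidable (IsoBy s e e') :=
  inferInstanceAs (Decidable (∀ _, _))

theorem IsoBy.isIsoVia {s : List ℕ} {D D' : Diagram (Fin N)} (h : IsoBy s D.edge D'.edge)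
    (hs : Function.Injective (signedFun N s)) :
    D.IsIsoVia D' (Equiv.ofBijective _ (Finite.injective_iff_bijective.1 hs)) (signedTurn N s) :=
  fun v o => h (v, o)

end Signed

/-! ### Enumeration of diagrams -/

section Search

variable {N : ℕ}

/-- The diagram agrees with the initial part `l` of a table. -/
def Agrees [NeZero N] (l : List ℕ) (D : Diagram (Fin N)) : Prop :=
  ∀ x, outCode x < l.length → D.edge x = tableTo N l x

/-- Enumeration of the tables in which the crossings are numbered in the order of their first
occurrence; the part of the table that is known already is given in reversed order, and it
involves `m` crossings. -/
def tableSearch (N : ℕ) (leaf : List ℕ → Bool) : ℕ → ℕ → List ℕ → ℕ → Bool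
  | 0, _, pre, _ => leaf pre.reverse
  | n + 1, k, pre, m =>
    Nat.ble m (k / 2) ||
      ((List.range (2 * m)).all (fun t =>
          pre.elem t || (Nat.blt 1 N && Nat.beq (t / 2) (k / 2)) ||
            tableSearch N leaf n (k + 1) (t :: pre) m) &&
        (Nat.ble N m || tableSearch N leaf n (k + 1) (2 * m :: pre) (m + 1)))

variable [NeZero N]

/-- A loop at a crossing leaves it at most one edge to the others. With a single crossing there is
nothing to cut, and loops are allowed. -/
theorem Diagram.IsCutFree.edge_fst_ne {D : Diagram (Fin N)} (hD : D.IsCutFree) (hN : 1 < N)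
    (x : Fin N × OutEnd) : (D.edge x).1 ≠ x.1 := by
  intro hx
  have h₁ := hD {x.1} ⟨x.1, by simp⟩ (fun e => by
    have := congrArg Finset.card e
    simp at this
    omega)
  have h₂ : D.leaving {x.1} ⊆ {(x.1, x.2.opp)} := by
    rintro ⟨v, o⟩ hy
    rw [mem_leaving] at hy
    simp only [Finset.mem_singleton] at hy ⊢
    obtain ⟨rfl, hy⟩ := hy
    refine Prod.ext rfl ?_
    by_contra ho
    obtain rfl : o = x.2 := by
      cases o <;> cases h : x.2 <;> simp_all [OutEnd.opp]
    exact hy hx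
  have := Finset.card_le_card h₂
  simp at this
  omega

theorem Agrees.cons {D : Diagram (Fin N)} {pre : List ℕ} (h : Agrees pre.reverse D) {t : ℕ}
    (ht : D.edge (decOut N pre.length) = decIn N t) :
    Agrees (t :: pre).reverse D := by
  intro x hx
  rw [List.reverse_cons, List.length_append, List.length_reverse, List.length_singleton] at hx
  rcases Nat.lt_succ_iff_lt_or_eq.1 hx with h' | h'
  · rw [h x (by simpa using h'), tableTo, tableTo, List.reverse_cons, List.getD_append _ _ _ _
      (by simpa using h')]
  · rw [tableTo, List.reverse_cons, List.getD_append_right _ _ _ _ (by simp [h']), h',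
      List.length_reverse, Nat.sub_self, List.getD_cons_zero, ← ht, ← h', decOut_outCode]

theorem getD_mem {l : List ℕ} {k : ℕ} (h : k < l.length) : l.getD k 0 ∈ l := by
  rw [List.getD_eq_getElem _ _ h]
  exact List.getElem_mem h

theorem exists_getD_eq {l : List ℕ} {t : ℕ} (h : t ∈ l) : ∃ k < l.length, l.getD k 0 = t := by
  obtain ⟨k, hk, rfl⟩ := List.mem_iff_getElem.1 h
  exact ⟨k, hk, List.getD_eq_getElem _ _ hk⟩

/-- The search follows the edges of `D` in the order of their outgoing ends. Since `P` respects
isomorphism, a crossing that is met for the first time may be renamed `m` and turned so that it is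
entered at NE, which fixes the code `2 * m`; this change does not affect the part of the table
already read. -/
theorem of_tableSearch {leaf : List ℕ → Bool} {P : Diagram (Fin N) → Prop}
    (hP : ∀ D D' : Diagram (Fin N), D.Iso D' → P D' → P D)
    (hleaf : ∀ l (D : Diagram (Fin N)), leaf l = true → l.length = 2 * N → (∀ t ∈ l, t < 2 * N) →
      Agrees l D → D.IsCutFree → D.IsSpherical → P D)
    (n k : ℕ) (pre : List ℕ) (m : ℕ) (hn : k + n = 2 * N) (hk : pre.length = k)
    (hpre : ∀ t ∈ pre, t < 2 * m) (hm : 0 < m) (hmN : m ≤ N)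
    (h : tableSearch N leaf n k pre m = true) (D : Diagram (Fin N)) (hD : D.IsCutFree)
    (hD' : D.IsSpherical) (hag : Agrees pre.reverse D) : P D := by
  induction n generalizing k pre m D with
  | zero =>
    refine hleaf _ D h (by simp; omega) (fun t ht => ?_) hag hD hD'
    have := hpre t (by simpa using ht)
    omega
  | succ n ih =>
    rw [tableSearch, Bool.or_eq_true, Bool.and_eq_true, List.all_eq_true] at h
    have hval (x : Fin N × OutEnd) (hx : outCode x < k) :
        pre.reverse.getD (outCode x) 0 ∈ pre ∧
          D.edge x = decIn N (pre.reverse.getD (outCode x) 0) :=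
      ⟨List.mem_reverse.1 (getD_mem (by simpa [hk] using hx)), hag x (by simpa [hk] using hx)⟩
    have hfst (x : Fin N × OutEnd) (hx : outCode x < k) : ((D.edge x).1 : ℕ) < m := by
      obtain ⟨h₁, h₂⟩ := hval x hx
      have h₃ := hpre _ h₁
      rw [h₂, decIn_fst (by omega)]
      omega
    have hk2 : k < 2 * N := by omega
    have hkx : outCode (decOut N k) = k := outCode_decOut hk2
    -- If the next crossing has not been met, the crossings met so far are closed under all their
    -- outgoing edges and form a component, against cut freeness.
    by_cases hkm : m ≤ k / 2
    · exfalso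
      let S : Finset (Fin N) := Finset.univ.filter fun u => (u : ℕ) < m
      have hS (u : Fin N) : u ∈ S ↔ (u : ℕ) < m := by simp [S]
      have := hD S ⟨⟨0, by omega⟩, (hS _).2 hm⟩ (fun e => by
        have : (⟨k / 2, by omega⟩ : Fin N) ∈ S := e ▸ Finset.mem_univ _
        rw [hS] at this
        simp only at this
        omega)
      have h0 : D.leaving S = ∅ := by
        refine Finset.eq_empty_of_forall_notMem fun x hx => ?_
        rw [Diagram.mem_leaving, hS, hS] at hx
        have := outCode_div x
        exact hx.2 (hfst x (by omega))
      simp [h0] at this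
    · rcases h with h | ⟨h₁, h₂⟩
      · exact absurd (Nat.le_of_ble_eq_true h) hkm
      by_cases hy : ((D.edge (decOut N k)).1 : ℕ) < m
      · have ht := inCode_div (D.edge (decOut N k))
        have h₃ := h₁ (inCode (D.edge (decOut N k))) (List.mem_range.2 (by omega))
        simp only [Bool.or_eq_true, Bool.and_eq_true, Nat.beq_eq, List.elem_iff, Nat.blt_eq] at h₃
        rcases h₃ with (h₃ | ⟨hN, h₃⟩) | h₃
        · exfalso
          obtain ⟨j, hj, hjt⟩ := exists_getD_eq (List.mem_reverse.2 h₃)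
          rw [List.length_reverse, hk] at hj
          have h₄ := (hval (decOut N j) (by rwa [outCode_decOut (by omega)])).2
          rw [outCode_decOut (by omega), hjt, decIn_inCode] at h₄
          have := congrArg outCode (D.edge.injective h₄)
          rw [hkx, outCode_decOut (by omega)] at this
          omega
        · exfalso
          refine hD.edge_fst_ne hN (decOut N k) (Fin.ext ?_)
          rw [← ht, h₃, ← hkx, outCode_div, hkx]
        · refine ih (k + 1) _ m (by omega) (by simp [hk]) ?_ hm hmN h₃ D hD hD' (hag.cons ?_)
          · intro t ht'
            rcases List.mem_cons.1 ht' with rfl | ht'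
            · omega
            · exact hpre t ht'
          · rw [hk, decIn_inCode]
      · obtain ⟨⟨w, i⟩, hw⟩ : ∃ y, D.edge (decOut N k) = y := ⟨_, rfl⟩
        rw [hw] at hy
        simp only at hy
        have hmN' : m < N := by omega
        have h₃ : tableSearch N leaf n (k + 1) (2 * m :: pre) (m + 1) = true := by
          rcases Bool.or_eq_true _ _ ▸ h₂ with h₂ | h₂
          · exact absurd (Nat.le_of_ble_eq_true h₂) (by omega)
          · exact h₂
        -- The new crossing `w` receives the first free number, with a half turn exactly if the edge
        -- arrives at SW.
        let π : Fin N ≃ Fin N := Equiv.swap w ⟨m, hmN'⟩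
        let r : Fin N → Bool := fun u => decide (u = w) && decide (i = .sw)
        have hπ {u : Fin N} (hu : (u : ℕ) < m) : π u = u :=
          Equiv.swap_apply_of_ne_of_ne (by rintro rfl; omega) (by rintro rfl; simp at hu)
        have hr {u : Fin N} (hu : (u : ℕ) < m) : r u = false := by
          have : u ≠ w := by rintro rfl; omega
          simp [r, this]
        have hiso := D.isIsoVia_relabel π r
        have hout {x : Fin N × OutEnd} (hx : (x.1 : ℕ) < m) : Diagram.outMap π r x = x := by
          simp [hπ hx, hr hx]
        refine hP D _ ⟨π, r, hiso⟩ (ih (k + 1) _ (m + 1) (by omega) (by simp [hk]) ?_ (by omega)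
          (by omega) h₃ _ (hD.of_isIsoVia hiso) (hiso.isSpherical hD') (Agrees.cons ?_ ?_))
        · intro t ht'
          rcases List.mem_cons.1 ht' with rfl | ht'
          · omega
          · have := hpre t ht'
            omega
        · intro x hx
          have hx' : outCode x < k := by simpa [hk] using hx
          have hxm : (x.1 : ℕ) < m := by
            have := outCode_div x
            omega
          rw [← hag x hx]
          have := Diagram.isIsoVia_iff.1 hiso x
          rw [hout hxm] at this
          rw [this]
          simp [hπ (hfst x hx'), hr (hfst x hx')]
        · rw [hk]
          have hxm : ((decOut N k).1 : ℕ) < m := by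
            rw [decOut_fst hk2]
            omega
          have := Diagram.isIsoVia_iff.1 hiso (decOut N k)
          rw [hout hxm, hw] at this
          rw [this]
          have h2m : decIn N (2 * m) = (⟨m, hmN'⟩, .ne) :=
            decIn_inCode (⟨m, hmN'⟩, .ne)
          rw [h2m]
          cases i <;> simp [π, r, InEnd.turn, InEnd.opp]

end Search

/-! ### Recognition of tables -/

/-- No element among the first `n` iterates of `f` at `x` is smaller than `k`. -/
def noneBelow (f : ℕ → ℕ) (k : ℕ) : ℕ → ℕ → Bool
  | 0, _ => true
  | n + 1, x => Nat.ble k x && noneBelow f k n (f x)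

theorem noneBelow_iff {f : ℕ → ℕ} {k n x : ℕ} :
    noneBelow f k n x = true ↔ ∀ i < n, k ≤ f^[i] x := by
  induction n generalizing x with
  | zero => simp [noneBelow]
  | succ n ih =>
    rw [noneBelow, Bool.and_eq_true, ih, Nat.ble_eq, Nat.forall_lt_succ_left']
    simp only [Function.iterate_zero, id_eq, Function.iterate_succ, Function.comp_apply]

/-- The number of cycles of the permutation `f` of the numbers less than `n`. -/
def numCycles (f : ℕ → ℕ) (n : ℕ) : ℕ := ((List.range n).filter fun k => noneBelow f k n k).length

section Tables

variable {N : ℕ} [NeZero N]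

theorem card_sameCycle_eq_numCycles (σ : Equiv.Perm (Fin N × OutEnd)) {f : ℕ → ℕ}
    (hf : ∀ x, outCode (σ x) = f (outCode x)) :
    Nat.card (Quotient (Equiv.Perm.SameCycle.setoid σ)) = numCycles f (2 * N) := by
  have hi (i : ℕ) (x : Fin N × OutEnd) : outCode (σ^[i] x) = f^[i] (outCode x) :=
    (Function.Semiconj.iterate_right (f := outCode) hf i).eq x
  have hc : Fintype.card (Fin N × OutEnd) = 2 * N := by
    rw [Fintype.card_prod, Fintype.card_fin, mul_comm]
    rfl
  rw [card_quotient_sameCycle σ outCode outCode_injective, numCycles, ← card_filter_outCode]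
  simp only [hi, hc, noneBelow_iff]

/-- Euler's formula for a table. -/
def sphericalTable (N : ℕ) (l : List ℕ) : Bool :=
  Nat.beq (numCycles (fun k => l.getD k 0) (2 * N) +
    numCycles (fun k => oppCode (l.getD k 0)) (2 * N)) (N + 2)

/-- Less than two edges leave the set of crossings with the binary digits of `m`. -/
def cutTable (N : ℕ) (l : List ℕ) (m : ℕ) : Bool :=
  Nat.ble ((List.range (2 * N)).filter fun k =>
    m.testBit (k / 2) && !m.testBit (l.getD k 0 / 2)).length 1

theorem inCode_edge_of_agrees {D : Diagram (Fin N)} {l : List ℕ} (h : Agrees l D)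
    (hl : l.length = 2 * N) (hlt : ∀ t ∈ l, t < 2 * N) (x : Fin N × OutEnd) :
    inCode (D.edge x) = l.getD (outCode x) 0 := by
  have hx : outCode x < l.length := hl ▸ outCode_lt x
  rw [h x hx, tableTo, inCode_decIn (hlt _ (getD_mem hx))]

theorem isSpherical_iff_of_agrees {D : Diagram (Fin N)} {l : List ℕ} (h : Agrees l D)
    (hl : l.length = 2 * N) (hlt : ∀ t ∈ l, t < 2 * N) :
    D.IsSpherical ↔ sphericalTable N l = true := by
  have he := inCode_edge_of_agrees h hl hlt
  rw [Diagram.IsSpherical, Diagram.numFaces, Diagram.numFaces,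
    card_sameCycle_eq_numCycles (f := fun k => l.getD k 0) _ fun x => ?_,
    card_sameCycle_eq_numCycles (f := fun k => oppCode (l.getD k 0)) _ fun x => ?_,
    sphericalTable, Nat.beq_eq, Fintype.card_fin]
  · rw [← he, ← outCode_turnLeft]
    rfl
  · rw [← he, ← outCode_turnRight]
    rfl

theorem card_leaving_of_agrees {D : Diagram (Fin N)} {l : List ℕ} (h : Agrees l D)
    (hl : l.length = 2 * N) (hlt : ∀ t ∈ l, t < 2 * N) (m : ℕ) :
    (D.leaving (Finset.univ.filter fun v : Fin N => m.testBit v)).card =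
      ((List.range (2 * N)).filter fun k =>
        m.testBit (k / 2) && !m.testBit (l.getD k 0 / 2)).length := by
  rw [← card_filter_outCode]
  congr 1
  ext x
  rw [Finset.mem_filter, ← inCode_edge_of_agrees h hl hlt, outCode_div, inCode_div,
    Diagram.mem_leaving]
  simp

/-- The table is not one of a cut free diagram on the sphere, or it is carried by one of the
listed renamings to one of the diagrams `T`. -/
def leafCheck {n : ℕ} (T : Fin n → Diagram (Fin N)) (L : List (Fin n × List ℕ)) (l : List ℕ) :
    Bool :=
  !sphericalTable N l || ((List.range (2 ^ N - 2)).any fun m => cutTable N l (m + 1)) ||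
    L.any fun p => decide (IsoBy p.2 (tableTo N l) (T p.1).edge)

theorem exists_iso_of_leafCheck {n : ℕ} {T : Fin n → Diagram (Fin N)} {L : List (Fin n × List ℕ)}
    (hL : ∀ p ∈ L, Function.Injective (signedFun N p.2)) {l : List ℕ} {D : Diagram (Fin N)}
    (h : leafCheck T L l = true) (hl : l.length = 2 * N) (hlt : ∀ t ∈ l, t < 2 * N)
    (hag : Agrees l D) (hD : D.IsCutFree) (hD' : D.IsSpherical) : ∃ i, D.Iso (T i) := by
  rw [leafCheck, (isSpherical_iff_of_agrees hag hl hlt).1 hD', Bool.not_true, Bool.false_or,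
    Bool.or_eq_true, List.any_eq_true, List.any_eq_true] at h
  rcases h with ⟨m, hm, hc⟩ | ⟨p, hp, hi⟩
  · exfalso
    rw [List.mem_range] at hm
    rw [cutTable, ← card_leaving_of_agrees hag hl hlt, Nat.ble_eq] at hc
    have h2 := hD (Finset.univ.filter fun v : Fin N => (m + 1).testBit v) ?_ ?_
    · omega
    · obtain ⟨i, hi⟩ := Nat.exists_testBit_of_ne_zero (Nat.succ_ne_zero m)
      have hiN : i < N := by
        by_contra hiN
        rw [Nat.testBit_eq_false_of_lt (lt_of_lt_of_le (by omega : m + 1 < 2 ^ N)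
          (Nat.pow_le_pow_right (by omega) (by omega)))] at hi
        exact absurd hi (by simp)
      exact ⟨⟨i, hiN⟩, by simpa using hi⟩
    · intro e
      -- The numbers `m + 1` with `m < 2 ^ N - 2` are the masks of the nonempty proper sets of
      -- crossings.
      have : m + 1 = 2 ^ N - 1 := by
        refine Nat.eq_of_testBit_eq fun i => ?_
        rw [Nat.testBit_two_pow_sub_one]
        by_cases hiN : i < N
        · have : (⟨i, hiN⟩ : Fin N) ∈ Finset.univ.filter fun v : Fin N => (m + 1).testBit v := by
            rw [e]
            exact Finset.mem_univ _
          simpa [hiN] using this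
        · rw [Nat.testBit_eq_false_of_lt (lt_of_lt_of_le (by omega : m + 1 < 2 ^ N)
            (Nat.pow_le_pow_right (by omega) (by omega)))]
          simp [hiN]
      omega
  · have he : (D.edge : Fin N × OutEnd → Fin N × InEnd) = tableTo N l :=
      funext fun x => hag x (hl ▸ outCode_lt x)
    rw [← he] at hi
    exact ⟨p.1, _, _, (of_decide_eq_true hi).isIsoVia (hL p hp)⟩

/-- Every cut free diagram on the sphere is one of the diagrams `T`, if the search says so. -/
theorem exists_iso_of_tableSearch {n : ℕ} {T : Fin n → Diagram (Fin N)}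
    {L : List (Fin n × List ℕ)} (hL : ∀ p ∈ L, Function.Injective (signedFun N p.2))
    (h : tableSearch N (leafCheck T L) (2 * N) 0 [] 1 = true) (D : Diagram (Fin N))
    (hD : D.IsCutFree) (hD' : D.IsSpherical) : ∃ i, D.Iso (T i) := by
  refine of_tableSearch (P := fun D => ∃ i, D.Iso (T i)) ?_ ?_ (2 * N) 0 [] 1 (by omega) rfl
    (by simp) one_pos (Nat.one_le_iff_ne_zero.2 (NeZero.ne N)) h D hD hD' fun x hx => ?_
  · rintro D D' hi ⟨i, hi'⟩
    exact ⟨i, hi.trans hi'⟩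
  · intro l D h hl hlt hag hc hs
    exact exists_iso_of_leafCheck hL h hl hlt hag hc hs
  · exact absurd hx (by simp)

theorem agrees_ofTable {l : List ℕ} (h : IsTable N l) : Agrees l (Diagram.ofTable l h) :=
  fun _ _ => rfl

end Tables

/-! ### Behaviour of smoothings under reflection and reversal -/

namespace Diagram

variable {V : Type}

theorem isSingle_mirror (D : Diagram V) (f : V → Bool) :
    (D.IsSingle fun v => !f v) ↔ D.mirror.IsSingle f := by
  have key := sameCycle_conj (outMap (Equiv.refl V) fun _ => true)
    (σ := D.circles fun v => !f v) (τ := D.mirror.circles f) fun z => by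
      obtain ⟨v, o⟩ := z
      have h : D.mirror.edge (v, o.turn true) = D.edge (v, o) := by cases o <;> rfl
      simp only [circles, Equiv.trans_apply, outMap_apply, Equiv.refl_apply, h, smooth_apply]
      cases f (D.edge (v, o)).1 <;> cases (D.edge (v, o)).2 <;> rfl
  exact ⟨fun h x y => by
    obtain ⟨x, rfl⟩ := (outMap (Equiv.refl V) fun _ => true).surjective x
    obtain ⟨y, rfl⟩ := (outMap (Equiv.refl V) fun _ => true).surjective y
    exact (key x y).2 (h x y), fun h x y => (key x y).1 (h _ _)⟩

/-- The same circles are traversed in the opposite sense: a circle of `D` read backwards is a circle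
of the reversed diagram, with left and right smoothings exchanged. -/
theorem isSingle_reverse (D : Diagram V) (f : V → Bool) :
    (D.IsSingle fun v => !f v) ↔ D.reverse.IsSingle f := by
  have key := sameCycle_conj (outMap (Equiv.refl V) fun v => !f v)
    (σ := (D.circles fun v => !f v).symm) (τ := D.reverse.circles f) fun z => by
      obtain ⟨z, rfl⟩ := (D.circles fun v => !f v).surjective z
      rw [Equiv.symm_apply_apply]
      obtain ⟨y, hy⟩ : ∃ y, D.edge z = y := ⟨_, rfl⟩
      have h₁ : outMap (Equiv.refl V) (fun v => !f v) ((D.circles fun v => !f v) z) =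
          (y.1, turnRight y.2) := by
        obtain ⟨w, i⟩ := y
        simp only [circles, Equiv.trans_apply, hy, smooth_apply, outMap_apply, Equiv.refl_apply]
        cases f w <;> cases i <;> rfl
      have h₂ : D.reverse.edge (y.1, turnRight y.2) = (z.1, turnLeft.symm z.2) := by
        simp [Diagram.reverse, ← hy, Prod.map]
      rw [h₁]
      obtain ⟨v, o⟩ := z
      simp only [circles, Equiv.trans_apply, h₂, smooth_apply, outMap_apply, Equiv.refl_apply]
      cases f v <;> cases o <;> rfl
  have key' (x y) := (key x y).trans Equiv.Perm.sameCycle_inv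
  exact ⟨fun h x y => by
    obtain ⟨x, rfl⟩ := (outMap (Equiv.refl V) fun v => !f v).surjective x
    obtain ⟨y, rfl⟩ := (outMap (Equiv.refl V) fun v => !f v).surjective y
    exact (key' x y).2 (h x y), fun h x y => (key' x y).1 (h _ _)⟩

end Diagram

/-! ### Conway numbers, merging ribbons and curls under isomorphism -/

namespace Config

variable {V : Type}

section Conway

variable [Fintype V] [DecidableEq V] [Nonempty V]

/-- The flag `b` covers reflection and reversal: they exchange both the directions and the two
smoothings, so the choice between the factors `a v` and `1` is unchanged. -/
theorem conway_comp {c c' : Config V} (π : V ≃ V) (b : Bool)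
    (hdir : ∀ v, c'.dir (π v) = if b then (c.dir v).other else c.dir v)
    (hs : ∀ f, (c.diagram.IsSingle fun v => b ^^ f (π v)) ↔ c'.diagram.IsSingle f) (a : V → ℕ+) :
    c.conway (a ∘ π) = c'.conway a := by
  classical
  rw [conway_eq_sum, conway_eq_sum]
  refine (Fintype.sum_equiv (π.symm.arrowCongr (Equiv.refl Bool)) _ _ fun r => ?_).symm
  have h : c.turns (π.symm.arrowCongr (Equiv.refl Bool) r) = fun v => b ^^ c'.turns r (π v) := by
    funext v
    simp only [turns, hdir]
    cases b <;> cases h : c.dir v <;> cases h' : r (π v) <;> simp [Dir.other, h']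
  rw [h]
  simp only [hs]
  refine if_congr Iff.rfl ?_ rfl
  rw [← Equiv.prod_comp π]
  simp

/-- The Conway numbers agree up to a permutation of the variables. -/
def SameConway (c c' : Config V) : Prop := ∃ ρ : Equiv.Perm V, ∀ a, c.conway a = c'.conway (a ∘ ρ)

theorem SameConway.symm {c c' : Config V} (h : c.SameConway c') : c'.SameConway c := by
  obtain ⟨ρ, h⟩ := h
  refine ⟨ρ.symm, fun a => ?_⟩
  rw [h, Function.comp_assoc, ← Equiv.coe_trans, Equiv.self_trans_symm]
  rfl

theorem SameConway.trans {c c' c'' : Config V} (h : c.SameConway c') (h' : c'.SameConway c'') :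
    c.SameConway c'' := by
  obtain ⟨ρ, h⟩ := h
  obtain ⟨ρ', h'⟩ := h'
  exact ⟨ρ'.trans ρ, fun a => by rw [h, h']; rfl⟩

theorem Iso.sameConway {c c' : Config V} (h : c.Iso c') : c.SameConway c' := by
  obtain ⟨π, r, h, hd⟩ := h
  refine SameConway.symm ⟨π, fun a => ?_⟩
  refine (conway_comp π false hd (fun f => ?_) a).symm
  rw [← h.isSingle]
  simp only [Bool.false_xor]
  rfl

theorem sameConway_mirror (c : Config V) : c.SameConway c.mirror :=
  ⟨Equiv.refl V, conway_comp (Equiv.refl V) true (fun _ => rfl) fun f => by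
    simp only [Bool.true_xor, Equiv.refl_apply]
    exact c.diagram.isSingle_mirror f⟩

theorem sameConway_reverse (c : Config V) : c.SameConway c.reverse :=
  ⟨Equiv.refl V, conway_comp (Equiv.refl V) true (fun _ => rfl) fun f => by
    simp only [Bool.true_xor, Equiv.refl_apply]
    exact c.diagram.isSingle_reverse f⟩

end Conway

/-- Two different ribbons of the same direction form only one ribbon, after half turns. -/
def WeaklyMerges (c : Config V) : Prop :=
  ∃ v w : V, v ≠ w ∧ c.dir v = c.dir w ∧ ∃ b b' : Bool,
    c.diagram.edge (v, (c.dir v).fwd.turn b) = (w, InEnd.sw.turn b') ∧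
      c.diagram.edge (w, (c.dir v).bwd.turn b') = (v, InEnd.ne.turn b)

theorem HasMergingRibbons.weaklyMerges {c : Config V} (h : c.HasMergingRibbons) :
    c.WeaklyMerges := by
  obtain ⟨v, w, hvw, hd, h₁, h₂⟩ := h
  exact ⟨v, w, hvw, hd, false, false, h₁, h₂⟩

theorem WeaklyMerges.of_iso {c c' : Config V} (hi : c.Iso c') (h : c.WeaklyMerges) :
    c'.WeaklyMerges := by
  obtain ⟨v, w, hvw, hd, b, b', h₁, h₂⟩ := h
  obtain ⟨π, r, hπ, hr⟩ := hi
  rw [Diagram.isIsoVia_iff] at hπ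
  refine ⟨π v, π w, π.injective.ne hvw, by rw [hr, hr, hd], b ^^ r v, b' ^^ r w, ?_, ?_⟩
  · have := hπ (v, (c.dir v).fwd.turn b)
    rw [h₁] at this
    simpa only [Diagram.outMap_apply, Diagram.inMap_apply, OutEnd.turn_turn, InEnd.turn_turn,
      hr] using this
  · have := hπ (w, (c.dir v).bwd.turn b')
    rw [h₂] at this
    simpa only [Diagram.outMap_apply, Diagram.inMap_apply, OutEnd.turn_turn, InEnd.turn_turn,
      hr] using this

/-- The weak form is invariant under half turns, hence can be tested on any representative; suitable
half turns of the two ribbons turn it into genuine merging. -/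
theorem WeaklyMerges.exists_iso [DecidableEq V] {c : Config V} (h : c.WeaklyMerges) :
    ∃ c', c.Iso c' ∧ c'.HasMergingRibbons := by
  obtain ⟨v, w, hvw, hd, b, b', h₁, h₂⟩ := h
  let r : V → Bool := fun u => if u = v then b else b'
  have hv : r v = b := if_pos rfl
  have hw : r w = b' := if_neg hvw.symm
  have hi := c.diagram.isIsoVia_relabel (Equiv.refl V) r
  refine ⟨⟨c.diagram.relabel (Equiv.refl V) r, c.dir⟩, ⟨_, _, hi, fun _ => rfl⟩, v, w, hvw, hd,
    ?_, ?_⟩ <;> rw [Diagram.isIsoVia_iff] at hi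
  · have := hi (v, (c.dir v).fwd.turn b)
    rw [h₁] at this
    simpa [OutEnd.turn_turn, InEnd.turn_turn, hv, hw] using this
  · have := hi (w, (c.dir v).bwd.turn b')
    rw [h₂] at this
    simpa [OutEnd.turn_turn, InEnd.turn_turn, hv, hw] using this

theorem NoCurl.of_iso {c c' : Config V} (hi : c.Iso c') (h : c.NoCurl) : c'.NoCurl := by
  obtain ⟨π, r, hπ, hr⟩ := hi
  rw [Diagram.isIsoVia_iff] at hπ
  intro v
  obtain ⟨v, rfl⟩ := π.surjective v
  have key (o : OutEnd) (i : InEnd) (hc : c'.diagram.edge (π v, o) = (π v, i)) :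
      c.diagram.edge (v, o.turn (r v)) = (v, i.turn (r v)) := by
    refine (Diagram.inMap π r).injective ?_
    rw [← hπ]
    simpa [OutEnd.turn_turn, InEnd.turn_turn] using hc
  constructor
  all_goals
    intro hc
    rw [hr] at hc
    have h' := key _ _ hc
    cases hrv : r v <;> cases hd : c.dir v <;> rw [hrv, hd] at h'
    all_goals
      have hn := h v
      rw [hd] at hn
      first
      | exact hn.1 h'
      | exact hn.2 h'

theorem representative_iso (c : Config V) : c.representative.Iso c.diagram := by
  let : Unique (Fin ((1 : ℕ+) : ℕ)) := inferInstanceAs (Unique (Fin 1))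
  refine Diagram.Iso.symm ⟨(Equiv.sigmaUnique V fun _ => Fin ((1 : ℕ+) : ℕ)).symm, fun _ => false,
    fun v o => ?_⟩
  have h (i : V × InEnd) : ribbonIn (fun _ => 1) i =
      ((Equiv.sigmaUnique V fun _ => Fin ((1 : ℕ+) : ℕ)).symm i.1, i.2) := by
    obtain ⟨v, _ | _⟩ := i <;>
      exact Prod.ext (Sigma.ext rfl (heq_of_eq (Subsingleton.elim _ _))) rfl
  have h' : c.ribbonOut (fun _ => 1) (v, o) =
      ((Equiv.sigmaUnique V fun _ => Fin ((1 : ℕ+) : ℕ)).symm v, o) := by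
    rw [ribbonOut]
    split_ifs <;> exact Prod.ext (Sigma.ext rfl (heq_of_eq (Subsingleton.elim _ _))) rfl
  have := c.expandTo_ribbonOut (fun _ => 1) (v, o)
  rw [h', h] at this
  exact this

end Config

/-! ### Tangles and flypes of a given diagram -/

/-- Four ends of crossings. -/
structure Ends (V : Type) where
  nw : V × OutEnd
  se : V × OutEnd
  ne : V × InEnd
  sw : V × InEnd

namespace Diagram

variable {V : Type} [DecidableEq V]

/-- The diagram in which two tangles with the given ends are exchanged. -/
def flyped (D : Diagram V) (a b : Ends V) : Diagram V where
  edge := (Equiv.swap a.se b.se).trans ((Equiv.swap a.nw b.nw).trans (D.edge.trans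
    ((Equiv.swap a.sw b.sw).trans (Equiv.swap a.ne b.ne))))

theorem ext_of_edge {D D' : Diagram V} (h : ∀ o, D.edge o = D'.edge o) : D = D' :=
  Diagram.ext (Equiv.ext h)

variable {N : ℕ}

/-- The edge starting at `o` leaves the set of crossings with the binary digits of `m`. -/
def Leaves (D : Diagram (Fin N)) (m : ℕ) (o : Fin N × OutEnd) : Prop :=
  (m.testBit o.1 && !m.testBit (D.edge o).1) = true

/-- The edge arriving at `i` enters the set of crossings with the binary digits of `m`. -/
def Enters (D : Diagram (Fin N)) (m : ℕ) (i : Fin N × InEnd) : Prop :=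
  (m.testBit i.1 && !m.testBit (D.edge.symm i).1) = true

instance (D : Diagram (Fin N)) (m : ℕ) (o : Fin N × OutEnd) : Decidable (D.Leaves m o) :=
  inferInstanceAs (Decidable (_ = _))

instance (D : Diagram (Fin N)) (m : ℕ) (i : Fin N × InEnd) : Decidable (D.Enters m i) :=
  inferInstanceAs (Decidable (_ = _))

theorem leaves_iff {D : Diagram (Fin N)} {m : ℕ} {A : Finset (Fin N)}
    (hA : ∀ v : Fin N, m.testBit v = true ↔ v ∈ A) (o : Fin N × OutEnd) :
    D.Leaves m o ↔ o.1 ∈ A ∧ (D.edge o).1 ∉ A := by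
  simp [Leaves, ← hA]

theorem enters_iff {D : Diagram (Fin N)} {m : ℕ} {A : Finset (Fin N)}
    (hA : ∀ v : Fin N, m.testBit v = true ↔ v ∈ A) (i : Fin N × InEnd) :
    D.Enters m i ↔ i.1 ∈ A ∧ (D.edge.symm i).1 ∉ A := by
  simp [Enters, ← hA]

/-- `nw` and `se` are the places where edges leave the set of crossings `m`. -/
def OutEnds (D : Diagram (Fin N)) (m : ℕ) (nw se : Fin N × OutEnd) : Prop :=
  nw ≠ se ∧ ∀ o, D.Leaves m o → o = nw ∨ o = se

/-- `ne` and `sw` are the places where edges enter the set of crossings `m`. -/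
def InEnds (D : Diagram (Fin N)) (m : ℕ) (ne sw : Fin N × InEnd) : Prop :=
  ne ≠ sw ∧ ∀ i, D.Enters m i → i = ne ∨ i = sw

instance (D : Diagram (Fin N)) (m : ℕ) (nw se : Fin N × OutEnd) : Decidable (D.OutEnds m nw se) :=
  inferInstanceAs (Decidable (_ ∧ _))

instance (D : Diagram (Fin N)) (m : ℕ) (ne sw : Fin N × InEnd) : Decidable (D.InEnds m ne sw) :=
  inferInstanceAs (Decidable (_ ∧ _))

/-- No side of the set of crossings `m` joins the wrong ends. -/
def SidesFit (D : Diagram (Fin N)) (m : ℕ) (e : Ends (Fin N)) : Prop :=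
  D.LeadsTo turnRight (fun v => m.testBit v) (2 * N) e.ne e.nw ∧
    D.LeadsTo turnRight (fun v => m.testBit v) (2 * N) e.sw e.se ∧
    D.LeadsTo turnLeft (fun v => m.testBit v) (2 * N) e.ne e.se ∧
    D.LeadsTo turnLeft (fun v => m.testBit v) (2 * N) e.sw e.nw

instance (D : Diagram (Fin N)) (m : ℕ) (e : Ends (Fin N)) : Decidable (D.SidesFit m e) :=
  inferInstanceAs (Decidable (_ ∧ _))

/-- The set of crossings `m` is a tangle. -/
def TangleWith (D : Diagram (Fin N)) (m : ℕ) (e : Ends (Fin N)) : Prop :=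
  (D.Leaves m e.nw ∧ D.Leaves m e.se ∧ D.OutEnds m e.nw e.se) ∧
    (D.Enters m e.ne ∧ D.Enters m e.sw ∧ D.InEnds m e.ne e.sw) ∧
    D.walkEnd turnRight (fun v => m.testBit v) (2 * N) e.ne = some e.nw ∧
    D.walkEnd turnRight (fun v => m.testBit v) (2 * N) e.sw = some e.se ∧
    D.walkEnd turnLeft (fun v => m.testBit v) (2 * N) e.ne = some e.se ∧
    D.walkEnd turnLeft (fun v => m.testBit v) (2 * N) e.sw = some e.nw

instance (D : Diagram (Fin N)) (m : ℕ) (e : Ends (Fin N)) : Decidable (D.TangleWith m e) :=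
  inferInstanceAs (Decidable (_ ∧ _))

theorem TangleWith.isTangle {D : Diagram (Fin N)} {m : ℕ} {e : Ends (Fin N)}
    (h : D.TangleWith m e) {A : Finset (Fin N)} (hA : ∀ v : Fin N, m.testBit v = true ↔ v ∈ A) :
    D.IsTangle A e.nw e.se e.ne e.sw := by
  obtain ⟨⟨h₁, h₂, h₃⟩, ⟨h₄, h₅, h₆⟩, h₇, h₈, h₉, h₀⟩ := h
  have hn := ((enters_iff hA _).1 h₄).1
  have hs := ((enters_iff hA _).1 h₅).1
  refine ⟨h₃.1, h₆.1, fun o => ?_, fun i => ?_, .of_walkEnd hA hn h₇, .of_walkEnd hA hs h₈,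
    .of_walkEnd hA hn h₉, .of_walkEnd hA hs h₀⟩
  · rw [← leaves_iff hA]
    exact ⟨h₃.2 o, by rintro (rfl | rfl) <;> assumption⟩
  · rw [← enters_iff hA]
    exact ⟨h₆.2 i, by rintro (rfl | rfl) <;> assumption⟩

theorem exists_mask (A : Finset (Fin N)) :
    ∃ m : Fin (2 ^ N), ∀ v : Fin N, (m : ℕ).testBit v = true ↔ v ∈ A :=
  ⟨⟨Nat.ofBits fun v => decide (v ∈ A), Nat.ofBits_lt_two_pow _⟩, fun v => by simp⟩

/-- Necessary conditions only: `SidesFit` also tolerates walks that run out of steps. For the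
enumeration of all flypes this is the safe direction; `TangleWith` is the sufficient counterpart
used to exhibit flypes. -/
theorem IsTangle.ends {D : Diagram (Fin N)} {A : Finset (Fin N)} {e : Ends (Fin N)}
    (h : D.IsTangle A e.nw e.se e.ne e.sw) {m : ℕ}
    (hA : ∀ v : Fin N, m.testBit v = true ↔ v ∈ A) :
    (D.Leaves m e.nw ∧ D.Leaves m e.se ∧ D.OutEnds m e.nw e.se) ∧
      (D.Enters m e.ne ∧ D.Enters m e.sw ∧ D.InEnds m e.ne e.sw) ∧ D.SidesFit m e := by
  have ho (o) : D.Leaves m o ↔ o = e.nw ∨ o = e.se := (leaves_iff hA o).trans (h.out_iff o)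
  have hi (i) : D.Enters m i ↔ i = e.ne ∨ i = e.sw := (enters_iff hA i).trans (h.in_iff i)
  have hnw := ((h.out_iff e.nw).2 (.inl rfl)).2
  have hse := ((h.out_iff e.se).2 (.inr rfl)).2
  exact ⟨⟨(ho _).2 (.inl rfl), (ho _).2 (.inr rfl), h.nw_ne_se, fun o => (ho o).1⟩,
    ⟨(hi _).2 (.inl rfl), (hi _).2 (.inr rfl), h.ne_ne_sw, fun i => (hi i).1⟩,
    h.north.leadsTo hA hnw _, h.south.leadsTo hA hse _, h.east.leadsTo hA hse _,
    h.west.leadsTo hA hnw _⟩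

/-- The results of flypes of `D` satisfy `Q`. -/
def AllFlypes (D : Diagram (Fin N)) (Q : Diagram (Fin N) → Prop) : Prop :=
  ∀ m : Fin (2 ^ N), ∀ nw, D.Leaves m nw → ∀ se, D.Leaves m se → D.OutEnds m nw se →
    ∀ ne, D.Enters m ne → ∀ sw, D.Enters m sw → D.InEnds m ne sw →
      D.SidesFit m ⟨nw, se, ne, sw⟩ →
        ∀ m' : Fin (2 ^ N), Nat.land m m' = 0 → D.Leaves m' (D.edge.symm ne) →
          D.Enters m' (D.edge se) → ∀ se', D.Leaves m' se' → D.OutEnds m' (D.edge.symm ne) se' →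
            ∀ ne', D.Enters m' ne' → D.InEnds m' ne' (D.edge se) →
              D.SidesFit m' ⟨D.edge.symm ne, se', ne', D.edge se⟩ →
                Q (D.flyped ⟨nw, se, ne, sw⟩ ⟨D.edge.symm ne, se', ne', D.edge se⟩)

instance (D : Diagram (Fin N)) (Q : Diagram (Fin N) → Prop) [DecidablePred Q] :
    Decidable (D.AllFlypes Q) :=
  inferInstanceAs (Decidable (∀ _, _))

/-- The tangle `A` and its ends determine the NW and SW ends of `B` through the two connecting
edges, so only the two remaining ends of `B` are searched for. -/
theorem AllFlypes.of_eastWestFlype {D D' : Diagram (Fin N)} {Q : Diagram (Fin N) → Prop}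
    (hQ : D.AllFlypes Q) (h : D.EastWestFlype D') : Q D' := by
  obtain ⟨A, B, nw, se, nw', se', ne, sw, ne', sw', hAB, hA, hB, h₁, h₂, h₃⟩ := h
  obtain rfl : nw' = D.edge.symm ne := D.edge.eq_symm_apply.2 h₁
  subst h₂
  obtain ⟨m, hm⟩ := exists_mask A
  obtain ⟨m', hm'⟩ := exists_mask B
  obtain ⟨⟨a₁, a₂, a₃⟩, ⟨a₄, a₅, a₆⟩, a₇⟩ := IsTangle.ends (e := ⟨nw, se, ne, sw⟩) hA hm
  obtain ⟨⟨b₁, b₂, b₃⟩, ⟨b₄, b₅, b₆⟩, b₇⟩ := IsTangle.ends (e := ⟨_, se', ne', _⟩) hB hm'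
  have hand : Nat.land m m' = 0 := by
    refine Nat.eq_of_testBit_eq fun i => ?_
    rw [Nat.zero_testBit]
    change ((m : ℕ) &&& (m' : ℕ)).testBit i = false
    rw [Nat.testBit_and, Bool.and_eq_false_iff]
    by_contra hc
    push Not at hc
    simp only [ne_eq, Bool.not_eq_false] at hc
    have hi : i < N := by
      by_contra hi
      rw [Nat.testBit_eq_false_of_lt (lt_of_lt_of_le m.2 (Nat.pow_le_pow_right (by omega)
        (by omega)))] at hc
      exact absurd hc.1 (by simp)
    exact Finset.disjoint_left.1 hAB ((hm ⟨i, hi⟩).1 hc.1) ((hm' ⟨i, hi⟩).1 hc.2)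
  have key := hQ m nw a₁ se a₂ a₃ ne a₄ sw a₅ a₆ a₇ m' hand b₁ b₅ se' b₂ b₃ ne' b₄ b₆ b₇
  have e : D.flyped ⟨nw, se, ne, sw⟩ ⟨D.edge.symm ne, se', ne', D.edge se⟩ = D' :=
    ext_of_edge fun o => (h₃ o).symm
  exact e ▸ key

theorem eastWestFlype_flyped {D : Diagram (Fin N)} {m m' : ℕ} {a b : Ends (Fin N)}
    (hm : Nat.land m m' = 0) (ha : D.TangleWith m a) (hb : D.TangleWith m' b)
    (h₁ : D.edge b.nw = a.ne) (h₂ : D.edge a.se = b.sw) : D.EastWestFlype (D.flyped a b) := by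
  refine ⟨Finset.univ.filter fun v => m.testBit v, Finset.univ.filter fun v => m'.testBit v,
    _, _, _, _, _, _, _, _, ?_, ha.isTangle fun v => by simp, hb.isTangle fun v => by simp, h₁, h₂,
    fun o => rfl⟩
  refine Finset.disjoint_left.2 fun v hv hv' => ?_
  simp only [Finset.mem_filter, Finset.mem_univ, true_and] at hv hv'
  have : (m &&& m').testBit v = true := by rw [Nat.testBit_and, hv, hv', Bool.and_self]
  rw [show m &&& m' = 0 from hm] at this
  simp at this

end Diagram

/-! ### Directions and sets of crossings as binary digits -/

section Masks

variable (N : ℕ) [NeZero N]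

/-- The directions given by the binary digits of a number; the digit 1 stands for horizontal. -/
def dirs (d : ℕ) (v : Fin N) : Dir := if d.testBit v then .horizontal else .vertical

/-- The digits of `d` are carried along the renaming `s`, and exchanged if `b` is true. -/
def pull (b : Bool) (s : List ℕ) (d : ℕ) : ℕ :=
  Nat.ofBits fun v : Fin N => b ^^ d.testBit (signedFun N s v)

theorem exists_eq_testBit (f : Fin N → Bool) :
    ∃ m : Fin (2 ^ N), f = fun v : Fin N => (m : ℕ).testBit v :=
  ⟨⟨Nat.ofBits f, Nat.ofBits_lt_two_pow _⟩, by funext v; simp⟩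

theorem eq_of_testBit_eq {x y : ℕ} (hx : x < 2 ^ N) (hy : y < 2 ^ N)
    (h : ∀ v : Fin N, x.testBit v = y.testBit v) : x = y := by
  refine Nat.eq_of_testBit_eq fun i => ?_
  by_cases hi : i < N
  · exact h ⟨i, hi⟩
  · have hpow : 2 ^ N ≤ 2 ^ i := Nat.pow_le_pow_right (by omega) (by omega)
    rw [Nat.testBit_eq_false_of_lt (hx.trans_le hpow),
      Nat.testBit_eq_false_of_lt (hy.trans_le hpow)]

theorem exists_eq_dirs (f : Fin N → Dir) : ∃ d < 2 ^ N, f = dirs N d := by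
  obtain ⟨m, hm⟩ := exists_eq_testBit N fun v => decide (f v = .horizontal)
  refine ⟨m, m.2, funext fun v => ?_⟩
  have := congrFun hm v
  rw [dirs, ← this]
  cases f v <;> rfl

variable {N}

theorem pull_lt (b : Bool) (s : List ℕ) (d : ℕ) : pull N b s d < 2 ^ N := Nat.ofBits_lt_two_pow _

theorem dirs_pull (b : Bool) (s : List ℕ) (d : ℕ) (v : Fin N) :
    dirs N (pull N b s d) v =
      if b then (dirs N d (signedFun N s v)).other else dirs N d (signedFun N s v) := by
  rw [dirs, pull, Nat.testBit_ofBits_lt _ _ v.2, dirs]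
  cases b <;> cases d.testBit (signedFun N s v) <;> rfl

theorem Config.iso_of_isoBy {D D' : Diagram (Fin N)} {s : List ℕ} {f f' : Fin N → Dir}
    (h : IsoBy s D.edge D'.edge) (hs : Function.Injective (signedFun N s))
    (hf : ∀ v, f' (signedFun N s v) = f v) : (Config.mk D f).Iso ⟨D', f'⟩ :=
  ⟨_, _, h.isIsoVia hs, hf⟩

theorem Config.iso_of_isoBy_pull {D D' : Diagram (Fin N)} {s : List ℕ} (b : Bool) {d : ℕ}
    (h : IsoBy s D.edge D'.edge) (hs : Function.Injective (signedFun N s)) :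
    (Config.mk D (dirs N (pull N b s d))).Iso
      ⟨D', fun v => if b then (dirs N d v).other else dirs N d v⟩ :=
  Config.iso_of_isoBy h hs fun v => (dirs_pull b s d v).symm

end Masks

section Tables

variable {N : ℕ} [NeZero N]

theorem isCutFree_of_agrees {D : Diagram (Fin N)} {l : List ℕ} (h : Agrees l D)
    (hl : l.length = 2 * N) (hlt : ∀ t ∈ l, t < 2 * N)
    (hc : ∀ m : Fin (2 ^ N - 2), cutTable N l (m + 1) = false) : D.IsCutFree := by
  intro S hS hS'
  obtain ⟨m, hm⟩ := Diagram.exists_mask S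
  obtain rfl : (Finset.univ.filter fun v : Fin N => (m : ℕ).testBit v) = S := by
    ext v
    simp [hm]
  have h0 : (m : ℕ) ≠ 0 := by
    intro e
    obtain ⟨v, hv⟩ := hS
    simp [e] at hv
  have h1 : (m : ℕ) ≠ 2 ^ N - 1 := by
    intro e
    refine hS' (Finset.eq_univ_of_forall fun v => ?_)
    simp [e]
  have := m.2
  have := hc ⟨m - 1, by omega⟩
  rw [cutTable, show (m : ℕ) - 1 + 1 = m by omega, ← card_leaving_of_agrees h hl hlt,
    ← Bool.not_eq_true, Nat.ble_eq] at this
  omega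

end Tables

/-! ### Atlases of diagrams and their soundness -/

/-- A flype of one of the diagrams of an atlas. -/
structure FlypeData (N n : ℕ) where
  source : Fin n
  target : Fin n
  rename : List ℕ
  left : ℕ
  leftEnds : Ends (Fin N)
  right : ℕ
  rightEnds : Ends (Fin N)

/-- Tables of the diagrams with `N` crossings, and of their mutual relations. -/
structure Atlas (N n m : ℕ) [NeZero N] where
  table : Fin n → List ℕ
  isTable : ∀ i, IsTable N (table i)
  start : List (Fin n × List ℕ)
  label : Fin n → List ℕ
  mirrorTo : Fin n → Fin n × List ℕ
  reverseTo : Fin n → Fin n × List ℕ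
  flypesTo : Fin n → List (Fin n × List ℕ)
  flypes : List (FlypeData N n)
  family : Fin m → Config (Fin N)
  root : Fin m → Fin n × ℕ × List ℕ
  terms : Fin m → List ℕ

namespace Atlas

variable {N n m : ℕ} [NeZero N] (A : Atlas N n m)

/-- The diagrams of the atlas. -/
def diagram (i : Fin n) : Diagram (Fin N) := .ofTable (A.table i) (A.isTable i)

/-- The configurations of the atlas. -/
def node (i : Fin n) (d : ℕ) : Config (Fin N) := ⟨A.diagram i, dirs N d⟩

/-- The number `k + 1` if the configuration belongs to the family `k`, and `0` if it belongs to no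
family. -/
def lab (i : Fin n) (d : ℕ) : ℕ := (A.label i).getD d 0

/-- The renaming of the diagram `p.1` is possible and compatible with the labels. -/
def Carries (b : Bool) (i : Fin n) (p : Fin n × List ℕ) : Prop :=
  Function.Injective (signedFun N p.2) ∧
    ∀ d : Fin (2 ^ N), A.lab i d = A.lab p.1 (pull N b p.2 d)

instance (b : Bool) (i : Fin n) (p : Fin n × List ℕ) : Decidable (A.Carries b i p) :=
  inferInstanceAs (Decidable (_ ∧ _))

instance (c : Config (Fin N)) : Decidable c.WeaklyMerges :=
  inferInstanceAs (Decidable (∃ _, _))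

instance (c : Config (Fin N)) : Decidable c.NoCurl :=
  inferInstanceAs (Decidable (∀ _, _))

/-- The flype is one of the diagram `source`, and its result is the diagram `target`. -/
def IsFlype (f : FlypeData N n) : Prop :=
  Nat.land f.left f.right = 0 ∧ (A.diagram f.source).TangleWith f.left f.leftEnds ∧
    (A.diagram f.source).TangleWith f.right f.rightEnds ∧
    (A.diagram f.source).edge f.rightEnds.nw = f.leftEnds.ne ∧
    (A.diagram f.source).edge f.leftEnds.se = f.rightEnds.sw ∧
    Function.Injective (signedFun N f.rename) ∧
    IsoBy f.rename (A.diagram f.target).edge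
      ((A.diagram f.source).flyped f.leftEnds f.rightEnds).edge

instance (f : FlypeData N n) : Decidable (A.IsFlype f) := inferInstanceAs (Decidable (_ ∧ _))

/-- A configuration is connected in at most `t` steps to a listed family or to a configuration in
which two ribbons merge. -/
def reach : ℕ → Fin n → ℕ → Bool
  | 0, _, _ => false
  | t + 1, i, d =>
    decide (∃ k, (A.root k).1 = i ∧ (A.root k).2.1 = d) || decide (A.node i d).WeaklyMerges ||
      (A.flypes.any fun f => decide (f.source = i) && reach t f.target (pull N false f.rename d)) ||
      reach t (A.mirrorTo i).1 (pull N true (A.mirrorTo i).2 d)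

/-- The tables of the atlas are correct and complete. -/
structure IsValid : Prop where
  table_length : ∀ i, (A.table i).length = 2 * N
  table_lt : ∀ i, ∀ t ∈ A.table i, t < 2 * N
  spherical : ∀ i, sphericalTable N (A.table i) = true
  cutFree : ∀ i, ∀ m : Fin (2 ^ N - 2), cutTable N (A.table i) (m + 1) = false
  start_injective : ∀ p ∈ A.start, Function.Injective (signedFun N p.2)
  search : tableSearch N (leafCheck A.diagram A.start) (2 * N) 0 [] 1 = true
  mirror_iso : ∀ i,
    IsoBy (A.mirrorTo i).2 (A.diagram (A.mirrorTo i).1).edge (A.diagram i).mirror.edge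
  mirror_carries : ∀ i, A.Carries true i (A.mirrorTo i)
  reverse_iso : ∀ i,
    IsoBy (A.reverseTo i).2 (A.diagram (A.reverseTo i).1).edge (A.diagram i).reverse.edge
  reverse_carries : ∀ i, A.Carries true i (A.reverseTo i)
  allFlypes : ∀ i, (A.diagram i).AllFlypes fun D =>
    ∃ p ∈ A.flypesTo i, IsoBy p.2 (A.diagram p.1).edge D.edge
  flypes_carries : ∀ i, ∀ p ∈ A.flypesTo i, A.Carries false i p
  flypes_isSingle : ∀ i, ∀ p ∈ A.flypesTo i, ∀ m : Fin (2 ^ N),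
    ((A.diagram p.1).IsSingle fun v => (m : ℕ).testBit (signedFun N p.2 v)) ↔
      (A.diagram i).IsSingle fun v => (m : ℕ).testBit v
  not_weaklyMerges : ∀ i, ∀ d : Fin (2 ^ N), A.lab i d ≠ 0 → ¬ (A.node i d).WeaklyMerges
  isFlype : ∀ f ∈ A.flypes, A.IsFlype f
  exists_reach : ∀ i, ∀ d : Fin (2 ^ N), (A.node i d).NoCurl → A.reach 9 i d = true
  root_injective : ∀ k, Function.Injective (signedFun N (A.root k).2.2)
  root_lt : ∀ k, (A.root k).2.1 < 2 ^ N
  root_lab : ∀ k, A.lab (A.root k).1 (A.root k).2.1 = k + 1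
  root_iso : ∀ k, IsoBy (A.root k).2.2 (A.family k).diagram.edge (A.diagram (A.root k).1).edge
  root_dir : ∀ k v, dirs N (A.root k).2.1 (signedFun N (A.root k).2.2 v) = (A.family k).dir v
  family_noCurl : ∀ k, (A.family k).NoCurl
  terms_nodup : ∀ k, (A.terms k).Nodup
  terms_lt : ∀ k, ∀ x ∈ A.terms k, x < 2 ^ N
  terms_iff : ∀ k, ∀ x : Fin (2 ^ N),
    ((A.family k).diagram.IsSingle ((A.family k).turns fun v => (x : ℕ).testBit v)) ↔
      (x : ℕ) ∈ A.terms k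

/-- The configuration belongs to the family `k`. -/
def Belongs (k : Fin m) (c : Config (Fin N)) : Prop :=
  (∃ i, ∃ d < 2 ^ N, c.Iso (A.node i d) ∧ A.lab i d = k + 1) ∧ c.SameConway (A.family k)

/-- The configuration is equivalent to a listed family or to a configuration in which two ribbons
merge. -/
def Known (c : Config (Fin N)) : Prop :=
  (∃ k, c.Equivalent (A.family k)) ∨ ∃ c', c.Equivalent c' ∧ c'.HasMergingRibbons

variable {A}

theorem Known.of_equivalent {c c' : Config (Fin N)} (h : c.Equivalent c') : A.Known c' → A.Known c
  | .inl ⟨k, hk⟩ => .inl ⟨k, h.trans _ _ _ hk⟩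
  | .inr ⟨c'', h', hm⟩ => .inr ⟨c'', h.trans _ _ _ h', hm⟩

theorem equivalent_of_iso {c c' : Config (Fin N)} (h : c.Iso c') : c.Equivalent c' :=
  .rel _ _ (.iso _ _ h)

namespace IsValid

variable (hA : A.IsValid)
include hA

theorem isSpherical (i : Fin n) : (A.diagram i).IsSpherical :=
  (isSpherical_iff_of_agrees (agrees_ofTable _) (hA.table_length i) (hA.table_lt i)).2
    (hA.spherical i)

theorem isCutFree (i : Fin n) : (A.diagram i).IsCutFree :=
  isCutFree_of_agrees (agrees_ofTable _) (hA.table_length i) (hA.table_lt i) (hA.cutFree i)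

theorem family_iso (k : Fin m) : (A.family k).Iso (A.node (A.root k).1 (A.root k).2.1) :=
  Config.iso_of_isoBy (hA.root_iso k) (hA.root_injective k) (hA.root_dir k)

theorem belongs_family (k : Fin m) : A.Belongs k (A.family k) :=
  ⟨⟨_, _, hA.root_lt k, hA.family_iso k, hA.root_lab k⟩, ⟨Equiv.refl _, fun _ => rfl⟩⟩

/-- Each branch of the search is an actual equivalence: a root is isomorphic to its family, weak
merging is merging after half turns, and the other two branches apply a listed flype or the
reflection, followed by a renaming. -/
theorem known_of_reach (t : ℕ) (i : Fin n) (d : ℕ) (h : A.reach t i d = true) :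
    A.Known (A.node i d) := by
  induction t generalizing i d with
  | zero => exact absurd h (by simp [reach])
  | succ t ih =>
    rw [reach, Bool.or_eq_true, Bool.or_eq_true, Bool.or_eq_true, decide_eq_true_iff,
      decide_eq_true_iff, List.any_eq_true] at h
    rcases h with ((⟨k, rfl, rfl⟩ | h) | ⟨f, hf, h⟩) | h
    · exact .inl ⟨k, equivalent_of_iso (hA.family_iso k).symm⟩
    · obtain ⟨c', hi, hm⟩ := h.exists_iso
      exact .inr ⟨c', equivalent_of_iso hi, hm⟩
    · rw [Bool.and_eq_true, decide_eq_true_iff] at h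
      obtain ⟨rfl, h⟩ := h
      obtain ⟨h₁, h₂, h₃, h₄, h₅, h₆, h₇⟩ := hA.isFlype f hf
      have hfl : (A.node f.source d).EastWestFlype
          ⟨(A.diagram f.source).flyped f.leftEnds f.rightEnds, dirs N d⟩ :=
        ⟨Diagram.eastWestFlype_flyped h₁ h₂ h₃ h₄ h₅, rfl⟩
      refine (ih _ _ h).of_equivalent (.trans _ _ _ (.rel _ _ (.eastWestFlype _ _ hfl)) ?_)
      exact equivalent_of_iso (Config.iso_of_isoBy_pull false h₇ h₆).symm
    · refine (ih _ _ h).of_equivalent (.trans _ _ _ (.rel _ _ (.mirror _)) ?_)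
      exact equivalent_of_iso
        (Config.iso_of_isoBy_pull true (hA.mirror_iso i) (hA.mirror_carries i).1).symm

theorem belongs_of_carries {k : Fin m} {c' : Config (Fin N)} {b : Bool} {i : Fin n} {d : ℕ}
    {p : Fin n × List ℕ} (hd : d < 2 ^ N) (hl : A.lab i d = k + 1) (hp : A.Carries b i p)
    {D' : Diagram (Fin N)} (hi : IsoBy p.2 (A.diagram p.1).edge D'.edge)
    (hc : c'.Iso ⟨D', fun v => if b then (dirs N d v).other else dirs N d v⟩) :
    ∃ i, ∃ d < 2 ^ N, c'.Iso (A.node i d) ∧ A.lab i d = k + 1 :=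
  ⟨p.1, _, pull_lt b p.2 d, hc.trans (Config.iso_of_isoBy_pull b hi hp.1).symm,
    (hp.2 ⟨d, hd⟩).symm.trans hl⟩

/-- Every configuration that belongs to `k` is isomorphic to a labelled node, so it suffices to
follow the four identifications on nodes. There the tables give the new node with the same label. -/
theorem belongs_iff {k : Fin m} {c c' : Config (Fin N)} (h : c.Equivalent c') :
    A.Belongs k c ↔ A.Belongs k c' := by
  refine h.of_closed ?_ ?_ ?_ ?_
  · rintro c c' hi ⟨⟨i, d, hd, h, hl⟩, hc⟩
    exact ⟨⟨i, d, hd, hi.symm.trans h, hl⟩, hi.sameConway.symm.trans hc⟩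
  · rintro c ⟨⟨i, d, hd, h, hl⟩, hc⟩
    exact ⟨hA.belongs_of_carries hd hl (hA.mirror_carries i) (hA.mirror_iso i) h.mirror,
      c.sameConway_mirror.symm.trans hc⟩
  · rintro c ⟨⟨i, d, hd, h, hl⟩, hc⟩
    exact ⟨hA.belongs_of_carries hd hl (hA.reverse_carries i) (hA.reverse_iso i) h.reverse,
      c.sameConway_reverse.symm.trans hc⟩
  · rintro c c' hf ⟨⟨i, d, hd, h, hl⟩, hc⟩
    -- The flype is transported to the node, where all flypes have been enumerated.
    obtain ⟨⟨D', f'⟩, ⟨hD, hf⟩, hi⟩ := hf.exists_of_iso h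
    obtain rfl : f' = dirs N d := hf
    obtain ⟨p, hp, hp'⟩ := (hA.allFlypes i).of_eastWestFlype hD
    have hcar := hA.flypes_carries i p hp
    refine ⟨hA.belongs_of_carries hd hl hcar hp' hi, ?_⟩
    have h₁ := Config.iso_of_isoBy_pull (d := d) false hp' hcar.1
    refine hi.sameConway.trans (h₁.sameConway.symm.trans (.trans ?_ (h.sameConway.symm.trans hc)))
    -- The one-circle smoothings of the node and of its flyped partner correspond, which gives equal
    -- state sums.
    refine Config.SameConway.symm ⟨Equiv.ofBijective _ (Finite.injective_iff_bijective.1 hcar.1),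
      fun a => (Config.conway_comp _ false (fun v => ?_) (fun f => ?_) a).symm⟩
    · exact (dirs_pull false p.2 d v).symm
    · obtain ⟨x, rfl⟩ := exists_eq_testBit N f
      simp only [Bool.false_xor]
      exact hA.flypes_isSingle i p hp x

/-- The list `terms k` contains the masks of the choices that give a single circle; the state sum is
therefore a sum of the monomials with these supports. -/
theorem conway_family (k : Fin m) (a : Fin N → ℕ+) :
    (A.family k).conway a =
      (((A.terms k).map fun x => ∏ v : Fin N, if x.testBit v then (a v : ℕ) else 1).sum : ℕ) := by
  have h : (A.family k).conway a = ∑ r : Fin N → Bool,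
      if (A.family k).diagram.IsSingle ((A.family k).turns r) then
        ∏ v, (if r v then (a v : ℚ) else 1) else 0 := by
    rw [Config.conway_eq_sum]
    refine Finset.sum_congr rfl fun r _ => ?_
    split_ifs <;> rfl
  rw [h, ← List.sum_toFinset _ (hA.terms_nodup k), ← Finset.sum_filter]
  push_cast
  symm
  refine Finset.sum_bij (fun x _ v => x.testBit v) (fun x hx => ?_) (fun x hx y hy hxy => ?_)
    (fun r hr => ?_) (fun x _ => ?_)
  · rw [List.mem_toFinset] at hx
    rw [Finset.mem_filter]
    exact ⟨Finset.mem_univ _, (hA.terms_iff k ⟨x, hA.terms_lt k x hx⟩).2 hx⟩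
  · rw [List.mem_toFinset] at hx hy
    exact eq_of_testBit_eq N (hA.terms_lt k x hx) (hA.terms_lt k y hy) fun v => congrFun hxy v
  · obtain ⟨x, rfl⟩ := exists_eq_testBit N r
    rw [Finset.mem_filter] at hr
    exact ⟨x, List.mem_toFinset.2 ((hA.terms_iff k x).1 hr.2), rfl⟩
  · exact Finset.prod_congr rfl fun v _ => by split_ifs <;> simp

theorem classifies {F : Fin m → (Fin N → ℕ) → ℕ} {t : Fin m → ℕ} {K : Fin m → SomeDiagram}
    (hF : ∀ k a, F k a =
      ((A.terms k).map fun x => ∏ v : Fin N, if x.testBit v then a v else 1).sum)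
    (ht : ∀ k, F k (fun _ => 1) = t k)
    (hinj : ∀ k l, (F k (fun _ => 1), F k (fun _ => 2), F k (fun _ => 3)) =
      (F l (fun _ => 1), F l (fun _ => 2), F l (fun _ => 3)) → k = l)
    (hK : ∀ i (k : Fin m), (∃ d : Fin (2 ^ N), A.lab i d = k + 1) → (A.diagram i).Same (K k).2) :
    Classifies A.family F t K := by
  have hconway (k : Fin m) (a : Fin N → ℕ+) : (A.family k).conway a = F k fun i => (a i : ℕ) := by
    rw [hA.conway_family, hF]
  have hbel {c : Config (Fin N)} {k : Fin m} (h : c.Equivalent (A.family k)) : A.Belongs k c :=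
    (hA.belongs_iff h).2 (hA.belongs_family k)
  have hne (i : Fin n) (c : Config (Fin N)) (d : ℕ) (hi : c.Iso (A.node i d)) (hd : d < 2 ^ N)
      (k : Fin m) (hl : A.lab i d = k + 1) (hm : c.HasMergingRibbons) : False :=
    hA.not_weaklyMerges i ⟨d, hd⟩ (by simp [hl]) (hm.weaklyMerges.of_iso hi)
  refine ⟨fun k => ⟨?_, fun a ha => ?_, fun c' hc' hm => ?_⟩, fun k l hkl => ?_, fun c hc => ?_,
    hconway, fun c k hck => ?_, fun k => ?_, fun c k hck => ?_, fun k => ?_⟩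
  · obtain ⟨π, r, h, -⟩ := (hA.family_iso k).symm
    exact h.isSpherical (hA.isSpherical _)
  · obtain ⟨π, r, h, -⟩ := (hA.family_iso k).symm
    exact (A.family k).isPrime_expand ((hA.isCutFree _).of_isIsoVia h) (hA.family_noCurl k) a ha
  · obtain ⟨⟨i, d, hd, hi, hl⟩, -⟩ := (hA.belongs_iff hc').1 (hA.belongs_family k)
    exact hne i c' d hi hd k hl hm
  -- At constant arguments the unknown permutation of the variables disappears; the values at 1, 2
  -- and 3 separate the families.
  · obtain ⟨-, ρ, hρ⟩ := hbel hkl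
    have h (x : ℕ+) : F k (fun _ => x) = F l (fun _ => x) := by
      have := hρ fun _ => x
      rw [hconway, hconway] at this
      exact_mod_cast this
    exact hinj k l (by
      rw [show F k (fun _ => 1) = F l (fun _ => 1) from h 1,
        show F k (fun _ => 2) = F l (fun _ => 2) from h 2,
        show F k (fun _ => 3) = F l (fun _ => 3) from h 3])
  -- Primeness of one member suffices for cut freeness and the absence of curls, and so for the
  -- search to apply.
  · have hp := hc.2.1 (fun _ => 2) fun _ => le_rfl
    obtain ⟨i, π, r, hi⟩ := exists_iso_of_tableSearch hA.start_injective hA.search c.diagram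
      (c.isCutFree_of_isPrime_expand _ hp) hc.1
    obtain ⟨d, hd, hd'⟩ := exists_eq_dirs N (c.dir ∘ π.symm)
    have hiso : c.Iso (A.node i d) := ⟨π, r, hi, fun v => by
      rw [node, ← hd']
      simp⟩
    have hn : (A.node i d).NoCurl := (c.noCurl_of_isPrime_expand _ hp).of_iso hiso
    rcases (hA.known_of_reach 9 i d (hA.exists_reach i ⟨d, hd⟩ hn)).of_equivalent
      (equivalent_of_iso hiso) with h | ⟨c', hc', hm⟩
    · exact h
    · exact absurd hm (hc.2.2 c' hc')
  · obtain ⟨-, ρ, hρ⟩ := hbel hck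
    exact ⟨ρ, fun a => by rw [hρ, hconway]; rfl⟩
  · refine ⟨(A.terms k).toFinset.image fun x => Finset.univ.filter fun v : Fin N => x.testBit v, ?_,
      fun a => ?_⟩
    all_goals
      have hinj' : Set.InjOn (fun x : ℕ => Finset.univ.filter fun v : Fin N => x.testBit v)
          ((A.terms k).toFinset : Set ℕ) := by
        intro x hx y hy hxy
        simp only [List.coe_toFinset, Set.mem_ofPred_eq] at hx hy
        refine eq_of_testBit_eq N (hA.terms_lt k x hx) (hA.terms_lt k y hy) fun v => ?_
        have := Finset.ext_iff.1 hxy v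
        simp only [Finset.mem_filter, Finset.mem_univ, true_and] at this
        exact Bool.eq_iff_iff.2 this
    · rw [Finset.card_image_of_injOn hinj', ← ht, hF,
        List.toFinset_card_of_nodup (hA.terms_nodup k)]
      simp
    · rw [Finset.sum_image hinj', List.sum_toFinset _ (hA.terms_nodup k), hF]
      simp only [Finset.prod_filter]
  · obtain ⟨⟨i, d, hd, ⟨π, r, hi, -⟩, hl⟩, -⟩ := hbel hck
    exact (hK i k ⟨⟨d, hd⟩, hl⟩).of_iso_left (c.representative_iso.trans ⟨π, r, hi⟩)
  · rw [← ht]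
    exact hconway k fun _ => 1

end IsValid
end Atlas

/-! ### The atlases for one to five ribbons -/

/-- The diagrams and configurations with 1 crossing. -/
def atlasOne : Atlas 1 2 1 where
  table := ![[0, 1],
      [1, 0]]
  isTable := by decide +kernel
  start :=
    [(0, [0]), (1, [0])]
  label :=
    ![[0, 1],
      [1, 0]]
  mirrorTo := ![(1, [1]), (0, [0])]
  reverseTo := ![(1, [0]), (0, [0])]
  flypesTo :=
    ![[],
      []]
  flypes :=
    []
  family :=
    ![⟨.ofTable [1, 0] (by decide +kernel), dirs 1 0⟩]
  root :=
    ![(1, 0, [0])]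
  terms :=
    ![[1]]

/-- The diagrams and configurations with 2 crossings. -/
def atlasTwo : Atlas 2 1 1 where
  table := ![[2, 3, 0, 1]]
  isTable := by decide +kernel
  start :=
    [(0, [0, 2])]
  label :=
    ![[0, 1, 1, 0]]
  mirrorTo := ![(0, [0, 3])]
  reverseTo := ![(0, [0, 3])]
  flypesTo :=
    ![[(0, [0, 2])]]
  flypes :=
    []
  family :=
    ![⟨.ofTable [2, 3, 0, 1] (by decide +kernel), dirs 2 1⟩]
  root :=
    ![(0, 1, [0, 2])]
  terms :=
    ![[0, 3]]

/-- The diagrams and configurations with 3 crossings. -/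
def atlasThree : Atlas 3 2 2 where
  table := ![[2, 4, 0, 5, 1, 3],
      [2, 4, 5, 1, 3, 0]]
  isTable := by decide +kernel
  start :=
    [(0, [0, 2, 4]), (1, [0, 2, 4])]
  label :=
    ![[0, 0, 0, 2, 0, 2, 2, 1],
      [1, 2, 2, 0, 2, 0, 0, 0]]
  mirrorTo := ![(1, [1, 2, 4]), (0, [4, 0, 3])]
  reverseTo := ![(1, [0, 3, 5]), (0, [0, 4, 2])]
  flypesTo :=
    ![[(0, [0, 2, 4])],
      [(1, [0, 5, 3]), (1, [0, 2, 4])]]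
  flypes :=
    []
  family :=
    ![⟨.ofTable [2, 4, 0, 5, 1, 3] (by decide +kernel), dirs 3 7⟩,
      ⟨.ofTable [4, 2, 1, 5, 0, 3] (by decide +kernel), dirs 3 5⟩]
  root :=
    ![(0, 7, [0, 2, 4]), (0, 3, [0, 4, 2])]
  terms :=
    ![[3, 5, 6],
      [1, 4, 7]]

/-- The diagrams and configurations with 4 crossings. -/
def atlasFour : Atlas 4 3 5 where
  table := ![[2, 4, 0, 6, 1, 7, 3, 5],
      [2, 4, 0, 6, 7, 3, 5, 1],
      [2, 4, 6, 1, 7, 0, 5, 3]]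
  isTable := by decide +kernel
  start :=
    [(0, [0, 2, 4, 6]), (1, [0, 2, 4, 6]), (1, [1, 4, 2, 7]), (1, [4, 7, 3, 1]),
     (1, [5, 3, 7, 0]), (2, [0, 2, 4, 6])]
  label :=
    ![[0, 0, 0, 0, 0, 0, 0, 2, 0, 0, 0, 2, 0, 2, 2, 1],
      [0, 4, 4, 3, 0, 5, 5, 4, 0, 5, 5, 4, 0, 0, 0, 0],
      [1, 2, 2, 0, 2, 0, 0, 0, 2, 0, 0, 0, 0, 0, 0, 0]]
  mirrorTo := ![(2, [6, 5, 3, 1]), (1, [5, 7, 3, 1]), (0, [1, 2, 4, 6])]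
  reverseTo := ![(2, [0, 3, 5, 7]), (1, [5, 7, 0, 2]), (0, [0, 4, 2, 7])]
  flypesTo :=
    ![[(0, [0, 2, 4, 6])],
      [(1, [0, 2, 4, 6]), (1, [0, 2, 7, 5])],
      [(2, [0, 5, 7, 2]), (2, [0, 6, 3, 5]), (2, [0, 2, 4, 6]), (2, [0, 6, 4, 2]),
       (2, [0, 2, 7, 5])]]
  flypes :=
    [⟨2, 2, [6, 5, 1, 2], 1, ⟨(0, .nw), (0, .se), (0, .ne), (0, .sw)⟩,
      12, ⟨(2, .se), (3, .se), (3, .ne), (2, .ne)⟩⟩]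
  family :=
    ![⟨.ofTable [2, 4, 0, 6, 1, 7, 3, 5] (by decide +kernel), dirs 4 15⟩,
      ⟨.ofTable [2, 4, 0, 6, 1, 7, 3, 5] (by decide +kernel), dirs 4 7⟩,
      ⟨.ofTable [2, 4, 0, 6, 7, 3, 5, 1] (by decide +kernel), dirs 4 3⟩,
      ⟨.ofTable [3, 7, 1, 5, 6, 0, 4, 2] (by decide +kernel), dirs 4 4⟩,
      ⟨.ofTable [2, 4, 0, 6, 7, 3, 5, 1] (by decide +kernel), dirs 4 5⟩]
  root :=
    ![(0, 15, [0, 2, 4, 6]), (0, 7, [0, 2, 4, 6]), (1, 3, [0, 2, 4, 6]), (1, 1, [4, 6, 0, 2]),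
      (1, 5, [0, 2, 4, 6])]
  terms :=
    ![[7, 11, 13, 14],
      [3, 5, 6, 15],
      [5, 6, 9, 10, 15],
      [1, 2, 7, 13, 14],
      [0, 3, 9, 12, 15]]

/-- The diagrams and configurations with 5 crossings. -/
def atlasFive : Atlas 5 6 12 where
  table := ![[2, 4, 0, 6, 1, 8, 3, 9, 5, 7],
      [2, 4, 0, 6, 1, 8, 9, 5, 7, 3],
      [2, 4, 0, 6, 7, 8, 9, 1, 5, 3],
      [2, 4, 0, 6, 8, 3, 9, 1, 7, 5],
      [2, 4, 5, 6, 8, 0, 9, 1, 7, 3],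
      [2, 4, 6, 1, 8, 0, 9, 3, 7, 5]]
  isTable := by decide +kernel
  start :=
    [(0, [0, 2, 4, 6, 8]), (1, [0, 2, 4, 6, 8]), (1, [2, 0, 6, 4, 9]), (1, [3, 6, 0, 9, 5]),
     (1, [6, 9, 5, 3, 1]), (1, [7, 5, 9, 1, 3]), (2, [0, 2, 4, 6, 8]), (2, [1, 4, 2, 7, 8]),
     (2, [2, 0, 6, 4, 9]), (2, [3, 6, 0, 9, 4]), (2, [6, 9, 1, 3, 5]), (3, [0, 2, 4, 6, 8]),
     (3, [1, 4, 2, 8, 6]), (3, [4, 8, 3, 7, 0]), (3, [5, 3, 8, 6, 0]), (3, [8, 7, 5, 1, 3]),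
     (4, [0, 2, 4, 6, 8]), (4, [1, 4, 2, 8, 6]), (4, [2, 5, 6, 0, 8]), (4, [4, 8, 0, 7, 3]),
     (4, [5, 0, 8, 2, 7]), (5, [0, 2, 4, 6, 8])]
  label :=
    ![[0, 0, 0, 0, 0, 0, 0, 0, 0, 0, 0, 0, 0, 0, 0, 2, 0, 0, 0, 0, 0, 0, 0, 2, 0, 0, 0, 2, 0, 2,
       2, 1],
      [0, 0, 0, 5, 0, 5, 5, 3, 0, 0, 0, 6, 0, 6, 6, 4, 0, 0, 0, 6, 0, 6, 6, 4, 0, 0, 0, 0, 0, 0,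
       0, 0],
      [0, 0, 0, 0, 0, 7, 7, 12, 0, 0, 0, 0, 0, 10, 10, 11, 0, 7, 7, 12, 0, 12, 12, 8, 0, 10, 10,
       11, 0, 11, 11, 9],
      [0, 4, 4, 3, 0, 6, 6, 5, 0, 6, 6, 5, 0, 0, 0, 0, 0, 6, 6, 5, 0, 0, 0, 0, 0, 0, 0, 0, 0, 0,
       0, 0],
      [9, 11, 8, 12, 11, 0, 12, 0, 11, 10, 12, 7, 10, 0, 7, 0, 11, 10, 12, 7, 10, 0, 7, 0, 0, 0,
       0, 0, 0, 0, 0, 0],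
      [1, 2, 2, 0, 2, 0, 0, 0, 2, 0, 0, 0, 0, 0, 0, 0, 2, 0, 0, 0, 0, 0, 0, 0, 0, 0, 0, 0, 0, 0,
       0, 0]]
  mirrorTo := ![(5, [4, 8, 1, 7, 2]), (3, [7, 9, 5, 3, 1]), (4, [2, 6, 0, 9, 4]),
      (1, [8, 5, 7, 3, 1]),
      (2, [7, 9, 1, 3, 4]), (0, [0, 4, 2, 8, 6])]
  reverseTo := ![(5, [0, 3, 5, 7, 9]), (3, [9, 7, 4, 2, 0]), (4, [1, 6, 3, 5, 8]),
      (1, [8, 5, 7, 0, 2]),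
      (2, [0, 4, 6, 3, 9]), (0, [0, 4, 2, 8, 6])]
  flypesTo :=
    ![[(0, [0, 2, 4, 6, 8])],
      [(1, [0, 2, 4, 6, 8]), (1, [0, 2, 4, 9, 7])],
      [(2, [0, 2, 4, 6, 8]), (2, [2, 0, 9, 7, 5])],
      [(3, [0, 2, 4, 6, 8]), (3, [0, 2, 7, 9, 4]), (3, [0, 2, 8, 5, 7]), (3, [0, 2, 8, 6, 4]),
       (3, [0, 2, 4, 9, 7])],
      [(4, [5, 2, 1, 6, 8]), (4, [0, 2, 4, 6, 8]), (4, [0, 2, 4, 9, 7])],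
      [(5, [0, 5, 8, 2, 7]), (5, [0, 9, 7, 5, 3]), (5, [0, 6, 3, 9, 4]), (5, [0, 2, 4, 6, 8]),
       (5, [0, 6, 4, 9, 3]), (5, [0, 6, 4, 2, 8]), (5, [0, 2, 8, 5, 7]), (5, [0, 2, 7, 9, 4]),
       (5, [0, 2, 8, 6, 4]), (5, [0, 9, 4, 2, 7]), (5, [0, 2, 4, 9, 7])]]
  flypes :=
    [⟨4, 4, [0, 2, 4, 9, 7], 7, ⟨(2, .nw), (1, .se), (0, .sw), (1, .sw)⟩,
      8, ⟨(3, .se), (3, .nw), (3, .sw), (3, .ne)⟩⟩,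
     ⟨3, 3, [2, 0, 9, 7, 5], 3, ⟨(0, .se), (1, .se), (0, .sw), (1, .sw)⟩,
      8, ⟨(3, .se), (3, .nw), (3, .sw), (3, .ne)⟩⟩,
     ⟨5, 5, [7, 1, 9, 4, 2], 2, ⟨(1, .nw), (1, .se), (1, .ne), (1, .sw)⟩,
      5, ⟨(0, .nw), (2, .nw), (2, .sw), (0, .sw)⟩⟩]
  family :=
    ![⟨.ofTable [2, 4, 0, 6, 1, 8, 3, 9, 5, 7] (by decide +kernel), dirs 5 31⟩,
      ⟨.ofTable [2, 4, 0, 6, 1, 8, 3, 9, 5, 7] (by decide +kernel), dirs 5 15⟩,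
      ⟨.ofTable [3, 9, 1, 7, 6, 8, 4, 0, 5, 2] (by decide +kernel), dirs 5 28⟩,
      ⟨.ofTable [3, 9, 1, 7, 6, 8, 4, 0, 5, 2] (by decide +kernel), dirs 5 29⟩,
      ⟨.ofTable [4, 2, 1, 8, 0, 6, 9, 3, 7, 5] (by decide +kernel), dirs 5 5⟩,
      ⟨.ofTable [4, 2, 1, 8, 0, 6, 9, 3, 7, 5] (by decide +kernel), dirs 5 13⟩,
      ⟨.ofTable [2, 8, 0, 4, 7, 1, 9, 3, 5, 6] (by decide +kernel), dirs 5 17⟩,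
      ⟨.ofTable [2, 6, 0, 4, 9, 1, 5, 8, 7, 3] (by decide +kernel), dirs 5 27⟩,
      ⟨.ofTable [2, 6, 0, 4, 9, 1, 5, 8, 7, 3] (by decide +kernel), dirs 5 31⟩,
      ⟨.ofTable [2, 8, 0, 4, 7, 1, 9, 3, 5, 6] (by decide +kernel), dirs 5 21⟩,
      ⟨.ofTable [2, 8, 0, 4, 7, 1, 9, 3, 5, 6] (by decide +kernel), dirs 5 23⟩,
      ⟨.ofTable [2, 8, 0, 4, 7, 1, 9, 3, 5, 6] (by decide +kernel), dirs 5 19⟩]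
  root :=
    ![(0, 31, [0, 2, 4, 6, 8]), (0, 15, [0, 2, 4, 6, 8]), (1, 7, [6, 8, 0, 2, 4]),
      (1, 15, [6, 8, 0, 2, 4]), (1, 3, [0, 4, 2, 6, 8]), (1, 11, [0, 4, 2, 6, 8]),
      (2, 5, [0, 2, 6, 8, 4]), (2, 23, [0, 2, 6, 4, 8]), (2, 31, [0, 2, 6, 4, 8]),
      (2, 13, [0, 2, 6, 8, 4]), (2, 15, [0, 2, 6, 8, 4]), (2, 7, [0, 2, 6, 8, 4])]
  terms :=
    ![[15, 23, 27, 29, 30],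
      [7, 11, 13, 14, 31],
      [13, 14, 21, 22, 25, 26, 31],
      [12, 15, 20, 23, 24, 27, 30],
      [9, 12, 15, 17, 20, 23, 29],
      [1, 4, 7, 21, 25, 28, 31],
      [0, 3, 5, 20, 23, 24, 27, 29],
      [9, 10, 15, 17, 18, 23, 29, 30],
      [11, 13, 14, 19, 21, 22, 25, 26],
      [1, 4, 7, 16, 19, 25, 28, 31],
      [3, 5, 6, 17, 18, 27, 29, 30],
      [1, 2, 7, 21, 22, 25, 26, 31]]

/-! ### Verification of the atlases by computation -/

theorem atlasOne_isValid : atlasOne.IsValid where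
  table_length := by decide +kernel
  table_lt := by decide +kernel
  spherical := by decide +kernel
  cutFree := by decide +kernel
  start_injective := by decide +kernel
  search := by decide +kernel
  mirror_iso := by decide +kernel
  mirror_carries := by decide +kernel
  reverse_iso := by decide +kernel
  reverse_carries := by decide +kernel
  allFlypes := by decide +kernel
  flypes_carries := by decide +kernel
  flypes_isSingle := by decide +kernel
  not_weaklyMerges := by decide +kernel
  isFlype := by decide +kernel
  exists_reach := by decide +kernel
  root_injective := by decide +kernel
  root_lt := by decide +kernel
  root_lab := by decide +kernel
  root_iso := by decide +kernel
  root_dir := by decide +kernel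
  family_noCurl := by decide +kernel
  terms_nodup := by decide +kernel
  terms_lt := by decide +kernel
  terms_iff := by decide +kernel

theorem atlasTwo_isValid : atlasTwo.IsValid where
  table_length := by decide +kernel
  table_lt := by decide +kernel
  spherical := by decide +kernel
  cutFree := by decide +kernel
  start_injective := by decide +kernel
  search := by decide +kernel
  mirror_iso := by decide +kernel
  mirror_carries := by decide +kernel
  reverse_iso := by decide +kernel
  reverse_carries := by decide +kernel
  allFlypes := by decide +kernel
  flypes_carries := by decide +kernel
  flypes_isSingle := by decide +kernel
  not_weaklyMerges := by decide +kernel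
  isFlype := by decide +kernel
  exists_reach := by decide +kernel
  root_injective := by decide +kernel
  root_lt := by decide +kernel
  root_lab := by decide +kernel
  root_iso := by decide +kernel
  root_dir := by decide +kernel
  family_noCurl := by decide +kernel
  terms_nodup := by decide +kernel
  terms_lt := by decide +kernel
  terms_iff := by decide +kernel

theorem atlasThree_isValid : atlasThree.IsValid where
  table_length := by decide +kernel
  table_lt := by decide +kernel
  spherical := by decide +kernel
  cutFree := by decide +kernel
  start_injective := by decide +kernel
  search := by decide +kernel
  mirror_iso := by decide +kernel
  mirror_carries := by decide +kernel
  reverse_iso := by decide +kernel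
  reverse_carries := by decide +kernel
  allFlypes := by decide +kernel
  flypes_carries := by decide +kernel
  flypes_isSingle := by decide +kernel
  not_weaklyMerges := by decide +kernel
  isFlype := by decide +kernel
  exists_reach := by decide +kernel
  root_injective := by decide +kernel
  root_lt := by decide +kernel
  root_lab := by decide +kernel
  root_iso := by decide +kernel
  root_dir := by decide +kernel
  family_noCurl := by decide +kernel
  terms_nodup := by decide +kernel
  terms_lt := by decide +kernel
  terms_iff := by decide +kernel

theorem atlasFour_isValid : atlasFour.IsValid where
  table_length := by decide +kernel
  table_lt := by decide +kernel
  spherical := by decide +kernel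
  cutFree := by decide +kernel
  start_injective := by decide +kernel
  search := by decide +kernel
  mirror_iso := by decide +kernel
  mirror_carries := by decide +kernel
  reverse_iso := by decide +kernel
  reverse_carries := by decide +kernel
  allFlypes := by decide +kernel
  flypes_carries := by decide +kernel
  flypes_isSingle := by decide +kernel
  not_weaklyMerges := by decide +kernel
  isFlype := by decide +kernel
  exists_reach := by decide +kernel
  root_injective := by decide +kernel
  root_lt := by decide +kernel
  root_lab := by decide +kernel
  root_iso := by decide +kernel
  root_dir := by decide +kernel
  family_noCurl := by decide +kernel
  terms_nodup := by decide +kernel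
  terms_lt := by decide +kernel
  terms_iff := by decide +kernel

set_option maxHeartbeats 4000000 in
theorem atlasFive_isValid : atlasFive.IsValid where
  table_length := by decide +kernel
  table_lt := by decide +kernel
  spherical := by decide +kernel
  cutFree := by decide +kernel
  start_injective := by decide +kernel
  search := by decide +kernel
  mirror_iso := by decide +kernel
  mirror_carries := by decide +kernel
  reverse_iso := by decide +kernel
  reverse_carries := by decide +kernel
  allFlypes := by decide +kernel
  flypes_carries := by decide +kernel
  flypes_isSingle := by decide +kernel
  not_weaklyMerges := by decide +kernel
  isFlype := by decide +kernel
  exists_reach := by decide +kernel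
  root_injective := by decide +kernel
  root_lt := by decide +kernel
  root_lab := by decide +kernel
  root_iso := by decide +kernel
  root_dir := by decide +kernel
  family_noCurl := by decide +kernel
  terms_nodup := by decide +kernel
  terms_lt := by decide +kernel
  terms_iff := by decide +kernel

/-! ### The standard diagrams -/

theorem Diagram.iso_of_bijective {V W : Type} {D : Diagram V} {D' : Diagram W} (f : V → W)
    (r : V → Bool) (hf : Function.Bijective f)
    (h : ∀ v o, D'.edge (f v, if r v then o.opp else o) = (f (D.edge (v, o)).1,
      if r (D.edge (v, o)).1 then (D.edge (v, o)).2.opp else (D.edge (v, o)).2)) : D.Iso D' :=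
  ⟨Equiv.ofBijective f hf, r, h⟩

theorem atlasOne_same (i : Fin 2) :
    (atlasOne.diagram i).Same (torusLink 1).2 := by
  fin_cases i
  · exact .inr <| .inl <|
      show (atlasOne.diagram 0).mirror.Iso (ring 1) from
        Diagram.iso_of_bijective ![0]
          ![false] (by decide +kernel) (by decide +kernel)
  · exact .inl <|
      show (atlasOne.diagram 1).Iso (ring 1) from
        Diagram.iso_of_bijective ![0]
          ![false] (by decide +kernel) (by decide +kernel)

theorem atlasTwo_same (i : Fin 1) :
    (atlasTwo.diagram i).Same (torusLink 2).2 := by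
  fin_cases i
  · exact .inl <|
      show (atlasTwo.diagram 0).Iso (ring 2) from
        Diagram.iso_of_bijective ![0, 1]
          ![false, true] (by decide +kernel) (by decide +kernel)

theorem atlasThree_same (i : Fin 2) :
    (atlasThree.diagram i).Same (torusLink 3).2 := by
  fin_cases i
  · exact .inl <|
      show (atlasThree.diagram 0).Iso (ring 3) from
        Diagram.iso_of_bijective ![0, 1, 2]
          ![false, true, false] (by decide +kernel) (by decide +kernel)
  · exact .inr <| .inl <|
      show (atlasThree.diagram 1).mirror.Iso (ring 3) from
        Diagram.iso_of_bijective ![0, 2, 1]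
          ![false, false, true] (by decide +kernel) (by decide +kernel)

theorem atlasFour_same (i : Fin 3) :
    (atlasFour.diagram i).Same 
      ((![torusLink 4, knotFourOne, torusLink 4] : Fin 3 → _) i).2 := by
  fin_cases i
  · exact .inl <|
      show (atlasFour.diagram 0).Iso (ring 4) from
        Diagram.iso_of_bijective ![0, 1, 3, 2]
          ![false, true, false, true] (by decide +kernel) (by decide +kernel)
  · exact .inl <|
      show (atlasFour.diagram 1).Iso
          ((Config.mk (ring 2) ![.vertical, .horizontal]).expand ![2, 2]) from
        Diagram.iso_of_bijective
          ![⟨0, 0, by decide⟩, ⟨0, 1, by decide⟩, ⟨1, 1, by decide⟩,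
            ⟨1, 0, by decide⟩]
          ![false, true, false, true] (by decide +kernel) (by decide +kernel)
  · exact .inr <| .inl <|
      show (atlasFour.diagram 2).mirror.Iso (ring 4) from
        Diagram.iso_of_bijective ![0, 3, 1, 2]
          ![false, false, true, false] (by decide +kernel) (by decide +kernel)

theorem atlasFive_same (i : Fin 6) :
    (atlasFive.diagram i).Same 
      ((![torusLink 5, knotFiveTwo, whiteheadLink, knotFiveTwo, whiteheadLink,
        torusLink 5] : Fin 6 → _) i).2 := by
  fin_cases i
  · exact .inl <|
      show (atlasFive.diagram 0).Iso (ring 5) from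
        Diagram.iso_of_bijective ![0, 1, 4, 2, 3]
          ![false, true, false, true, false] (by decide +kernel) (by decide +kernel)
  · exact .inl <|
      show (atlasFive.diagram 1).Iso
          ((Config.mk (ring 2) ![.vertical, .horizontal]).expand ![3, 2]) from
        Diagram.iso_of_bijective
          ![⟨0, 1, by decide⟩, ⟨0, 0, by decide⟩, ⟨0, 2, by decide⟩,
            ⟨1, 1, by decide⟩, ⟨1, 0, by decide⟩]
          ![true, false, true, false, true] (by decide +kernel) (by decide +kernel)
  · exact .inr <| .inl <|
      show (atlasFive.diagram 2).mirror.Iso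
          ((Config.mk (ring 3) ![.horizontal, .vertical, .horizontal]).expand ![2, 1, 2]) from
        Diagram.iso_of_bijective
          ![⟨0, 1, by decide⟩, ⟨0, 0, by decide⟩, ⟨2, 1, by decide⟩,
            ⟨1, 0, by decide⟩, ⟨2, 0, by decide⟩]
          ![true, false, false, true, false] (by decide +kernel) (by decide +kernel)
  · exact .inr <| .inl <|
      show (atlasFive.diagram 3).mirror.Iso
          ((Config.mk (ring 2) ![.vertical, .horizontal]).expand ![3, 2]) from
        Diagram.iso_of_bijective
          ![⟨1, 0, by decide⟩, ⟨1, 1, by decide⟩, ⟨0, 0, by decide⟩,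
            ⟨0, 2, by decide⟩, ⟨0, 1, by decide⟩]
          ![false, true, true, false, true] (by decide +kernel) (by decide +kernel)
  · exact .inl <|
      show (atlasFive.diagram 4).Iso
          ((Config.mk (ring 3) ![.horizontal, .vertical, .horizontal]).expand ![2, 1, 2]) from
        Diagram.iso_of_bijective
          ![⟨0, 0, by decide⟩, ⟨1, 0, by decide⟩, ⟨0, 1, by decide⟩,
            ⟨2, 0, by decide⟩, ⟨2, 1, by decide⟩]
          ![false, true, true, true, false] (by decide +kernel) (by decide +kernel)
  · exact .inr <| .inl <|
      show (atlasFive.diagram 5).mirror.Iso (ring 5) from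
        Diagram.iso_of_bijective ![0, 4, 1, 3, 2]
          ![false, false, true, false, true] (by decide +kernel) (by decide +kernel)

end AltKnot

/-! ### Assembly of the classification -/

open AltKnot in
theorem mainTheorem8 :
    -- one ribbon
    (∃ fam : Fin 1 → Config (Fin 1),
      Classifies fam ![fun a => a 0] ![1] ![torusLink 1]) ∧
    -- two ribbons, orthogonal to each other
    (∃ fam : Fin 1 → Config (Fin 2),
      Classifies fam ![fun a => 1 + a 0 * a 1] ![2] ![torusLink 2] ∧
      (fam 0).dir 0 ≠ (fam 0).dir 1) ∧
    -- three ribbons: three parallel ones; two parallel ones and one orthogonal to them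
    (∃ fam : Fin 2 → Config (Fin 3),
      Classifies fam
        ![fun a => a 0 * a 1 + a 1 * a 2 + a 2 * a 0,
          fun a => a 0 * a 1 * a 2 + a 0 + a 2]
        ![3, 3]
        ![torusLink 3, torusLink 3] ∧
      ((fam 0).dir 0 = (fam 0).dir 1 ∧ (fam 0).dir 1 = (fam 0).dir 2) ∧
      ((fam 1).dir 0 = (fam 1).dir 2 ∧ (fam 1).dir 0 ≠ (fam 1).dir 1)) ∧
    -- four ribbons: two families for the Solomon knot and three for the knot `4_1`
    (∃ fam : Fin 5 → Config (Fin 4),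
      Classifies fam
        ![fun a => a 0 * a 1 * a 2 + a 1 * a 2 * a 3 + a 2 * a 3 * a 0 + a 3 * a 0 * a 1,
          fun a => a 0 * a 1 * a 2 * a 3 + a 0 * a 1 + a 1 * a 2 + a 2 * a 0,
          fun a => a 0 * a 1 * a 2 * a 3 + (a 0 + a 1) * (a 2 + a 3),
          fun a => a 0 * a 1 * a 2 + (a 0 + a 1) * (a 2 * a 3 + 1),
          fun a => a 0 * a 1 * a 2 * a 3 + a 0 * a 1 + a 2 * a 3 + a 0 * a 3 + 1]
        ![4, 4, 5, 5, 5]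
        ![torusLink 4, torusLink 4, knotFourOne, knotFourOne, knotFourOne] ∧
      -- four parallel ribbons
      ((fam 0).dir 0 = (fam 0).dir 1 ∧ (fam 0).dir 1 = (fam 0).dir 2 ∧
        (fam 0).dir 2 = (fam 0).dir 3) ∧
      -- three parallel ribbons and one orthogonal to them
      ((fam 1).dir 0 = (fam 1).dir 1 ∧ (fam 1).dir 1 = (fam 1).dir 2 ∧
        (fam 1).dir 2 ≠ (fam 1).dir 3) ∧
      -- a tangle of two parallel ribbons, and one of two parallel ribbons orthogonal to the former
      ((fam 2).diagram.FormTangle {0, 1} ∧ (fam 2).diagram.FormTangle {2, 3} ∧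
        (fam 2).dir 0 = (fam 2).dir 1 ∧ (fam 2).dir 2 = (fam 2).dir 3 ∧
        (fam 2).dir 0 ≠ (fam 2).dir 2) ∧
      -- a tangle of two parallel ribbons, and a tangle of two orthogonal ribbons
      ((fam 3).diagram.FormTangle {0, 1} ∧ (fam 3).diagram.FormTangle {2, 3} ∧
        (fam 3).dir 0 = (fam 3).dir 1 ∧ (fam 3).dir 0 = (fam 3).dir 3 ∧
        (fam 3).dir 0 ≠ (fam 3).dir 2) ∧
      -- two tangles of two orthogonal ribbons
      ((fam 4).diagram.FormTangle {0, 1} ∧ (fam 4).diagram.FormTangle {2, 3} ∧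
        (fam 4).dir 0 ≠ (fam 4).dir 1 ∧ (fam 4).dir 2 ≠ (fam 4).dir 3)) ∧
    -- five ribbons: two families for `5_1`, four for `5_2` and six for the Whitehead link
    (∃ fam : Fin 12 → Config (Fin 5),
      Classifies fam
        ![fun a => a 0 * a 1 * a 2 * a 3 + a 1 * a 2 * a 3 * a 4 + a 2 * a 3 * a 4 * a 0 +
            a 3 * a 4 * a 0 * a 1 + a 4 * a 0 * a 1 * a 2,
          fun a => a 0 * a 1 * a 2 + a 1 * a 2 * a 3 + a 2 * a 3 * a 0 + a 3 * a 0 * a 1 +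
            a 0 * a 1 * a 2 * a 3 * a 4,
          fun a => (a 0 + a 1) * (a 2 * a 3 + a 3 * a 4 + a 4 * a 2) +
            a 0 * a 1 * a 2 * a 3 * a 4,
          fun a => (a 0 * a 1 + 1) * (a 2 * a 3 + a 3 * a 4 + a 4 * a 2) + a 1 * a 2 * a 3 * a 4,
          fun a => (a 0 + a 2 + a 0 * a 1 * a 2) * (a 3 + a 4) + a 0 * a 2 * a 3 * a 4,
          fun a => (a 0 + a 2 + a 0 * a 1 * a 2) * (1 + a 3 * a 4) + a 0 * a 2 * a 4,
          fun a => 1 + a 0 * (a 1 + a 2) + (a 2 + a 3) * a 4 +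
            a 0 * (a 1 * a 2 + a 2 * a 3 + a 3 * a 1) * a 4,
          fun a => (a 0 + a 1) * (a 3 + a 4) + a 0 * a 1 * a 2 * (a 3 + a 4) +
            (a 0 + a 1) * a 2 * a 3 * a 4,
          fun a => (a 0 + a 1) * a 2 * (a 3 + a 4) + a 0 * a 1 * (a 3 + a 4) +
            (a 0 + a 1) * a 3 * a 4,
          fun a => a 0 + a 4 + a 0 * (a 1 + a 3) * a 4 + (a 0 * a 1 + 1) * a 2 * (a 3 * a 4 + 1),
          fun a => (a 0 + a 1) * (a 2 * a 3 * a 4 + a 2 + a 4) + a 0 * a 1 * (1 + a 3 * a 4),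
          fun a => (a 0 * a 1 * a 2 + a 0 + a 1) * (1 + a 3 * a 4) + (a 0 + a 1) * a 2 * a 4]
        ![5, 5, 7, 7, 7, 7, 8, 8, 8, 8, 8, 8]
        ![torusLink 5, torusLink 5, knotFiveTwo, knotFiveTwo, knotFiveTwo, knotFiveTwo,
          whiteheadLink, whiteheadLink, whiteheadLink, whiteheadLink, whiteheadLink,
          whiteheadLink]) := by
  refine ⟨⟨atlasOne.family, atlasOne_isValid.classifies ?_ ?_ ?_ ?_⟩,
    ⟨atlasTwo.family, atlasTwo_isValid.classifies ?_ ?_ ?_ ?_, by decide +kernel⟩,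
    ⟨atlasThree.family, atlasThree_isValid.classifies ?_ ?_ ?_ ?_, by decide +kernel⟩,
    ⟨atlasFour.family, atlasFour_isValid.classifies ?_ ?_ ?_ ?_, by decide +kernel,
      by decide +kernel, ⟨?_, ?_, by decide +kernel⟩, ⟨?_, ?_, by decide +kernel⟩,
      ⟨?_, ?_, by decide +kernel⟩⟩,
    ⟨atlasFive.family, atlasFive_isValid.classifies ?_ ?_ ?_ ?_⟩⟩
  -- The factored polynomials of the statement are compared with the sums of monomials given by the
  -- masks in `terms`.
  · intro k a
    fin_cases k
    simp [atlasOne]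
  · decide
  · decide
  · intro i k _
    fin_cases k
    exact atlasOne_same i
  · intro k a
    fin_cases k
    simp [atlasTwo, Fin.prod_univ_succ, Nat.testBit_eq_decide_div_mod_eq]
  · decide
  · decide
  · intro i k _
    fin_cases k
    exact atlasTwo_same i
  · intro k a
    fin_cases k <;> simp [atlasThree, Fin.prod_univ_succ, Nat.testBit_eq_decide_div_mod_eq] <;> ring
  · decide
  · decide
  · intro i k _
    fin_cases k <;> exact atlasThree_same i
  · intro k a
    fin_cases k <;> simp [atlasFour, Fin.prod_univ_succ, Nat.testBit_eq_decide_div_mod_eq] <;> ring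
  · decide
  · decide +kernel
  -- Either no choice of directions on diagram `i` carries the label of family `k`, which refutes
  -- `hk`, or the standard diagrams for `i` and `k` coincide.
  · intro i k hk
    have h := atlasFour_same i
    fin_cases i <;> fin_cases k <;> first | exact absurd hk (by decide +kernel) | exact h
  -- The masks 3 and 12 are the sets `{0, 1}` and `{2, 3}`.
  · exact ⟨_, _, _, _, Diagram.TangleWith.isTangle (m := 3)
      (e := ⟨(0, .se), (1, .se), (0, .sw), (1, .sw)⟩) (by decide +kernel) (by decide)⟩
  · exact ⟨_, _, _, _, Diagram.TangleWith.isTangle (m := 12)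
      (e := ⟨(2, .se), (3, .se), (3, .ne), (2, .ne)⟩) (by decide +kernel) (by decide)⟩
  · exact ⟨_, _, _, _, Diagram.TangleWith.isTangle (m := 3)
      (e := ⟨(0, .se), (1, .se), (1, .ne), (0, .ne)⟩) (by decide +kernel) (by decide)⟩
  · exact ⟨_, _, _, _, Diagram.TangleWith.isTangle (m := 12)
      (e := ⟨(2, .se), (3, .se), (2, .sw), (3, .sw)⟩) (by decide +kernel) (by decide)⟩
  · exact ⟨_, _, _, _, Diagram.TangleWith.isTangle (m := 3)
      (e := ⟨(0, .se), (1, .se), (0, .sw), (1, .sw)⟩) (by decide +kernel) (by decide)⟩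
  · exact ⟨_, _, _, _, Diagram.TangleWith.isTangle (m := 12)
      (e := ⟨(2, .se), (3, .se), (3, .ne), (2, .ne)⟩) (by decide +kernel) (by decide)⟩
  · intro k a
    fin_cases k <;>
      simp [atlasFive, Fin.prod_univ_succ, Nat.testBit_eq_decide_div_mod_eq] <;> ring
  · decide +kernel
  · decide +kernel
  · intro i k hk
    have h := atlasFive_same i
    fin_cases i <;> fin_cases k <;> first | exact absurd hk (by decide +kernel) | exact h
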